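/- Let $r\in\mathbb R$, $\sigma>0$, $T>0$, and let $S_t=S_0\exp((r-\sigma^2/2)t+\sigma W_t)$ be the geometric Brownian motion $dS_t=rS_t\,dt+\sigma S_t\,dW_t$, where $W$ is a standard Brownian motion independent of the initial price $S_0>0$, $S_0\sim\pi_0$. Its $n$-step binomial option pricing model has step size $h=T/n$ and prices $S_{k+1}=S_kY_{k+1}$ with $Y_1,\dots,Y_n$ i.i.d., independent of $S_0$, $\Pr(Y_k=U)=p=1-\Pr(Y_k=D)$, where either (Cox–Ross–Rubinstein) $U=e^{\sigma\sqrt h}$, $D=e^{-\sigma\sqrt h}$, $p=(e^{rh}-D)/(U-D)$, or (Jarrow–Rudd) $U=e^{(r-\sigma^2/2)h+\sigma\sqrt h}$, $D=e^{(r-\sigma^2/2)h-\sigma\sqrt h}$, $p=1/2$; to distinguish the two processes, write $\widehat S_n$ for its terminal price. Let $\psi$ be a piecewise constant payoff with breakpoints $\overline S_0<\dots<\overline S_m$: it equals a constant $\psi_L$ on $(-\infty,\overline S_0)$, $\psi_j$ on $[\overline S_{j-1},\overline S_j)$ for $1\le j\le m$, and $\psi_R$ on $[\overline S_m,\infty)$.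 Let $|\psi|\le M$; in particular the variance of $\psi(\widehat S_n)$ is bounded independently of $h$. The payoff and $\pi_0$ are accessible only through quantum oracles. A unitary $O_I$ on $q$ qubits, which may be used together with its inverse, prepares the initial price: measuring $O_I|0\rangle$ in the computational basis yields a label $i\in\{0,1\}^q$, and the price $s_i>0$ attached to it has law $\pi_0$. The payoff oracle is $U_\psi|i\rangle|k\rangle|y\rangle=|i\rangle|k\rangle|y\oplus\psi(U^kD^{n-k}s_i)\rangle$ for $0\le k\le n$ (identity for $k>n$), where the value of $\psi$ is written in two's complement fixed-point binary with a number of bits chosen by the algorithm, rounded down. A quantum algorithm with accuracy $\epsilon$ is a choice of $n$ and of a quantum circuit composed of arbitrary one- and two-qubit gates and of calls to $O_I$, $O_I^{-1}$, $U_\psi$; it starts in the all-zero state, and at the end all qubits are measured and a designated register is read as a fixed-point binary number. Its cost is the total number of gates and oracle calls. **Theorem.** For each of the two lattices and all $r,\sigma,T,M$ as above there are constants $K$ and $c$ such that for all $m\ge0$, $q\ge0$ and $0<\epsilon\le 1/2$ there are $n\ge1$ (with $p\in[0,1]$) and a quantum circuit of cost at most $$K\,\epsilon^{-1}\bigl(q+\log((m+2)/\epsilon)\bigr)^c,$$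 that is $\widetilde O(\epsilon^{-1})$, such that for every piecewise constant payoff $\psi$ with $m+1$ breakpoints and $|\psi|\le M$, every $O_I$ and all prices $s_i>0$, its output is within $\epsilon$ of the option price $\mathbb E[e^{-rT}\psi(S_T)]$ with probability at least $0.99$, and within $\epsilon$ of the price $\mathbb E[e^{-rT}\psi(\widehat S_n)]$ in the $n$-step binomial model with probability at least $0.99$. -/

import Mathlib

open MeasureTheory ProbabilityTheory
open scoped NNReal ENNReal

namespace OptionPricing

noncomputable section

/-! ### Market model: payoff, geometric Brownian motion, binomial lattice -/

/-- A piecewise constant payoff with breakpoints `S̄_0 < ⋯ < S̄_m`: it takes the value `value 0` on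
`(-∞, S̄_0)`, the value `value j` on `[S̄_{j-1}, S̄_j)` and the value `value (m+1)` on `[S̄_m, ∞)`. -/
structure PiecewiseConstantPayoff (m : ℕ) where
  breakpoint : Fin (m + 1) → ℝ
  strictMono : StrictMono breakpoint
  value : Fin (m + 2) → ℝ

/-- The piece containing `s`, i.e. the number of breakpoints `≤ s`. -/
def PiecewiseConstantPayoff.piece {m : ℕ} (ψ : PiecewiseConstantPayoff m) (s : ℝ) : Fin (m + 2) :=
  ⟨(Finset.univ.filter fun j => ψ.breakpoint j ≤ s).card, by
    have h := Finset.card_filter_le (Finset.univ : Finset (Fin (m + 1)))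
      (fun j => ψ.breakpoint j ≤ s)
    simp only [Finset.card_univ, Fintype.card_fin] at h
    omega⟩

/-- The payoff as a function of the terminal price. -/
def PiecewiseConstantPayoff.eval {m : ℕ} (ψ : PiecewiseConstantPayoff m) (s : ℝ) : ℝ :=
  ψ.value (ψ.piece s)

/-- Geometric Brownian motion `dS_t = r S_t dt + σ S_t dW_t` started from `S₀`, driven by `W`. -/
def geometricBrownianMotion {Ω : Type*} (r σ : ℝ) (S₀ : Ω → ℝ) (W : ℝ≥0 → Ω → ℝ)
    (t : ℝ≥0) (ω : Ω) : ℝ :=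
  S₀ ω * Real.exp ((r - σ ^ 2 / 2) * t + σ * W t ω)

/-- The two lattices: Cox-Ross-Rubinstein and (equal probabilities) Jarrow-Rudd. -/
inductive Lattice
  | crr
  | jr

/-- The up factor `U` for the step size `h`. -/
def Lattice.up (L : Lattice) (r σ h : ℝ) : ℝ :=
  match L with
  | .crr => Real.exp (σ * √h)
  | .jr => Real.exp ((r - σ ^ 2 / 2) * h + σ * √h)

/-- The down factor `D` for the step size `h`. -/
def Lattice.down (L : Lattice) (r σ h : ℝ) : ℝ :=
  match L with
  | .crr => Real.exp (-(σ * √h))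
  | .jr => Real.exp ((r - σ ^ 2 / 2) * h - σ * √h)

/-- The probability `p` of an up step for the step size `h`. -/
def Lattice.upProb (L : Lattice) (r σ h : ℝ) : ℝ :=
  match L with
  | .crr => (Real.exp (r * h) - Lattice.crr.down r σ h) /
      (Lattice.crr.up r σ h - Lattice.crr.down r σ h)
  | .jr => 1 / 2

/-- The expectation of `f (S_n)` in the `n`-step binomial model on `[0, T]` with `S_0 = s`:
`S_n = s * Y_1 * ⋯ * Y_n`, where the `Y_k` are independent, equal to `U` with probability `p` and
to `D` with probability `1 - p`, and the step size is `h = T / n`. -/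
def binomialExpectation (L : Lattice) (r σ T : ℝ) (n : ℕ) (f : ℝ → ℝ) (s : ℝ) : ℝ :=
  ∑ y : Fin n → Bool,
    (∏ k, if y k then L.upProb r σ (T / n) else 1 - L.upProb r σ (T / n)) *
      f (s * ∏ k, if y k then L.up r σ (T / n) else L.down r σ (T / n))

/-! ### Quantum circuits with oracles -/

/-- The natural number with binary digits `x` (least significant digit first). -/
def natOfBits {t : ℕ} (x : Fin t → Bool) : ℕ := ∑ j, if x j then 2 ^ (j : ℕ) else 0

/-- The integer whose two's complement representation is `x` (least significant digit first). -/
def intOfBits {t : ℕ} (x : Fin t → Bool) : ℤ :=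
  ∑ j : Fin t, if x j then (if (j : ℕ) + 1 = t then -2 ^ (j : ℕ) else 2 ^ (j : ℕ)) else 0

/-- The (unnormalized) pure states of the qubits indexed by `ι`: amplitudes in the computational
basis. -/
abbrev QState (ι : Type) : Type := (ι → Bool) → ℂ

/-- The operators on the qubits indexed by `ι`. -/
abbrev QMatrix (ι : Type) : Type := Matrix (ι → Bool) (ι → Bool) ℂ

/-- Apply `U` to the qubits in the image of `e`, and the identity to all others.
`Function.extend e z x` is `x` with the contents of the register `e` replaced by `z`. -/
def applyOn {ι : Type} [Fintype ι] [DecidableEq ι] {N : ℕ} (e : ι ↪ Fin N) (U : QMatrix ι)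
    (φ : QState (Fin N)) : QState (Fin N) :=
  fun x => ∑ z : ι → Bool, U (x ∘ e) z * φ (Function.extend e z x)

/-- The operations at unit cost on `N` qubits: one- and two-qubit gates, the oracle preparing the
initial price (a register of `q` qubits) and its inverse, and the payoff oracle, which acts on a
register of `q` qubits for the initial price, one of `t` qubits for the number of up steps and one
of `w` qubits for the payoff. -/
inductive Gate (q t w N : ℕ)
  | oneQubit (e : Fin 1 ↪ Fin N) (u : Matrix.unitaryGroup (Fin 1 → Bool) ℂ)
  | twoQubit (e : Fin 2 ↪ Fin N) (u : Matrix.unitaryGroup (Fin 2 → Bool) ℂ)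
  | initial (e : Fin q ↪ Fin N)
  | initialInv (e : Fin q ↪ Fin N)
  | payoff (e : (Fin q ⊕ Fin t) ⊕ Fin w ↪ Fin N)

/-- The unitary `|i⟩|k⟩|y⟩ ↦ |i⟩|k⟩|y ⊕ f i k⟩`. -/
def xorOracle {q t w : ℕ} (f : (Fin q → Bool) → (Fin t → Bool) → Fin w → Bool) :
    QMatrix ((Fin q ⊕ Fin t) ⊕ Fin w) :=
  fun x z =>
    if x = Sum.elim (z ∘ Sum.inl)
        (fun j => xor (z (Sum.inr j)) (f (z ∘ Sum.inl ∘ Sum.inl) (z ∘ Sum.inl ∘ Sum.inr) j))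
    then 1 else 0

/-- The action of a gate, given the initial price oracle `V` and the payoff table `f`. -/
def Gate.apply {q t w N : ℕ} (V : Matrix.unitaryGroup (Fin q → Bool) ℂ)
    (f : (Fin q → Bool) → (Fin t → Bool) → Fin w → Bool) :
    Gate q t w N → QState (Fin N) → QState (Fin N)
  | .oneQubit e u => applyOn e u.1
  | .twoQubit e u => applyOn e u.1
  | .initial e => applyOn e V.1
  | .initialInv e => applyOn e (V⁻¹).1
  | .payoff e => applyOn e (xorOracle f)

/-- A quantum circuit for option pricing. It fixes the number `steps` of steps of the binomial
model that the payoff oracle refers to and the fixed-point format (`width` bits, `frac` of them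
after the binary point) in which the payoff oracle writes its values. After the gates have been
applied to the all-zero state, all qubits are measured in the computational basis, and the output is
the number that the qubits `out` represent in two's complement with `outFrac` bits after the
binary point. -/
structure PricingCircuit (q : ℕ) where
  steps : ℕ
  width : ℕ
  frac : ℕ
  qubits : ℕ
  gates : List (Gate q steps.size width qubits)
  outWidth : ℕ
  outFrac : ℕ
  out : Fin outWidth ↪ Fin qubits

/-- The cost: the total number of elementary gates and oracle calls. -/
def PricingCircuit.cost {q : ℕ} (A : PricingCircuit q) : ℕ := A.gates.length

/-- The table of the payoff oracle `|i⟩|k⟩|0⟩ ↦ |i⟩|k⟩|ψ(U^k D^{n-k} s_i)⟩`, where `s_i` is the initial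
price with label `i`: the payoff is rounded down to `A.frac` binary places and written in two's
complement. For `k > n` the oracle does nothing. -/
def PricingCircuit.payoffTable {q : ℕ} (A : PricingCircuit q) (L : Lattice) (r σ T : ℝ)
    (ψ : ℝ → ℝ) (price : (Fin q → Bool) → ℝ)
    (i : Fin q → Bool) (k : Fin A.steps.size → Bool) (j : Fin A.width) : Bool :=
  if natOfBits k ≤ A.steps then
    Int.testBit ⌊2 ^ A.frac * ψ (L.up r σ (T / A.steps) ^ natOfBits k *
      L.down r σ (T / A.steps) ^ (A.steps - natOfBits k) * price i)⌋ j
  else false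

/-- The state before the measurement. -/
def PricingCircuit.finalState {q : ℕ} (A : PricingCircuit q)
    (V : Matrix.unitaryGroup (Fin q → Bool) ℂ)
    (f : (Fin q → Bool) → (Fin A.steps.size → Bool) → Fin A.width → Bool) :
    QState (Fin A.qubits) :=
  A.gates.foldl (fun φ g => g.apply V f φ) (Pi.single (fun _ => false) 1)

/-- The number that is output when the measurement result is `x`. -/
def PricingCircuit.output {q : ℕ} (A : PricingCircuit q) (x : Fin A.qubits → Bool) : ℝ :=
  (intOfBits (x ∘ A.out) : ℝ) / 2 ^ A.outFrac

open Classical in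
/-- The probability that the output of the circuit lies within `ε` of `v`. -/
def PricingCircuit.successProb {q : ℕ} (A : PricingCircuit q)
    (V : Matrix.unitaryGroup (Fin q → Bool) ℂ)
    (f : (Fin q → Bool) → (Fin A.steps.size → Bool) → Fin A.width → Bool) (v ε : ℝ) : ℝ :=
  ∑ x : Fin A.qubits → Bool, if |A.output x - v| ≤ ε then ‖A.finalState V f x‖ ^ 2 else 0

/-! ### The initial distribution given by its oracle -/

/-- The probability of the label `i` when `V|0⟩` is measured in the computational basis. -/
def initialProb {q : ℕ} (V : Matrix.unitaryGroup (Fin q → Bool) ℂ) (i : Fin q → Bool) : ℝ :=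
  ‖V.1 i (fun _ => false)‖ ^ 2

/-- The initial distribution `π₀`: the law of `price i` for a label `i` obtained by measuring
`V|0⟩`. -/
def initialLaw {q : ℕ} (V : Matrix.unitaryGroup (Fin q → Bool) ℂ)
    (price : (Fin q → Bool) → ℝ) : Measure ℝ :=
  ∑ i, ENNReal.ofReal (initialProb V i) • Measure.dirac (price i)

end

end OptionPricing

open OptionPricing

/-! The circuit never prepares the binomial law. With x = (2k - n)/√n for k up steps, the logarithm
of the terminal price is that of the initial price plus an affine function of x. For both lattices x
is asymptotically normal with variance one and a mean `tilt`, chosen so that the affine image of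
that normal law is the law of the Brownian log-return. It is enough to have any efficiently
preparable law on k that is close to the same normal law: the number estimated is then close both to
the binomial price and to the Brownian price, and one circuit serves for both.

Closeness means uniform distance of the masses of half-lines. A piecewise constant payoff with m + 1
jumps is, as a function of x, a constant plus m + 1 multiples (at most 2M) of indicators of
half-lines, so a distance D costs at most 2M(m + 1)D (`PiecewiseConstantPayoff.abs_mean_sub_le`).
For the walk, Lindeberg's exchange of steps against Gaussian steps, applied to an indicator smoothed
at scale δ, gives δ + C/(δ³√n) (`exists_walk_sub_gaussianTail_le`). The rate is poor, but n may be
any power of E = (m + 2)/ε, since only log n enters the cost.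

The preparable law has weights proportional to exp(-(2/n)(j² + j)) at distance j on either side of a
centre 2^H. The exponent is quadratic in the binary digits of j, so the weight is a product over
pairs of digits (`pair_weight`): toss uniform digits, toss one biased coin per pair, and reject if
two set digits meet a failed coin. This takes about log² n independent coins and no arithmetic.
Comparison of Riemann sums with the Gaussian integral controls the error
(`abs_discrete_gaussian_sub_le`). The mean is adjusted by the choice of n, which moves n/2 away from
2^H (`exists_steps`). The distances cover a range of only logarithmically many standard deviations,
so the acceptance probability is at least the inverse of a logarithm.

The payoff, shifted to be nonnegative by flipping its sign bit, becomes a probability by a further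
row of fair coins: the last digit selected by a coin is digit j with probability 2^j / 2^w
(`sum_chainFold_select`). Altogether the probability of one computable flag is an affine function of
the mean of the rounded payoff with known coefficients (`predProb_flag_latticeTable`).

That probability is found by amplitude estimation. The prepared state is a sum of two orthogonal
Grover eigenvectors of equal length with conjugate phases (`exists_grover_eigen`). Bitwise phase
estimation with coherent feedback has an explicit product distribution, whose mean error satisfies a
recursion in the number N of bits and is of order N / 2^N (`sum_outcomeProb_abs_sin`). Markov's
inequality then gives success probability 0.99 with 2^N equal to 1/ε up to logarithms. Every
diagonal operator on few qubits is synthesized exactly, so there is no gate approximation error, and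
a final table lookup turns the phase into the digits of the price. -/

namespace OptionPricing

noncomputable section

/-! ### Operators on registers -/

/-- Apply `U` to the register `e`. This is `applyOn` for an arbitrary type of qubits. -/
def applyReg {ι Q : Type} [Fintype ι] [DecidableEq ι] (e : ι ↪ Q) (U : QMatrix ι) (φ : QState Q) :
    QState Q :=
  fun x => ∑ z : ι → Bool, U (x ∘ e) z * φ (Function.extend e z x)

lemma extend_comp_embedding {ι Q α : Type*} (e : ι ↪ Q) (x : Q → α) :
    Function.extend e (x ∘ e) x = x := by
  funext c
  by_cases h : ∃ i, e i = c
  · obtain ⟨i, rfl⟩ := h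
    exact e.injective.extend_apply _ _ _
  · exact Function.extend_apply' _ _ _ h

lemma extend_extend {ι Q α : Type*} (e : ι ↪ Q) (z z' : ι → α) (x : Q → α) :
    Function.extend e z (Function.extend e z' x) = Function.extend e z x := by
  funext c
  by_cases h : ∃ i, e i = c
  · obtain ⟨i, rfl⟩ := h
    simp [e.injective.extend_apply]
  · simp [Function.extend_apply' _ _ _ h]

lemma extend_comp_self {ι Q α : Type*} (e : ι ↪ Q) (z : ι → α) (x : Q → α) :
    Function.extend e z x ∘ e = z := by
  funext c
  exact e.injective.extend_apply _ _ _

lemma extend_comp_equiv {ι Q Q' α : Type*} (e : ι ↪ Q) (a : Q ≃ Q') (z : ι → α) (x : Q' → α) :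
    Function.extend (e.trans a.toEmbedding) z x ∘ a = Function.extend e z (x ∘ a) := by
  funext c
  by_cases h : ∃ i, e i = c
  · obtain ⟨i, rfl⟩ := h
    have := (e.trans a.toEmbedding).injective.extend_apply z x i
    simp only [Function.Embedding.trans_apply, Equiv.coe_toEmbedding] at this
    simp [e.injective.extend_apply, this]
  · have h' : ¬ ∃ i, (e.trans a.toEmbedding) i = a c := by simpa using h
    simp [Function.extend_apply' _ _ _ h, Function.extend_apply' _ _ _ h']

section Registers

variable {ι Q : Type} [Fintype ι] [DecidableEq ι]

lemma applyReg_applyReg (e : ι ↪ Q) (U U' : QMatrix ι) (φ : QState Q) :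
    applyReg e U (applyReg e U' φ) = applyReg e (U * U') φ := by
  funext x
  simp only [applyReg, Matrix.mul_apply, extend_extend, extend_comp_self, Finset.mul_sum,
    Finset.sum_mul]
  rw [Finset.sum_comm]
  exact Finset.sum_congr rfl fun z _ => Finset.sum_congr rfl fun z' _ => by ring

lemma applyReg_one (e : ι ↪ Q) (φ : QState Q) : applyReg e 1 φ = φ := by
  funext x
  simp [applyReg, Matrix.one_apply, extend_comp_embedding]

lemma applyReg_diagonal (e : ι ↪ Q) (d : (ι → Bool) → ℂ) (φ : QState Q) (x : Q → Bool) :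
    applyReg e (Matrix.diagonal d) φ x = d (x ∘ e) * φ x := by
  simp [applyReg, Matrix.diagonal_apply, extend_comp_embedding]

lemma applyReg_add (e : ι ↪ Q) (U : QMatrix ι) (φ χ : QState Q) :
    applyReg e U (φ + χ) = applyReg e U φ + applyReg e U χ := by
  funext x
  simp [applyReg, mul_add, Finset.sum_add_distrib]

lemma applyReg_smul (e : ι ↪ Q) (U : QMatrix ι) (c : ℂ) (φ : QState Q) :
    applyReg e U (c • φ) = c • applyReg e U φ := by
  funext x
  simp only [applyReg, Pi.smul_apply, smul_eq_mul, Finset.mul_sum]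
  exact Finset.sum_congr rfl fun z _ => by ring

/-- The standard inner product of states. -/
def dot [Fintype Q] [DecidableEq Q] (φ χ : QState Q) : ℂ := ∑ x, star (φ x) * χ x

/-- Exchanging the contents of the register with the summation variable is an involution of the
pairs (x, z). It swaps the row and column indices of the matrix, which turns one double sum into the
other. -/
lemma dot_applyReg [Fintype Q] [DecidableEq Q] (e : ι ↪ Q) (U : QMatrix ι) (φ χ : QState Q) :
    dot (applyReg e U φ) χ = dot φ (applyReg e U.conjTranspose χ) := by
  have h1 : dot (applyReg e U φ) χ = ∑ p : (Q → Bool) × (ι → Bool),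
      star (U (p.1 ∘ e) p.2) * star (φ (Function.extend e p.2 p.1)) * χ p.1 := by
    simp only [dot, applyReg, star_sum, Finset.sum_mul, Fintype.sum_prod_type, star_mul']
  have h2 : dot φ (applyReg e U.conjTranspose χ) = ∑ p : (Q → Bool) × (ι → Bool),
      star (φ p.1) * (star (U p.2 (p.1 ∘ e)) * χ (Function.extend e p.2 p.1)) := by
    simp only [dot, applyReg, Finset.mul_sum, Fintype.sum_prod_type, Matrix.conjTranspose_apply]
  rw [h1, h2]
  refine Fintype.sum_equiv
    ⟨fun p => (Function.extend e p.2 p.1, p.1 ∘ e), fun p => (Function.extend e p.2 p.1, p.1 ∘ e),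
      fun p => ?_, fun p => ?_⟩ _ _ fun p => ?_
  · simp [extend_extend, extend_comp_self, extend_comp_embedding]
  · simp [extend_extend, extend_comp_self, extend_comp_embedding]
  · simp only [Equiv.coe_fn_mk, extend_comp_self, extend_extend, extend_comp_embedding]
    ring

end Registers

/-- The embedding of one qubit as a register. -/
def single {Q : Type} (a : Q) : Fin 1 ↪ Q := ⟨fun _ => a, fun _ _ _ => Subsingleton.elim _ _⟩

/-- The one-qubit operator `u` on the qubit `a`. -/
def op1 {Q : Type} [DecidableEq Q] (a : Q) (u : Matrix Bool Bool ℂ) (φ : QState Q) : QState Q :=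
  fun x => ∑ v : Bool, u (x a) v * φ (Function.update x a v)

/-- A one-qubit matrix as an operator on the register `Fin 1`. -/
def boolMatrix (u : Matrix Bool Bool ℂ) : QMatrix (Fin 1) :=
  u.submatrix (Equiv.funUnique (Fin 1) Bool) (Equiv.funUnique (Fin 1) Bool)

lemma boolMatrix_mul (u v : Matrix Bool Bool ℂ) :
    boolMatrix u * boolMatrix v = boolMatrix (u * v) := by
  rw [boolMatrix, boolMatrix, boolMatrix, Matrix.submatrix_mul_equiv]

lemma boolMatrix_one : boolMatrix 1 = 1 := by
  rw [boolMatrix, Matrix.submatrix_one_equiv]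

lemma boolMatrix_conjTranspose (u : Matrix Bool Bool ℂ) :
    (boolMatrix u).conjTranspose = boolMatrix u.conjTranspose := rfl

lemma extend_single {Q α : Type} [DecidableEq Q] (a : Q) (z : Fin 1 → α) (x : Q → α) :
    Function.extend (single a) z x = Function.update x a (z 0) := by
  funext c
  by_cases h : c = a
  · subst h
    rw [Function.update_self]
    exact (single c).injective.extend_apply z x 0
  · rw [Function.update_of_ne h]
    refine Function.extend_apply' _ _ _ ?_
    rintro ⟨i, hi⟩
    exact h hi.symm

lemma applyReg_single {Q : Type} [DecidableEq Q] (a : Q) (u : Matrix Bool Bool ℂ) (φ : QState Q) :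
    applyReg (single a) (boolMatrix u) φ = op1 a u φ := by
  funext x
  refine Fintype.sum_equiv (Equiv.funUnique (Fin 1) Bool) _ _ fun z => ?_
  rw [extend_single]
  rfl

lemma op1_op1 {Q : Type} [DecidableEq Q] (a : Q) (u v : Matrix Bool Bool ℂ) (φ : QState Q) :
    op1 a u (op1 a v φ) = op1 a (u * v) φ := by
  simp only [← applyReg_single, applyReg_applyReg, boolMatrix_mul]

lemma op1_one {Q : Type} [DecidableEq Q] (a : Q) (φ : QState Q) : op1 a 1 φ = φ := by
  rw [← applyReg_single, boolMatrix_one, applyReg_one]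

lemma dot_op1 {Q : Type} [Fintype Q] [DecidableEq Q] (a : Q) (u : Matrix Bool Bool ℂ)
    (φ χ : QState Q) : dot (op1 a u φ) χ = dot φ (op1 a u.conjTranspose χ) := by
  simp only [← applyReg_single, dot_applyReg, boolMatrix_conjTranspose]

lemma boolMatrix_mem_unitary {u : Matrix Bool Bool ℂ} (hu : u ∈ Matrix.unitaryGroup Bool ℂ) :
    boolMatrix u ∈ Matrix.unitaryGroup (Fin 1 → Bool) ℂ := by
  rw [Matrix.mem_unitaryGroup_iff] at hu ⊢
  rw [Matrix.star_eq_conjTranspose] at hu ⊢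
  rw [boolMatrix_conjTranspose, boolMatrix_mul, hu, boolMatrix_one]

/-! ### Implementable operations -/

/-- The payoff tables. -/
abbrev Table (q t w : ℕ) : Type := (Fin q → Bool) → (Fin t → Bool) → Fin w → Bool

/-- The initial price oracles. -/
abbrev InitialOracle (q : ℕ) : Type := Matrix.unitaryGroup (Fin q → Bool) ℂ

/-- Through the encoding `enc`, the operation `F`, which may depend on the oracles, is implemented
by a circuit of at most `l` gates. -/
def Impl {q t w N : ℕ} {S : Type} (enc : S → QState (Fin N)) (l : ℕ)
    (F : InitialOracle q → Table q t w → S → S) : Prop :=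
  ∃ gs : List (Gate q t w N), gs.length ≤ l ∧
    ∀ V f s, gs.foldl (fun φ g => g.apply V f φ) (enc s) = enc (F V f s)

namespace Impl

variable {q t w N : ℕ} {S : Type} {enc : S → QState (Fin N)}
  {F G : InitialOracle q → Table q t w → S → S} {l l' : ℕ}

lemma mono (h : Impl enc l F) (hl : l ≤ l') : Impl enc l' F := by
  obtain ⟨gs, h1, h2⟩ := h
  exact ⟨gs, h1.trans hl, h2⟩

lemma congr (h : Impl enc l F) (hF : ∀ V f s, F V f s = G V f s) : Impl enc l G := by
  obtain ⟨gs, h1, h2⟩ := h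
  exact ⟨gs, h1, fun V f s => by rw [h2, hF]⟩

lemma id : Impl enc 0 (fun (_ : InitialOracle q) (_ : Table q t w) s => s) :=
  ⟨[], by simp, fun _ _ _ => rfl⟩

lemma comp (hF : Impl enc l F) (hG : Impl enc l' G) :
    Impl enc (l + l') (fun V f s => G V f (F V f s)) := by
  obtain ⟨gs, h1, h2⟩ := hF
  obtain ⟨gs', h1', h2'⟩ := hG
  refine ⟨gs ++ gs', by simp; omega, fun V f s => ?_⟩
  rw [List.foldl_append, h2, h2']

lemma iterate (hF : Impl enc l F) (k : ℕ) : Impl enc (k * l) (fun V f => (F V f)^[k]) := by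
  induction k with
  | zero => exact (id.mono (by simp)).congr fun _ _ _ => rfl
  | succ k ih =>
    refine ((hF.comp ih).mono (by ring_nf; rfl)).congr fun V f s => ?_
    rw [Function.iterate_succ_apply]

lemma foldl {α : Type*} (L : List α) {H : α → InitialOracle q → Table q t w → S → S}
    (hH : ∀ a ∈ L, Impl enc l (H a)) :
    Impl enc (L.length * l) (fun V f s => L.foldl (fun s a => H a V f s) s) := by
  induction L with
  | nil => exact id.mono (by simp)
  | cons a L ih =>
    refine (((hH a (by simp)).comp (ih fun b hb => hH b (by simp [hb]))).mono ?_).congr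
      fun V f s => rfl
    simp only [List.length_cons]
    ring_nf
    rfl

/-- Change the encoding. -/
lemma transfer {S' : Type} (h : Impl enc l F) (emb : S' → S)
    {F' : InitialOracle q → Table q t w → S' → S'}
    (hF : ∀ V f s, F V f (emb s) = emb (F' V f s)) : Impl (fun s => enc (emb s)) l F' := by
  obtain ⟨gs, h1, h2⟩ := h
  exact ⟨gs, h1, fun V f s => by rw [h2, hF]⟩

end Impl

/-- States on the qubits `Q`, numbered by `a`. -/
def relabel {Q : Type} {N : ℕ} (a : Q ≃ Fin N) (φ : QState Q) : QState (Fin N) :=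
  fun x => φ (x ∘ a)

lemma applyOn_relabel {ι Q : Type} [Fintype ι] [DecidableEq ι] {N : ℕ} (a : Q ≃ Fin N) (e : ι ↪ Q)
    (U : QMatrix ι) (φ : QState Q) :
    applyOn (e.trans a.toEmbedding) U (relabel a φ) = relabel a (applyReg e U φ) := by
  funext x
  simp only [applyOn, relabel, applyReg]
  refine Finset.sum_congr rfl fun z _ => ?_
  rw [extend_comp_equiv]
  rfl

/-- The diagonal operator `D`. -/
def phase {Q : Type} (D : (Q → Bool) → ℂ) (φ : QState Q) : QState Q := fun x => D x * φ x

/-- Implementability of a diagonal operator. -/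
def ImplPhase {q t w N : ℕ} {Q : Type} (enc : QState Q → QState (Fin N)) (l : ℕ)
    (D : InitialOracle q → Table q t w → (Q → Bool) → ℂ) : Prop :=
  Impl enc l (fun V f => phase (D V f))

/-! ### The elementary gates and oracle calls as implementable operations. -/

section BaseGates

variable {q t w N : ℕ} {Q : Type} (e : Q ≃ Fin N)

lemma impl_op1 [DecidableEq Q] (a : Q) {u : Matrix Bool Bool ℂ} (hu : u ∈ Matrix.unitaryGroup Bool ℂ) :
    Impl (relabel e) 1 (fun (_ : InitialOracle q) (_ : Table q t w) => op1 a u) := by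
  refine ⟨[.oneQubit ((single a).trans e.toEmbedding) ⟨_, boolMatrix_mem_unitary hu⟩], by simp,
    fun V f φ => ?_⟩
  simp only [List.foldl_cons, List.foldl_nil, Gate.apply, applyOn_relabel, applyReg_single]

lemma impl_initial (r : Fin q ↪ Q) :
    Impl (relabel e) 1 (fun (V : InitialOracle q) (_ : Table q t w) => applyReg r V.1) := by
  refine ⟨[.initial (r.trans e.toEmbedding)], by simp, fun V f φ => ?_⟩
  simp only [List.foldl_cons, List.foldl_nil, Gate.apply, applyOn_relabel]

lemma impl_initialInv (r : Fin q ↪ Q) :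
    Impl (relabel e) 1
      (fun (V : InitialOracle q) (_ : Table q t w) => applyReg r V.1.conjTranspose) := by
  refine ⟨[.initialInv (r.trans e.toEmbedding)], by simp, fun V f φ => ?_⟩
  simp only [List.foldl_cons, List.foldl_nil, Gate.apply, applyOn_relabel]
  rfl

lemma impl_payoff (r : (Fin q ⊕ Fin t) ⊕ Fin w ↪ Q) :
    Impl (relabel e) 1 (fun (_ : InitialOracle q) (f : Table q t w) φ x =>
      φ (Function.extend r (Sum.elim (x ∘ r ∘ Sum.inl) (fun j => xor (x (r (Sum.inr j)))
        (f (x ∘ r ∘ Sum.inl ∘ Sum.inl) (x ∘ r ∘ Sum.inl ∘ Sum.inr) j))) x)) := by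
  refine ⟨[.payoff (r.trans e.toEmbedding)], by simp, fun V f φ => ?_⟩
  simp only [List.foldl_cons, List.foldl_nil, Gate.apply, applyOn_relabel]
  congr 1
  funext x
  simp only [applyReg, xorOracle]
  -- The map i, k, y ↦ i, k, y ⊕ f is its own inverse, so row x of the matrix has its only nonzero
  -- entry in the column obtained by applying the same map to x.
  have key : ∀ z : (Fin q ⊕ Fin t) ⊕ Fin w → Bool,
      (x ∘ r = Sum.elim (z ∘ Sum.inl) (fun j => xor (z (Sum.inr j))
        (f (z ∘ Sum.inl ∘ Sum.inl) (z ∘ Sum.inl ∘ Sum.inr) j))) ↔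
      z = Sum.elim (x ∘ r ∘ Sum.inl) (fun j => xor (x (r (Sum.inr j)))
        (f (x ∘ r ∘ Sum.inl ∘ Sum.inl) (x ∘ r ∘ Sum.inl ∘ Sum.inr) j)) := by
    intro z
    constructor
    · intro h
      have hl : x ∘ r ∘ Sum.inl = z ∘ Sum.inl := by
        have := congrArg (fun g => g ∘ Sum.inl) h
        simpa [Function.comp_assoc] using this
      have hl1 : x ∘ r ∘ Sum.inl ∘ Sum.inl = z ∘ Sum.inl ∘ Sum.inl :=
        congrArg (fun g => g ∘ Sum.inl) hl
      have hl2 : x ∘ r ∘ Sum.inl ∘ Sum.inr = z ∘ Sum.inl ∘ Sum.inr :=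
        congrArg (fun g => g ∘ Sum.inr) hl
      funext c
      rcases c with c | j
      · exact (congrFun hl c).symm
      · have := congrFun h (Sum.inr j)
        simp only [Function.comp_apply, Sum.elim_inr] at this ⊢
        rw [hl1, hl2, this]
        simp
    · intro h
      funext c
      subst h
      rcases c with c | j
      · rfl
      · simp only [Function.comp_apply, Sum.elim_inr]
        have h1 : (Sum.elim (x ∘ r ∘ Sum.inl) (fun j => xor (x (r (Sum.inr j)))
          (f (x ∘ r ∘ Sum.inl ∘ Sum.inl) (x ∘ r ∘ Sum.inl ∘ Sum.inr) j))) ∘ Sum.inl ∘ Sum.inl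
            = x ∘ r ∘ Sum.inl ∘ Sum.inl := rfl
        have h2 : (Sum.elim (x ∘ r ∘ Sum.inl) (fun j => xor (x (r (Sum.inr j)))
          (f (x ∘ r ∘ Sum.inl ∘ Sum.inl) (x ∘ r ∘ Sum.inl ∘ Sum.inr) j))) ∘ Sum.inl ∘ Sum.inr
            = x ∘ r ∘ Sum.inl ∘ Sum.inr := rfl
        rw [h1, h2]
        simp
  simp only [key, ite_mul, one_mul, zero_mul, Finset.sum_ite_eq', Finset.mem_univ, if_true]

end BaseGates

end

end OptionPricing

namespace OptionPricing

noncomputable section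

/-! ### Diagonal operators and reversible classical steps -/

/-- The Hadamard gate. -/
def hadamard : Matrix Bool Bool ℂ :=
  fun a b => ((√2 : ℝ) : ℂ)⁻¹ * if a && b then -1 else 1

lemma inv_sqrt_two_sq : (((√2 : ℝ) : ℂ)⁻¹) ^ 2 = 1 / 2 := by
  rw [inv_pow, ← Complex.ofReal_pow, Real.sq_sqrt (by norm_num)]
  norm_num

lemma hadamard_mem_unitary : hadamard ∈ Matrix.unitaryGroup Bool ℂ := by
  rw [Matrix.mem_unitaryGroup_iff]
  have h := inv_sqrt_two_sq
  ext a b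
  cases a <;> cases b <;>
    simp [Matrix.mul_apply, Matrix.star_apply, hadamard, -Complex.ofReal_inv] <;>
    linear_combination 2 * h

lemma diagonal_mem_unitary {n : Type*} [Fintype n] [DecidableEq n] {d : n → ℂ}
    (hd : ∀ i, ‖d i‖ = 1) : Matrix.diagonal d ∈ Matrix.unitaryGroup n ℂ := by
  rw [Matrix.mem_unitaryGroup_iff, Matrix.star_eq_conjTranspose, Matrix.diagonal_conjTranspose,
    Matrix.diagonal_mul_diagonal, ← Matrix.diagonal_one]
  congr 1
  funext i
  have : d i * star (d i) = ((‖d i‖ ^ 2 : ℝ) : ℂ) := by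
    rw [Complex.star_def, Complex.mul_conj, Complex.normSq_eq_norm_sq]
  simp only [Pi.star_apply, this, hd, one_pow, Complex.ofReal_one]

/-- Implementability of the operator `φ ↦ φ ∘ s`. -/
def ImplMap {q t w N : ℕ} {Q : Type} (enc : QState Q → QState (Fin N)) (l : ℕ)
    (s : InitialOracle q → Table q t w → (Q → Bool) → (Q → Bool)) : Prop :=
  Impl enc l (fun V f φ x => φ (s V f x))

section

variable {q t w N : ℕ} {Q : Type} {enc : QState Q → QState (Fin N)} {l m : ℕ}
  {D D' : InitialOracle q → Table q t w → (Q → Bool) → ℂ}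
  {s : InitialOracle q → Table q t w → (Q → Bool) → (Q → Bool)}

lemma ImplPhase.mul (h : ImplPhase enc l D) (h' : ImplPhase enc m D') :
    ImplPhase enc (l + m) (fun V f x => D V f x * D' V f x) :=
  (Impl.comp h h').congr fun V f φ => by
    funext x
    simp only [phase]
    ring

/-- Compute, apply a phase, uncompute. All reversible arithmetic in the circuit enters through this
conjugation, which restores the ancillas automatically. -/
lemma ImplPhase.conj (h : ImplPhase enc m D) (hs : ImplMap enc l s)
    (hi : ∀ V f x, s V f (s V f x) = x) : ImplPhase enc (m + 2 * l) (fun V f x => D V f (s V f x)) :=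
  (Impl.mono ((Impl.comp (Impl.comp hs h) hs)) (by omega)).congr fun V f φ => by
    funext x
    simp only [phase, hi]

end

/-- Two distinct qubits as a register. -/
def pairEmb {Q : Type} {a b : Q} (h : a ≠ b) : Fin 2 ↪ Q :=
  ⟨![a, b], by
    intro i j hij
    fin_cases i <;> fin_cases j <;> simp_all⟩

lemma implPhase_cz {q t w N : ℕ} {Q : Type} (e : Q ≃ Fin N) {a b : Q} (h : a ≠ b) :
    ImplPhase (q := q) (t := t) (w := w) (relabel e) 1
      (fun _ _ x => if x a && x b then -1 else 1) := by
  have hd : ∀ z : Fin 2 → Bool, ‖(if z 0 && z 1 then -1 else 1 : ℂ)‖ = 1 := by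
    intro z
    split_ifs <;> simp
  refine ⟨[.twoQubit ((pairEmb h).trans e.toEmbedding) ⟨_, diagonal_mem_unitary hd⟩], by simp,
    fun V f φ => ?_⟩
  simp only [List.foldl_cons, List.foldl_nil, Gate.apply, applyOn_relabel]
  congr 1
  funext x
  rw [applyReg_diagonal]
  rfl

/-- Replace the qubit `b` by its sum with `g`. -/
def xorStep {Q : Type} [DecidableEq Q] (b : Q) (g : (Q → Bool) → Bool) (x : Q → Bool) : Q → Bool :=
  Function.update x b (xor (x b) (g x))

lemma xorStep_self {Q : Type} [DecidableEq Q] (b : Q) (g : (Q → Bool) → Bool) (x : Q → Bool) :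
    xorStep b g x b = xor (x b) (g x) := by simp [xorStep]

lemma xorStep_of_ne {Q : Type} [DecidableEq Q] {b c : Q} (h : c ≠ b) (g : (Q → Bool) → Bool)
    (x : Q → Bool) : xorStep b g x c = x c := by simp [xorStep, h]

lemma DependsOn.update {Q α : Type} [DecidableEq Q] {g : (Q → Bool) → α} {B : Set Q}
    (hg : DependsOn g B) {b : Q} (hb : b ∉ B) (x : Q → Bool) (v : Bool) :
    g (Function.update x b v) = g x :=
  hg fun i hi => Function.update_of_ne (by rintro rfl; exact hb hi) _ _

lemma xorStep_xorStep {Q : Type} [DecidableEq Q] {b : Q} {g : (Q → Bool) → Bool} {B : Set Q}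
    (hg : DependsOn g B) (hb : b ∉ B) (x : Q → Bool) : xorStep b g (xorStep b g x) = x := by
  funext c
  by_cases h : c = b
  · subst h
    rw [xorStep_self, xorStep_self, xorStep, DependsOn.update hg hb]
    simp
  · rw [xorStep_of_ne h, xorStep_of_ne h]

/-! ### Exact synthesis of diagonal operators and of reversible Boolean steps. -/

section

variable {q t w N : ℕ} {Q : Type} [DecidableEq Q] (e : Q ≃ Fin N)

/-- Two Hadamard gates on the target turn the phase (-1)^(x_b g(x)) into the flip of x_b by g(x). It
is essential that g does not read the qubit b. -/
lemma implMap_xorStep {b : Q} {g : (Q → Bool) → Bool} {B : Set Q} (hg : DependsOn g B)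
    (hb : b ∉ B) {l : ℕ}
    (h : ImplPhase (q := q) (t := t) (w := w) (relabel e) l
      (fun _ _ x => if x b && g x then -1 else 1)) :
    ImplMap (q := q) (t := t) (w := w) (relabel e) (l + 2) (fun _ _ => xorStep b g) := by
  have hH := impl_op1 (q := q) (t := t) (w := w) e b hadamard_mem_unitary
  refine (Impl.mono (Impl.comp (Impl.comp hH h) hH) (by omega)).congr fun V f φ => ?_
  funext x
  have h2 := inv_sqrt_two_sq
  simp only [op1, phase, Fintype.sum_bool, Function.update_self, Function.update_idem,
    DependsOn.update hg hb, hadamard, xorStep]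
  cases hx : x b <;> cases hgx : g x <;>
    simp [-Complex.ofReal_inv] <;>
    [linear_combination 2 * φ (Function.update x b false) * h2;
     linear_combination 2 * φ (Function.update x b true) * h2;
     linear_combination 2 * φ (Function.update x b true) * h2;
     linear_combination 2 * φ (Function.update x b false) * h2]

lemma implMap_cnot {a b : Q} (h : a ≠ b) :
    ImplMap (q := q) (t := t) (w := w) (relabel e) 3 (fun _ _ => xorStep b (fun x => x a)) :=
  implMap_xorStep (B := {a}) e (fun x y hxy => hxy a rfl) (by simpa using h.symm)
    (implPhase_cz e h.symm)

lemma implPhase_one (a : Q) {d : Bool → ℂ} (hd : ∀ v, ‖d v‖ = 1) :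
    ImplPhase (q := q) (t := t) (w := w) (relabel e) 1 (fun _ _ x => d (x a)) := by
  refine (impl_op1 e a (diagonal_mem_unitary hd)).congr fun V f φ => ?_
  funext x
  simp [op1, phase, Matrix.diagonal_apply]

/-- The parity character of a set of qubits. -/
def paritySign (S : Finset Q) (x : Q → Bool) : ℝ := ∏ c ∈ S, if x c then -1 else 1

/-- A controlled-not from b to a replaces the sign of a by the sign of the sum of a and b.
Conjugating by it extends the parity by b, at the price of two controlled-nots of three gates each.
-/
lemma implPhase_parity_insert (S : Finset Q) {a : Q} (ha : a ∉ S) (θ : ℝ) :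
    ImplPhase (q := q) (t := t) (w := w) (relabel e) (6 * S.card + 1)
      (fun _ _ x => Complex.exp ((θ * paritySign (insert a S) x : ℝ) * Complex.I)) := by
  induction S using Finset.induction_on with
  | empty =>
    refine Impl.congr (implPhase_one e a
      (d := fun v => Complex.exp ((θ * if v then -1 else 1 : ℝ) * Complex.I))
      fun v => Complex.norm_exp_ofReal_mul_I _) fun V f φ => ?_
    funext x
    simp [phase, paritySign]
  | insert b S hb ih =>
    have hab : a ≠ b := fun h => ha (by simp [h])
    have haS : a ∉ S := fun h => ha (by simp [h])
    refine Impl.congr (Impl.mono (ImplPhase.conj (ih haS) (implMap_cnot e hab.symm)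
      fun V f x => xorStep_xorStep (B := {b}) (fun x y hxy => hxy b rfl) (by simpa using hab) x)
      (by rw [Finset.card_insert_of_notMem hb]; omega)) fun V f φ => ?_
    funext x
    have key : paritySign (insert a S) (xorStep a (fun x => x b) x) =
        paritySign (insert a (insert b S)) x := by
      have h1 : ∀ c ∈ S, xorStep a (fun x => x b) x c = x c := fun c hc =>
        xorStep_of_ne (by rintro rfl; exact haS hc) _ _
      rw [paritySign, paritySign, Finset.prod_insert haS, Finset.prod_insert ha,
        Finset.prod_insert hb, xorStep_self, Finset.prod_congr rfl fun c hc => by rw [h1 c hc]]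
      cases x a <;> cases x b <;> simp
    simp only [phase, key]

lemma implPhase_parity [Nonempty Q] (S : Finset Q) (θ : ℝ) :
    ImplPhase (q := q) (t := t) (w := w) (relabel e) (6 * S.card + 1)
      (fun _ _ x => Complex.exp ((θ * paritySign S x : ℝ) * Complex.I)) := by
  rcases S.eq_empty_or_nonempty with rfl | ⟨a, ha⟩
  · obtain ⟨a⟩ := ‹Nonempty Q›
    refine Impl.congr (Impl.mono (implPhase_one e a
      (d := fun _ => Complex.exp ((θ : ℝ) * Complex.I))
      fun v => Complex.norm_exp_ofReal_mul_I _) (by simp)) fun V f φ => ?_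
    funext x
    simp [phase, paritySign]
  · have h := implPhase_parity_insert (q := q) (t := t) (w := w) e (S.erase a)
      (Finset.notMem_erase a S) θ
    rw [Finset.insert_erase ha] at h
    exact Impl.mono h (by have := Finset.card_erase_le (s := S) (a := a); omega)

/-- Walsh expansion, one variable at a time: as a function of the qubit a, the angle is an even part
plus an odd part times the sign of a, and that sign joins the parity. The factor `paritySign S` is
there to make the induction close. -/
lemma implPhase_dependsOn_mul_parity [Nonempty Q] (B : Finset Q) :
    ∀ (S : Finset Q) (θ : (Q → Bool) → ℝ), Disjoint B S → DependsOn θ (B : Set Q) →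
    ImplPhase (q := q) (t := t) (w := w) (relabel e) (2 ^ B.card * (6 * (S.card + B.card) + 1))
      (fun _ _ x => Complex.exp ((θ x * paritySign S x : ℝ) * Complex.I)) := by
  induction B using Finset.induction_on with
  | empty =>
    intro S θ _ hθ
    refine Impl.congr (Impl.mono (implPhase_parity e S (θ fun _ => false)) (by simp))
      fun V f φ => ?_
    funext x
    have : θ x = θ fun _ => false := hθ (by simp)
    simp only [phase, this]
  | insert a B ha ih =>
    intro S θ hS hθ
    have haS : a ∉ S := (Finset.disjoint_insert_left.1 hS).1
    have hBS : Disjoint B S := (Finset.disjoint_insert_left.1 hS).2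
    -- The even and the odd part of θ in the qubit a.
    set θ₀ : (Q → Bool) → ℝ :=
      fun x => (θ (Function.update x a false) + θ (Function.update x a true)) / 2
    set θ₁ : (Q → Bool) → ℝ :=
      fun x => (θ (Function.update x a false) - θ (Function.update x a true)) / 2
    have hd : ∀ v, DependsOn (fun x => θ (Function.update x a v)) (B : Set Q) := by
      intro v x y hxy
      refine hθ fun i hi => ?_
      by_cases h : i = a
      · subst h; simp
      · rw [Function.update_of_ne h, Function.update_of_ne h]
        exact hxy i (by simpa [h] using hi)
    have h0 := ih S θ₀ hBS fun x y hxy => by simp only [θ₀, hd false hxy, hd true hxy]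
    have h1 := ih (insert a S) θ₁ (Finset.disjoint_insert_right.2 ⟨ha, hBS⟩)
      fun x y hxy => by simp only [θ₁, hd false hxy, hd true hxy]
    refine Impl.congr (Impl.mono (ImplPhase.mul h0 h1) ?_) fun V f φ => ?_
    · rw [Finset.card_insert_of_notMem ha, Finset.card_insert_of_notMem haS, pow_succ]
      nlinarith [Nat.zero_le (2 ^ B.card)]
    · funext x
      simp only [phase]
      rw [← Complex.exp_add, ← add_mul, ← Complex.ofReal_add]
      congr 4
      rw [paritySign, paritySign, Finset.prod_insert haS]
      have hx : Function.update x a (x a) = x := Function.update_eq_self a x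
      cases h : x a <;> rw [h] at hx <;> simp only [θ₀, θ₁, hx] <;> simp <;> ring

/-- The cost of a diagonal operator that depends on `k` qubits. -/
def diagCost (k : ℕ) : ℕ := 2 ^ k * (6 * k + 1)

lemma diagCost_mono {k k' : ℕ} (h : k ≤ k') : diagCost k ≤ diagCost k' := by
  unfold diagCost
  gcongr
  norm_num

lemma implPhase_dependsOn [Nonempty Q] (B : Finset Q) {D : (Q → Bool) → ℂ}
    (hB : DependsOn D (B : Set Q)) (hD : ∀ x, ‖D x‖ = 1) :
    ImplPhase (q := q) (t := t) (w := w) (relabel e) (diagCost B.card) (fun _ _ => D) := by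
  refine Impl.congr (Impl.mono (implPhase_dependsOn_mul_parity e B ∅ (fun x => (D x).arg)
    (by simp) fun x y hxy => by simp only [hB hxy]) (by simp [diagCost])) fun V f φ => ?_
  funext x
  have := Complex.norm_mul_exp_arg_mul_I (D x)
  rw [hD, Complex.ofReal_one, one_mul] at this
  simp [phase, paritySign, this]

/-- The cost of adding a function of `k` qubits to a qubit. -/
def xorCost (k : ℕ) : ℕ := diagCost (k + 1) + 2

lemma xorCost_mono {k k' : ℕ} (h : k ≤ k') : xorCost k ≤ xorCost k' := by
  have := diagCost_mono (Nat.succ_le_succ h)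
  unfold xorCost
  simp only [Nat.succ_eq_add_one] at this
  omega

lemma implMap_xorStep_dependsOn [Nonempty Q] {b : Q} {g : (Q → Bool) → Bool} {B : Finset Q}
    (hg : DependsOn g (B : Set Q)) (hb : b ∉ B) :
    ImplMap (q := q) (t := t) (w := w) (relabel e) (xorCost B.card) (fun _ _ => xorStep b g) := by
  refine implMap_xorStep e hg (by simpa using hb) ?_
  have := implPhase_dependsOn (q := q) (t := t) (w := w) e (insert b B)
    (D := fun x => if x b && g x then -1 else 1) (fun x y hxy => by
      have h1 : g x = g y := hg fun i hi => hxy i (by simp at hi; simp [hi])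
      have h2 : x b = y b := hxy b (by simp)
      simp only [h1, h2]) (fun x => by split_ifs <;> simp)
  rwa [Finset.card_insert_of_notMem hb] at this

/-- Add `G c` to every qubit `c` of `S`. -/
def xorOn (S : Finset Q) (G : Q → (Q → Bool) → Bool) (x : Q → Bool) : Q → Bool :=
  fun c => if c ∈ S then xor (x c) (G c x) else x c

/-- The added values do not read the qubits that are changed, so they are the same at the second
application. -/
lemma xorOn_xorOn {S : Finset Q} {G : Q → (Q → Bool) → Bool}
    (hG : ∀ c ∈ S, DependsOn (G c) ((S : Set Q)ᶜ)) (x : Q → Bool) :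
    xorOn S G (xorOn S G x) = x := by
  funext c
  by_cases h : c ∈ S
  · have : G c (xorOn S G x) = G c x := hG c h fun i hi => by
      have : i ∉ S := by simpa using hi
      simp [xorOn, this]
    simp [xorOn, h, this]
  · simp [xorOn, h]

lemma implMap_xorOn [Nonempty Q] (S : Finset Q) (G : Q → (Q → Bool) → Bool) (B : Q → Finset Q)
    {k : ℕ} (hG : ∀ c ∈ S, DependsOn (G c) (B c : Set Q)) (hB : ∀ c ∈ S, Disjoint (B c) S)
    (hk : ∀ c ∈ S, (B c).card ≤ k) :
    ImplMap (q := q) (t := t) (w := w) (relabel e) (S.card * xorCost k) (fun _ _ => xorOn S G) := by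
  induction S using Finset.induction_on with
  | empty =>
      refine (Impl.id.mono (by simp)).congr fun V f φ => ?_
      funext x
      exact congrArg φ (funext fun c => by simp [xorOn])
  | insert a S ha ih =>
    have h1 := ih (fun c hc => hG c (by simp [hc]))
      (fun c hc => (Finset.disjoint_insert_right.1 (hB c (by simp [hc]))).2)
      fun c hc => hk c (by simp [hc])
    have h2 := implMap_xorStep_dependsOn (q := q) (t := t) (w := w) e (hG a (by simp))
      (Finset.disjoint_insert_right.1 (hB a (by simp))).1
    refine (Impl.mono (Impl.comp h1 h2) ?_).congr fun V f φ => ?_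
    · rw [Finset.card_insert_of_notMem ha, add_mul, one_mul]
      have := xorCost_mono (hk a (by simp))
      omega
    · funext x
      dsimp only
      congr 1
      funext c
      by_cases hc : c = a
      · subst hc
        simp [xorOn, ha, xorStep]
      · by_cases hcS : c ∈ S
        · have : G c (xorStep a (G a) x) = G c x :=
            DependsOn.update (hG c (by simp [hcS]))
              (by simpa using (Finset.disjoint_insert_right.1 (hB c (by simp [hcS]))).1) _ _
          simp [xorOn, hcS, xorStep_of_ne hc, this]
        · simp [xorOn, hcS, hc, xorStep_of_ne hc]

/-- A chain of steps: the qubit `ch (k + 1)` receives `h k` of the qubit `ch k` and others. -/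
def chainRun (ch : ℕ → Q) (h : ℕ → Bool → (Q → Bool) → Bool) : ℕ → (Q → Bool) → Q → Bool
  | 0, x => x
  | k + 1, x => xorStep (ch (k + 1)) (fun x => h k (x (ch k)) x) (chainRun ch h k x)

/-- The value that a chain computes from the initial value `false`. -/
def chainFold {X : Type} (h : ℕ → Bool → X → Bool) (x : X) : ℕ → Bool
  | 0 => false
  | k + 1 => h k (chainFold h x k) x

/-- Every step writes to a fresh zero qubit, which makes an irreversible recursion reversible. The
steps read only the previous chain qubit and qubits outside the chain, which keep their initial
values. -/
lemma chainRun_spec {ch : ℕ → Q} {h : ℕ → Bool → (Q → Bool) → Bool} {L : ℕ}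
    (hch : Set.InjOn ch (Set.Iic L))
    (hh : ∀ k r, DependsOn (h k r) (ch '' Set.Iic L)ᶜ) (x : Q → Bool)
    (hx : ∀ k ≤ L, x (ch k) = false) : ∀ k ≤ L,
      (∀ c, (∀ j, 0 < j → j ≤ k → c ≠ ch j) → chainRun ch h k x c = x c) ∧
      chainRun ch h k x (ch k) = chainFold h x k := by
  intro k
  induction k with
  | zero => exact fun _ => ⟨fun c _ => rfl, hx 0 (Nat.zero_le _)⟩
  | succ k ih =>
    intro hk
    obtain ⟨h1, h2⟩ := ih (by omega)
    refine ⟨fun c hc => ?_, ?_⟩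
    · rw [chainRun, xorStep_of_ne (hc (k + 1) (by omega) le_rfl)]
      exact h1 c fun j hj hjk => hc j hj (by omega)
    · rw [chainRun, xorStep_self, h1, hx _ hk, h2, chainFold, Bool.false_xor]
      · refine hh k _ fun c hc => h1 c fun j _ hj hcj => hc ⟨j, ?_, hcj.symm⟩
        simp only [Set.mem_Iic]
        omega
      · intro j _ hj hcj
        have := hch (by simp only [Set.mem_Iic]; omega) (by simp only [Set.mem_Iic]; omega) hcj
        omega

/-- The last step of the chain is absorbed into the diagonal operator by conjugation, and the
induction continues with the shorter chain. A step reads at most k qubits and its predecessor, hence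
`xorCost (k + 1)`, twice. -/
lemma implPhase_chainRun [Nonempty Q] {ch : ℕ → Q} {h : ℕ → Bool → (Q → Bool) → Bool} {L : ℕ}
    (hch : Set.InjOn ch (Set.Iic L)) (B : ℕ → Finset Q) {k : ℕ}
    (hB : ∀ j < L, ∀ r, DependsOn (h j r) (B j : Set Q)) (hBc : ∀ j < L, ch (j + 1) ∉ B j)
    (hk : ∀ j < L, (B j).card ≤ k) :
    ∀ (m : ℕ) (D : InitialOracle q → Table q t w → (Q → Bool) → ℂ),
      ImplPhase (relabel e) m D →
      ImplPhase (relabel e) (m + L * (2 * xorCost (k + 1))) (fun V f x => D V f (chainRun ch h L x)) := by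
  induction L with
  | zero => exact fun m D hD => Impl.mono hD (by omega)
  | succ L ih =>
    intro m D hD
    have hg : DependsOn (fun x => h L (x (ch L)) x) ((insert (ch L) (B L) : Finset Q) : Set Q) := by
      intro x y hxy
      dsimp only
      rw [hxy (ch L) (by simp)]
      exact hB L (by omega) _ fun i hi => hxy i (by simp at hi; simp [hi])
    have hn : ch (L + 1) ∉ insert (ch L) (B L) := by
      rw [Finset.mem_insert, not_or]
      refine ⟨fun hc => ?_, hBc L (by omega)⟩
      have := hch (by simp) (by simp) hc
      omega
    have hc : (insert (ch L) (B L)).card ≤ k + 1 :=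
      (Finset.card_insert_le _ _).trans (by have := hk L (by omega); omega)
    have hstep := Impl.mono (implMap_xorStep_dependsOn (q := q) (t := t) (w := w) e hg hn)
      (xorCost_mono hc)
    have h1 := ImplPhase.conj hD hstep fun V f x => xorStep_xorStep hg (by simpa using hn) x
    have h2 := ih (hch.mono (Set.Iic_subset_Iic.2 (by omega))) (fun j hj => hB j (by omega))
      (fun j hj => hBc j (by omega)) (fun j hj => hk j (by omega)) _ _ h1
    exact Impl.mono h2 (by ring_nf; rfl)

end

/-! ### Ancillas -/

/-- The state `φ` together with ancilla qubits in the state zero. -/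
def withZeros {K A : Type} [Fintype A] (φ : QState K) : QState (K ⊕ A) :=
  fun x => if ∀ a, x (Sum.inr a) = false then φ (x ∘ Sum.inl) else 0

section

variable {K A : Type} [Fintype A]

/-- Only the values of a diagonal operator at clean ancillas matter. Computations with ancillas
therefore need to be correct only when these start at zero. -/
lemma phase_withZeros {D : (K ⊕ A → Bool) → ℂ} {D' : (K → Bool) → ℂ}
    (h : ∀ x, D (Sum.elim x fun _ => false) = D' x) (φ : QState K) :
    phase D (withZeros φ : QState (K ⊕ A)) = withZeros (phase D' φ) := by
  funext x
  simp only [phase, withZeros]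
  split_ifs with hx
  · have : x = Sum.elim (x ∘ Sum.inl) (fun _ => false) := by
      funext c
      rcases c with c | c
      · rfl
      · exact hx c
    rw [← h, ← this]
  · simp

lemma op1_withZeros [DecidableEq K] [DecidableEq A] (a : K) (u : Matrix Bool Bool ℂ)
    (φ : QState K) :
    op1 (Sum.inl a) u (withZeros φ : QState (K ⊕ A)) = withZeros (op1 a u φ) := by
  funext x
  simp only [op1, withZeros]
  have h1 : ∀ v b, Function.update x (Sum.inl a) v (Sum.inr b : K ⊕ A) = x (Sum.inr b) :=
    fun v b => Function.update_of_ne (by simp) _ _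
  have h2 : ∀ v, Function.update x (Sum.inl a) v ∘ (Sum.inl : K → K ⊕ A) =
      Function.update (x ∘ Sum.inl) a v := by
    intro v
    funext c
    by_cases h : c = a
    · subst h; simp
    · simp [h]
  simp only [h1, h2]
  split_ifs <;> simp

lemma applyReg_withZeros {ι : Type} [Fintype ι] [DecidableEq ι] (e : ι ↪ K) (U : QMatrix ι)
    (φ : QState K) :
    applyReg (e.trans Function.Embedding.inl) U (withZeros φ : QState (K ⊕ A)) =
      withZeros (applyReg e U φ) := by
  funext x
  simp only [applyReg, withZeros]
  have h1 : ∀ z b, Function.extend (e.trans Function.Embedding.inl) z x (Sum.inr b : K ⊕ A) =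
      x (Sum.inr b) := fun z b => Function.extend_apply' _ _ _ (by simp)
  have h2 : ∀ z, Function.extend (e.trans Function.Embedding.inl) z x ∘ (Sum.inl : K → K ⊕ A) =
      Function.extend e z (x ∘ Sum.inl) := by
    intro z
    funext c
    by_cases h : ∃ i, e i = c
    · obtain ⟨i, rfl⟩ := h
      have := (e.trans (Function.Embedding.inl : K ↪ K ⊕ A)).injective.extend_apply z x i
      simp only [Function.Embedding.trans_apply, Function.Embedding.inl_apply] at this
      simp [e.injective.extend_apply, this]
    · have h' : ¬ ∃ i, (e.trans (Function.Embedding.inl : K ↪ K ⊕ A)) i = Sum.inl c := by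
        simpa using h
      simp [Function.extend_apply' _ _ _ h, Function.extend_apply' _ _ _ h']
  simp only [h1, h2]
  split_ifs
  · rfl
  · simp

end

end

end OptionPricing

namespace OptionPricing

noncomputable section

/-! ### Phase estimation: the distribution of the outcome -/

/-- A finite bit string, continued by zeros. -/
def pad {n : ℕ} (y : Fin n → Bool) (k : ℕ) : Bool := if h : k < n then y ⟨k, h⟩ else false

/-- The angle read off from the first `k` outcome bits. -/
def outcomeAngle (y : ℕ → Bool) : ℕ → ℝ
  | 0 => 0
  | k + 1 => (if y k then Real.pi else 0) + outcomeAngle y k / 2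

lemma outcomeAngle_congr {y y' : ℕ → Bool} : ∀ {k : ℕ}, (∀ j < k, y j = y' j) →
    outcomeAngle y k = outcomeAngle y' k
  | 0, _ => rfl
  | k + 1, h => by
    rw [outcomeAngle, outcomeAngle, h k (by omega),
      outcomeAngle_congr fun j hj => h j (by omega)]

/-- The probability of the outcome `y` of phase estimation with `n` bits for the phase `φ`. -/
def outcomeProb (n : ℕ) (φ : ℝ) (y : ℕ → Bool) : ℝ :=
  ∏ k ∈ Finset.range n, Real.cos ((2 ^ (n - 1 - k) * φ - outcomeAngle y (k + 1)) / 2) ^ 2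

lemma outcomeProb_nonneg (n : ℕ) (φ : ℝ) (y : ℕ → Bool) : 0 ≤ outcomeProb n φ y :=
  Finset.prod_nonneg fun _ _ => sq_nonneg _

lemma pad_snoc_of_lt {n : ℕ} (y : Fin n → Bool) (v : Bool) {k : ℕ} (hk : k < n) :
    pad (Fin.snoc (α := fun _ => Bool) y v) k = pad y k := by
  have h : k < n + 1 := by omega
  simp only [pad, hk, h, dif_pos, Fin.snoc]
  rfl

lemma pad_snoc_self {n : ℕ} (y : Fin n → Bool) (v : Bool) :
    pad (Fin.snoc (α := fun _ => Bool) y v) n = v := by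
  simp [pad, Fin.snoc]

lemma outcomeAngle_snoc {n : ℕ} (y : Fin n → Bool) (v : Bool) :
    outcomeAngle (pad (Fin.snoc (α := fun _ => Bool) y v)) (n + 1) =
      (if v then Real.pi else 0) + outcomeAngle (pad y) n / 2 := by
  rw [outcomeAngle, pad_snoc_self, outcomeAngle_congr fun j hj => pad_snoc_of_lt y v hj]

/-- The highest power of the operator is read first, so the first n of n + 1 bits are those of an
experiment for the phase 2φ. The last bit is then a coin whose bias depends on the remaining error
of that experiment. -/
lemma outcomeProb_snoc {n : ℕ} (φ : ℝ) (y : Fin n → Bool) (v : Bool) :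
    outcomeProb (n + 1) φ (pad (Fin.snoc (α := fun _ => Bool) y v)) =
      outcomeProb n (2 * φ) (pad y) *
        (if v then Real.sin ((2 * φ - outcomeAngle (pad y) n) / 2 / 2) ^ 2
          else Real.cos ((2 * φ - outcomeAngle (pad y) n) / 2 / 2) ^ 2) := by
  rw [outcomeProb, Finset.prod_range_succ, outcomeAngle_snoc]
  congr 1
  · refine Finset.prod_congr rfl fun k hk => ?_
    have hk' := Finset.mem_range.1 hk
    rw [outcomeAngle_congr fun j hj => pad_snoc_of_lt y v (by omega),
      show n + 1 - 1 - k = (n - 1 - k) + 1 by omega]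
    ring_nf
  · cases v
    · simp only [Nat.add_sub_cancel, Nat.sub_self, pow_zero, one_mul, Bool.false_eq_true, if_false]
      congr 2
      ring
    · simp only [Nat.add_sub_cancel, Nat.sub_self, pow_zero, one_mul, if_true]
      rw [← Real.cos_pi_div_two_sub, ← Real.cos_neg]
      congr 2
      ring

lemma sum_snoc {n : ℕ} (F : (Fin (n + 1) → Bool) → ℝ) :
    ∑ y, F y = ∑ y : Fin n → Bool, (F (Fin.snoc (α := fun _ => Bool) y true) +
      F (Fin.snoc (α := fun _ => Bool) y false)) := by
  rw [← (Fin.snocEquiv (fun _ : Fin (n + 1) => Bool)).sum_comp, Fintype.sum_prod_type_right]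
  exact Finset.sum_congr rfl fun y _ => Fintype.sum_bool _

lemma sum_outcomeProb : ∀ (n : ℕ) (φ : ℝ), ∑ y : Fin n → Bool, outcomeProb n φ (pad y) = 1
  | 0, φ => by simp [outcomeProb]
  | n + 1, φ => by
    rw [sum_snoc, ← sum_outcomeProb n (2 * φ)]
    refine Finset.sum_congr rfl fun y _ => ?_
    rw [outcomeProb_snoc, outcomeProb_snoc, ← mul_add]
    simp

/-- Let δ be half the error in the doubled phase. The two values of the new bit contribute 2
sin²(δ/2) cos²(δ/2) = sin²(δ)/2, so each bit halves the mean square error. -/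
lemma sum_outcomeProb_sin_sq : ∀ (n : ℕ) (φ : ℝ), ∑ y : Fin n → Bool, outcomeProb n φ (pad y) *
      Real.sin ((φ - outcomeAngle (pad y) n) / 2) ^ 2 ≤ 1 / 2 ^ n
  | 0, φ => by
    simpa [outcomeProb, outcomeAngle] using Real.abs_sin_le_one (φ / 2)
  | n + 1, φ => by
    rw [sum_snoc, pow_succ, ← div_div, le_div_iff₀ (by norm_num), Finset.sum_mul]
    refine le_trans (Finset.sum_le_sum fun y _ => ?_) (sum_outcomeProb_sin_sq n (2 * φ))
    rw [outcomeProb_snoc, outcomeProb_snoc, outcomeAngle_snoc, outcomeAngle_snoc]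
    set δ := (2 * φ - outcomeAngle (pad y) n) / 2 with hδ
    simp only [if_true, Bool.false_eq_true, if_false]
    have h1 : (φ - (Real.pi + outcomeAngle (pad y) n / 2)) / 2 = δ / 2 - Real.pi / 2 := by
      rw [hδ]; ring
    have h2 : (φ - (0 + outcomeAngle (pad y) n / 2)) / 2 = δ / 2 := by rw [hδ]; ring
    have h3 : Real.sin δ = 2 * Real.sin (δ / 2) * Real.cos (δ / 2) := by
      rw [← Real.sin_two_mul]; ring_nf
    rw [h1, h2, h3, Real.sin_sub_pi_div_two]
    apply le_of_eq
    ring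

/-- With s = |sin(δ/2)| and c = |cos(δ/2)|, the new bit gives the mean error sc(s + c) ≤ sc + (sc)²
= |sin δ|/2 + sin²(δ)/4. Combined with the mean square bound this gives the recursion solved by (1 +
n/2)/2^n. The mean square alone would only give 2^(-n/2), and the quadratic speedup would be lost.
-/
lemma sum_outcomeProb_abs_sin : ∀ (n : ℕ) (φ : ℝ), ∑ y : Fin n → Bool, outcomeProb n φ (pad y) *
      |Real.sin ((φ - outcomeAngle (pad y) n) / 2)| ≤ (1 + n / 2) / 2 ^ n
  | 0, φ => by
    simpa [outcomeProb, outcomeAngle] using Real.abs_sin_le_one (φ / 2)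
  | n + 1, φ => by
    have ih := sum_outcomeProb_abs_sin n (2 * φ)
    have ih2 := sum_outcomeProb_sin_sq n (2 * φ)
    have key : ∀ y : Fin n → Bool,
        outcomeProb (n + 1) φ (pad (Fin.snoc (α := fun _ => Bool) y true)) * |Real.sin ((φ -
          outcomeAngle (pad (Fin.snoc (α := fun _ => Bool) y true)) (n + 1)) / 2)| +
        outcomeProb (n + 1) φ (pad (Fin.snoc (α := fun _ => Bool) y false)) * |Real.sin ((φ -
          outcomeAngle (pad (Fin.snoc (α := fun _ => Bool) y false)) (n + 1)) / 2)| ≤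
        1 / 2 * (outcomeProb n (2 * φ) (pad y) *
          |Real.sin ((2 * φ - outcomeAngle (pad y) n) / 2)|) +
        1 / 4 * (outcomeProb n (2 * φ) (pad y) *
          Real.sin ((2 * φ - outcomeAngle (pad y) n) / 2) ^ 2) := by
      intro y
      rw [outcomeProb_snoc, outcomeProb_snoc, outcomeAngle_snoc, outcomeAngle_snoc]
      have hp := outcomeProb_nonneg n (2 * φ) (pad y)
      set p := outcomeProb n (2 * φ) (pad y)
      set δ := (2 * φ - outcomeAngle (pad y) n) / 2 with hδ
      simp only [if_true, Bool.false_eq_true, if_false]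
      have h1 : (φ - (Real.pi + outcomeAngle (pad y) n / 2)) / 2 = δ / 2 - Real.pi / 2 := by
        rw [hδ]; ring
      have h2 : (φ - (0 + outcomeAngle (pad y) n / 2)) / 2 = δ / 2 := by rw [hδ]; ring
      have h3 : Real.sin δ = 2 * Real.sin (δ / 2) * Real.cos (δ / 2) := by
        rw [← Real.sin_two_mul]; ring_nf
      rw [h1, h2, h3, Real.sin_sub_pi_div_two, abs_neg, abs_mul, abs_mul, abs_two,
        ← sq_abs (Real.sin (δ / 2)), ← sq_abs (Real.cos (δ / 2)), mul_pow, mul_pow,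
        ← sq_abs (Real.sin (δ / 2)), ← sq_abs (Real.cos (δ / 2))]
      have hs := Real.abs_sin_le_one (δ / 2)
      have hc := Real.abs_cos_le_one (δ / 2)
      have hs0 := abs_nonneg (Real.sin (δ / 2))
      have hc0 := abs_nonneg (Real.cos (δ / 2))
      set s := |Real.sin (δ / 2)|
      set c := |Real.cos (δ / 2)|
      -- This is s + c ≤ 1 + sc, multiplied by the nonnegative weight p s c.
      have h4 : 0 ≤ p * (s * c) * ((1 - s) * (1 - c)) :=
        mul_nonneg (mul_nonneg hp (mul_nonneg hs0 hc0))
          (mul_nonneg (by linarith) (by linarith))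
      linarith [h4]
    rw [sum_snoc]
    refine (Finset.sum_le_sum fun y _ => key y).trans ?_
    rw [Finset.sum_add_distrib, ← Finset.mul_sum, ← Finset.mul_sum]
    have : (1 + ((n + 1 : ℕ) : ℝ) / 2) / 2 ^ (n + 1) =
        1 / 2 * ((1 + (n : ℝ) / 2) / 2 ^ n) + 1 / 4 * (1 / 2 ^ n) := by
      rw [pow_succ]
      push_cast
      field_simp
      ring
    rw [this]
    linarith

lemma abs_cos_sq_sub_cos_sq_le (x y : ℝ) : |Real.cos x ^ 2 - Real.cos y ^ 2| ≤ |Real.sin (x - y)| := by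
  have h : Real.cos x ^ 2 - Real.cos y ^ 2 = -(Real.sin (x + y) * Real.sin (x - y)) := by
    rw [Real.sin_add, Real.sin_sub]
    have h1 := Real.sin_sq_add_cos_sq x
    have h2 := Real.sin_sq_add_cos_sq y
    linear_combination Real.cos y ^ 2 * h1 - Real.cos x ^ 2 * h2
  rw [h, abs_neg, abs_mul]
  exact mul_le_of_le_one_left (abs_nonneg _) (Real.abs_sin_le_one _)

/-- The estimate of `cos² (φ / 2)` is off by more than `η` only with small probability. -/
lemma sum_outcomeProb_bad_le (n : ℕ) (φ : ℝ) {η : ℝ} (hη : 0 < η) :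
    ∑ y : Fin n → Bool, (if |Real.cos (outcomeAngle (pad y) n / 2) ^ 2 - Real.cos (φ / 2) ^ 2| ≤ η
      then 0 else outcomeProb n φ (pad y)) ≤ (1 + n / 2) / 2 ^ n / η := by
  -- Markov's inequality for |sin((φ - estimate)/2)|, which dominates the error of cos²(φ/2).
  rw [le_div_iff₀ hη, Finset.sum_mul]
  refine le_trans (Finset.sum_le_sum fun y _ => ?_) (sum_outcomeProb_abs_sin n φ)
  split_ifs with h
  · rw [zero_mul]
    exact mul_nonneg (outcomeProb_nonneg _ _ _) (abs_nonneg _)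
  · refine mul_le_mul_of_nonneg_left ?_ (outcomeProb_nonneg _ _ _)
    rw [not_le] at h
    refine h.le.trans ((abs_cos_sq_sub_cos_sq_le _ _).trans (le_of_eq ?_))
    rw [← abs_neg, ← Real.sin_neg]
    congr 2
    ring

/-- The amplitude of the outcome `y` after `k` of `n` bits have been read. -/
def outcomeAmp (n : ℕ) (φ : ℝ) (y : ℕ → Bool) (k : ℕ) : ℂ :=
  ∏ j ∈ Finset.range k,
    (1 + Complex.exp ((2 ^ (n - 1 - j) * φ - outcomeAngle y (j + 1) : ℝ) * Complex.I)) / 2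

lemma norm_one_add_exp_div_two_sq (x : ℝ) :
    ‖(1 + Complex.exp (x * Complex.I)) / 2‖ ^ 2 = Real.cos (x / 2) ^ 2 := by
  have h1 : Real.cos x = 2 * Real.cos (x / 2) ^ 2 - 1 := by
    rw [← Real.cos_two_mul]
    congr 1
    ring
  have h2 := Real.sin_sq_add_cos_sq x
  have h3 : (1 + Complex.exp (x * Complex.I)) / 2 =
      ((1 + Real.cos x) / 2 : ℝ) + (Real.sin x / 2 : ℝ) * Complex.I := by
    rw [Complex.exp_mul_I]
    push_cast
    ring
  rw [h3, ← Complex.normSq_eq_norm_sq, Complex.normSq_add_mul_I]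
  nlinarith

lemma norm_outcomeAmp_sq (n : ℕ) (φ : ℝ) (y : ℕ → Bool) :
    ‖outcomeAmp n φ y n‖ ^ 2 = outcomeProb n φ y := by
  rw [outcomeAmp, norm_prod, ← Finset.prod_pow, outcomeProb]
  exact Finset.prod_congr rfl fun k _ => norm_one_add_exp_div_two_sq _

lemma outcomeAmp_congr {n : ℕ} {φ : ℝ} {y y' : ℕ → Bool} {k : ℕ} (h : ∀ j < k, y j = y' j) :
    outcomeAmp n φ y k = outcomeAmp n φ y' k := by
  refine Finset.prod_congr rfl fun j hj => ?_
  have hj' := Finset.mem_range.1 hj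
  rw [outcomeAngle_congr fun i hi => h i (by omega)]

/-! ### Phase estimation: the circuit -/

/-- States of a control register of `n` qubits and a further register. -/
abbrev CtrlState (n : ℕ) (C : Type) : Type := (Fin n → Bool) → QState C

/-- The Hadamard gate on a control qubit. -/
def ctrlHadamard {n : ℕ} {C : Type} (k : Fin n) (Φ : CtrlState n C) : CtrlState n C :=
  fun y c => ∑ v : Bool, hadamard (y k) v * Φ (Function.update y k v) c

/-- The controlled operator `G`. -/
def ctrlApply {n : ℕ} {C : Type} (k : Fin n) (G : QState C → QState C) (Φ : CtrlState n C) :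
    CtrlState n C :=
  fun y => if y k then G (Φ y) else Φ y

/-- A diagonal operator on the control register. -/
def ctrlPhase {n : ℕ} {C : Type} (D : (Fin n → Bool) → ℂ) (Φ : CtrlState n C) : CtrlState n C :=
  fun y c => D y * Φ y c

lemma ctrlApply_iterate {n : ℕ} {C : Type} (k : Fin n) (G : QState C → QState C) (p : ℕ)
    (Φ : CtrlState n C) : (ctrlApply k G)^[p] Φ = ctrlApply k G^[p] Φ := by
  induction p generalizing Φ with
  | zero => funext y; simp [ctrlApply]
  | succ p ih =>
    rw [Function.iterate_succ_apply, ih]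
    funext y
    by_cases h : y k <;> simp [ctrlApply, h]

/-- The correction by the bits read before the bit `k`. -/
def readPhase {n : ℕ} (k : Fin n) (y : Fin n → Bool) : ℂ :=
  if y k then Complex.exp ((-(outcomeAngle (pad y) k / 2) : ℝ) * Complex.I) else 1

/-- Reading one bit of the phase. -/
def readStep {n : ℕ} {C : Type} (G : QState C → QState C) (k : Fin n) (Φ : CtrlState n C) :
    CtrlState n C :=
  ctrlHadamard k (ctrlPhase (readPhase k)
    ((ctrlApply k G)^[2 ^ (n - 1 - (k : ℕ))] (ctrlHadamard k Φ)))

/-- Reading the first `k` bits of the phase. -/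
def readBits {n : ℕ} {C : Type} (G : QState C → QState C) : ℕ → CtrlState n C → CtrlState n C
  | 0, Φ => Φ
  | k + 1, Φ => if h : k < n then readStep G ⟨k, h⟩ (readBits G k Φ) else readBits G k Φ

lemma pad_update_of_lt {n : ℕ} (y : Fin n → Bool) (k : Fin n) (v : Bool) {j : ℕ} (hj : j < k) :
    pad (Function.update y k v) j = pad y j := by
  unfold pad
  split_ifs with h
  · exact Function.update_of_ne (by rintro rfl; simp at hj) _ _
  · rfl

lemma pad_apply {n : ℕ} (y : Fin n → Bool) (k : Fin n) : pad y k = y k := by simp [pad]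

section

variable {n : ℕ} {C : Type} {G : QState C → QState C} {U₁ U₂ : QState C} {φ₁ φ₂ : ℝ}

lemma iterate_eigen
    (hG : ∀ a b : ℂ, G (a • U₁ + b • U₂) = (a * Complex.exp (φ₁ * Complex.I)) • U₁ +
      (b * Complex.exp (φ₂ * Complex.I)) • U₂) (a b : ℂ) (p : ℕ) :
    G^[p] (a • U₁ + b • U₂) = (a * Complex.exp ((p * φ₁ : ℝ) * Complex.I)) • U₁ +
      (b * Complex.exp ((p * φ₂ : ℝ) * Complex.I)) • U₂ := by
  induction p generalizing a b with
  | zero => simp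
  | succ p ih =>
    rw [Function.iterate_succ_apply, hG, ih]
    congr 2 <;>
    · rw [mul_assoc, ← Complex.exp_add]
      congr 2
      push_cast
      ring

lemma exp_outcome (φ : ℝ) (k : Fin n) (y : Fin n → Bool) :
    Complex.exp ((2 ^ (n - 1 - (k : ℕ)) * φ - outcomeAngle (pad y) (k + 1) : ℝ) * Complex.I) =
      (if y k then -1 else 1) * (Complex.exp ((-(outcomeAngle (pad y) k / 2) : ℝ) * Complex.I) *
        Complex.exp ((((2 ^ (n - 1 - (k : ℕ)) : ℕ) : ℝ) * φ : ℝ) * Complex.I)) := by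
  rw [outcomeAngle, pad_apply]
  have h1 : (if y k then -1 else 1 : ℂ) =
      Complex.exp ((-(if y k then Real.pi else 0) : ℝ) * Complex.I) := by
    split_ifs
    · push_cast
      rw [neg_mul, Complex.exp_neg, Complex.exp_pi_mul_I]
      norm_num
    · simp
  rw [h1, ← Complex.exp_add, ← Complex.exp_add]
  congr 1
  push_cast
  ring

/-- A Hadamard test: the fresh control qubit is put in superposition, the branch where it is one
acquires the power of G and the correction by the bits already read, and the second Hadamard gate
makes the branches interfere. The correction is a coherent phase, not a measurement followed by
feedback. -/
lemma readStep_apply (k : Fin n) {Φ : CtrlState n C} {y : Fin n → Bool} {W' : QState C}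
    (h1 : Φ (Function.update y k true) = 0)
    (hW : G^[2 ^ (n - 1 - (k : ℕ))] ((((√2 : ℝ) : ℂ)⁻¹) • Φ (Function.update y k false)) =
      (((√2 : ℝ) : ℂ)⁻¹) • W') (c : C → Bool) :
    readStep G k Φ y c = (Φ (Function.update y k false) c + (if y k then -1 else 1) *
      (Complex.exp ((-(outcomeAngle (pad y) k / 2) : ℝ) * Complex.I) * W' c)) / 2 := by
  have hang : ∀ v, outcomeAngle (pad (Function.update y k v)) k = outcomeAngle (pad y) k :=
    fun v => outcomeAngle_congr fun j hj => pad_update_of_lt _ _ _ hj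
  have hH : ∀ v, ctrlHadamard k Φ (Function.update y k v) =
      (((√2 : ℝ) : ℂ)⁻¹) • Φ (Function.update y k false) := by
    intro v
    funext c
    simp only [ctrlHadamard, Fintype.sum_bool, Function.update_idem, h1]
    simp [hadamard, -Complex.ofReal_inv]
  have h2 := inv_sqrt_two_sq
  rw [readStep, ctrlApply_iterate]
  generalize 2 ^ (n - 1 - (k : ℕ)) = p at hW ⊢
  generalize ctrlHadamard k Φ = Ψ at hH ⊢
  simp only [ctrlHadamard, Fintype.sum_bool, ctrlPhase, readPhase, ctrlApply,
    Function.update_self, if_true, Bool.false_eq_true, if_false, hH, hW, hang]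
  simp only [Pi.smul_apply, smul_eq_mul, hadamard]
  generalize Complex.exp ((-(outcomeAngle (pad y) k / 2) : ℝ) * Complex.I) = E
  generalize Φ (Function.update y k false) c = w
  generalize W' c = w'
  generalize ((√2 : ℝ) : ℂ)⁻¹ = r at h2
  cases y k
  · simp only [Bool.false_and, Bool.and_false, Bool.false_eq_true, if_false]
    linear_combination (w + E * w') * h2
  · simp only [Bool.and_true, Bool.and_false, Bool.false_eq_true, if_false, if_true]
    linear_combination (w - E * w') * h2

lemma outcomeAmp_succ (φ : ℝ) (k : Fin n) (y : Fin n → Bool) :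
    outcomeAmp n φ (pad y) (k + 1) = outcomeAmp n φ (pad y) k *
      ((1 + (if y k then -1 else 1) *
        (Complex.exp ((-(outcomeAngle (pad y) k / 2) : ℝ) * Complex.I) *
        Complex.exp ((((2 ^ (n - 1 - (k : ℕ)) : ℕ) : ℝ) * φ : ℝ) * Complex.I))) / 2) := by
  rw [outcomeAmp, Finset.prod_range_succ, ← outcomeAmp, exp_outcome φ k y]

/-- The invariant: unread control qubits are zero, and each eigenvector carries its own product of
interference amplitudes. The initial state is a superposition of eigenvectors, so the two are
followed together. -/
lemma readBits_apply
    (hG : ∀ a b : ℂ, G (a • U₁ + b • U₂) = (a * Complex.exp (φ₁ * Complex.I)) • U₁ +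
      (b * Complex.exp (φ₂ * Complex.I)) • U₂) :
    ∀ k ≤ n, ∀ y : Fin n → Bool,
      readBits G k (fun y => if ∀ j, y j = false then U₁ + U₂ else 0) y =
        if ∀ j : Fin n, k ≤ j → y j = false then
          outcomeAmp n φ₁ (pad y) k • U₁ + outcomeAmp n φ₂ (pad y) k • U₂ else 0 := by
  intro k
  induction k with
  | zero =>
    intro _ y
    simp [readBits, outcomeAmp]
  | succ k ih =>
    intro hk y
    have hk' : k < n := by omega
    have ih := ih (by omega)
    rw [readBits, dif_pos hk']
    obtain ⟨κ, hκ⟩ : ∃ κ : Fin n, (⟨k, hk'⟩ : Fin n) = κ := ⟨_, rfl⟩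
    rw [hκ]
    have hκk : (κ : ℕ) = k := by rw [← hκ]
    generalize readBits G k (fun y => if ∀ j, y j = false then U₁ + U₂ else (0 : QState C)) = Φ
      at ih ⊢
    have h1 : Φ (Function.update y κ true) = 0 := by
      rw [ih, if_neg]
      push Not
      exact ⟨κ, hκk.ge, by simp⟩
    by_cases hy : ∀ j : Fin n, k + 1 ≤ j → y j = false
    · rw [if_pos hy]
      have h0 : ∀ j : Fin n, k ≤ j → Function.update y κ false j = false := by
        intro j hj
        by_cases hjk : j = κ
        · subst hjk; simp
        · rw [Function.update_of_ne hjk]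
          refine hy j ?_
          have : (j : ℕ) ≠ k := fun h => hjk (Fin.ext (h.trans hκk.symm))
          omega
      have hcongr : ∀ φ, outcomeAmp n φ (pad (Function.update y κ false)) k =
          outcomeAmp n φ (pad y) k := fun φ => outcomeAmp_congr fun j hj =>
        pad_update_of_lt _ _ _ (by omega)
      have hW : Φ (Function.update y κ false) =
          outcomeAmp n φ₁ (pad y) k • U₁ + outcomeAmp n φ₂ (pad y) k • U₂ := by
        rw [ih, if_pos h0, hcongr, hcongr]
      funext c
      rw [readStep_apply κ h1 (c := c) (W' :=
        (outcomeAmp n φ₁ (pad y) k *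
          Complex.exp ((((2 ^ (n - 1 - k) : ℕ) : ℝ) * φ₁ : ℝ) * Complex.I)) • U₁ +
        (outcomeAmp n φ₂ (pad y) k *
          Complex.exp ((((2 ^ (n - 1 - k) : ℕ) : ℝ) * φ₂ : ℝ) * Complex.I)) • U₂), hW]
      · have hA₁ := outcomeAmp_succ φ₁ κ y
        have hA₂ := outcomeAmp_succ φ₂ κ y
        rw [hκk] at hA₁ hA₂
        rw [hA₁, hA₂, hκk]
        simp only [Pi.add_apply, Pi.smul_apply, smul_eq_mul]
        ring
      · rw [hW, smul_add, smul_smul, smul_smul, iterate_eigen hG, hκk, smul_add, smul_smul,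
          smul_smul, mul_assoc, mul_assoc]
    · rw [if_neg hy]
      have h0 : Φ (Function.update y κ false) = 0 := by
        rw [ih, if_neg]
        push Not at hy ⊢
        obtain ⟨j, hj, hjy⟩ := hy
        refine ⟨j, by omega, ?_⟩
        have : j ≠ κ := by rintro rfl; omega
        simpa [this] using hjy
      have hG0 : ∀ p, G^[p] (0 : QState C) = 0 := fun p => by
        simpa using iterate_eigen hG 0 0 p
      funext c
      rw [readStep_apply κ h1 (c := c) (W' := 0) (by simp only [h0, smul_zero, hG0]), h0]
      simp

/-- The state after phase estimation. -/
lemma readBits_all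
    (hG : ∀ a b : ℂ, G (a • U₁ + b • U₂) = (a * Complex.exp (φ₁ * Complex.I)) • U₁ +
      (b * Complex.exp (φ₂ * Complex.I)) • U₂) (y : Fin n → Bool) :
    readBits G n (fun y => if ∀ j, y j = false then U₁ + U₂ else 0) y =
      outcomeAmp n φ₁ (pad y) n • U₁ + outcomeAmp n φ₂ (pad y) n • U₂ := by
  rw [readBits_apply hG n le_rfl, if_pos fun j hj => absurd hj (by omega)]

end

end

end OptionPricing

namespace OptionPricing

noncomputable section

/-! ### The Grover operator -/

section Scaled

variable {C : Type} {ψ : QState C} {f : (C → Bool) → Bool}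

/-- The state `ψ` with the part where `f` holds scaled by `P` and the other part by `Q`. -/
def scaled {C : Type} (ψ : QState C) (f : (C → Bool) → Bool) (P Q : ℂ) : QState C :=
  fun c => (if f c then P else Q) * ψ c

lemma scaled_one_one : scaled ψ f 1 1 = ψ := by
  funext c
  simp [scaled]

lemma smul_scaled_add (a b P Q P' Q' : ℂ) :
    a • scaled ψ f P Q + b • scaled ψ f P' Q' = scaled ψ f (a * P + b * P') (a * Q + b * Q') := by
  funext c
  simp only [scaled, Pi.add_apply, Pi.smul_apply, smul_eq_mul]
  split_ifs <;> ring

end Scaled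

section Grover

variable {C : Type} [Fintype C] [DecidableEq C]

/-- The Grover operator of the state `ψ` and the predicate `f`. -/
def groverOp (ψ : QState C) (f : (C → Bool) → Bool) (φ : QState C) : QState C :=
  fun c => (if f c then -1 else 1) * φ c -
    2 * dot ψ (fun c => (if f c then -1 else 1) * φ c) * ψ c

/-- The probability of `f` in the state `ψ`. -/
def predProb (ψ : QState C) (f : (C → Bool) → Bool) : ℝ := ∑ c, if f c then ‖ψ c‖ ^ 2 else 0

variable {ψ : QState C} {f : (C → Bool) → Bool}

lemma sum_not_predProb (hψ : ∑ c, ‖ψ c‖ ^ 2 = 1) :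
    ∑ c, (if f c then 0 else ‖ψ c‖ ^ 2) = 1 - predProb ψ f := by
  rw [eq_sub_iff_add_eq, predProb, ← Finset.sum_add_distrib, ← hψ]
  exact Finset.sum_congr rfl fun c _ => by split_ifs <;> simp

lemma dot_scaled (hψ : ∑ c, ‖ψ c‖ ^ 2 = 1) (P Q : ℂ) :
    dot ψ (scaled ψ f P Q) = P * predProb ψ f + Q * ((1 - predProb ψ f : ℝ) : ℂ) := by
  rw [← sum_not_predProb hψ, predProb, dot, Complex.ofReal_sum, Complex.ofReal_sum,
    Finset.mul_sum, Finset.mul_sum, ← Finset.sum_add_distrib]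
  refine Finset.sum_congr rfl fun c _ => ?_
  have h : star (ψ c) * ψ c = ((‖ψ c‖ ^ 2 : ℝ) : ℂ) := by
    rw [Complex.star_def, mul_comm, Complex.mul_conj, Complex.normSq_eq_norm_sq]
  simp only [scaled]
  split_ifs
  · rw [← h]
    simp
    ring
  · rw [← h]
    simp
    ring

/-- The plane spanned by the parts of ψ where f holds and where it fails is invariant, so the Grover
operator is reduced to a two by two matrix. -/
lemma groverOp_scaled (hψ : ∑ c, ‖ψ c‖ ^ 2 = 1) (P Q : ℂ) :
    groverOp ψ f (scaled ψ f P Q) =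
      scaled ψ f (-P - 2 * (-P * predProb ψ f + Q * ((1 - predProb ψ f : ℝ) : ℂ)))
        (Q - 2 * (-P * predProb ψ f + Q * ((1 - predProb ψ f : ℝ) : ℂ))) := by
  have h : (fun c => (if f c then -1 else 1) * scaled ψ f P Q c) = scaled ψ f (-P) Q := by
    funext c
    simp only [scaled]
    split_ifs <;> ring
  funext c
  rw [groverOp, h, dot_scaled hψ]
  simp only [scaled]
  split_ifs <;> ring

lemma sum_norm_scaled_sq (hψ : ∑ c, ‖ψ c‖ ^ 2 = 1) (P Q : ℂ) :
    ∑ c, ‖scaled ψ f P Q c‖ ^ 2 =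
      ‖P‖ ^ 2 * predProb ψ f + ‖Q‖ ^ 2 * (1 - predProb ψ f) := by
  rw [← sum_not_predProb hψ, predProb, Finset.mul_sum, Finset.mul_sum, ← Finset.sum_add_distrib]
  refine Finset.sum_congr rfl fun c _ => ?_
  simp only [scaled]
  split_ifs <;> simp [mul_pow]

/-- The state `ψ` is the sum of two eigenvectors of the Grover operator, to conjugate eigenvalues
whose phase determines the probability of `f`; they are orthogonal and have the same length. -/
lemma exists_grover_eigen (hψ : ∑ c, ‖ψ c‖ ^ 2 = 1) (h0 : 0 < predProb ψ f)
    (h1 : predProb ψ f < 1) : ∃ (φ : ℝ) (U₁ U₂ : QState C),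
      ψ = U₁ + U₂ ∧ Real.cos (φ / 2) ^ 2 = predProb ψ f ∧
      (∀ a b : ℂ, groverOp ψ f (a • U₁ + b • U₂) =
        (a * Complex.exp (φ * Complex.I)) • U₁ +
          (b * Complex.exp ((-φ : ℝ) * Complex.I)) • U₂) ∧
      ∀ a b : ℂ, ∑ c, ‖(a • U₁ + b • U₂) c‖ ^ 2 = (‖a‖ ^ 2 + ‖b‖ ^ 2) / 2 := by
  set p := predProb ψ f with hp
  have h1' : 0 < 1 - p := by linarith
  set s := √p with hs
  set r := √(1 - p) with hr
  have hs0 : 0 < s := Real.sqrt_pos.2 h0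
  have hr0 : 0 < r := Real.sqrt_pos.2 h1'
  have hs2 : s ^ 2 = p := Real.sq_sqrt h0.le
  have hr2 : r ^ 2 = 1 - p := Real.sq_sqrt h1'.le
  -- In the orthonormal basis of the normalized parts, the Grover operator is the rotation with
  -- cosine 2p - 1 and sine 2sr; μ is one of its eigenvalues. From cos φ = 2p - 1 follows cos²(φ/2)
  -- = p.
  set μ : ℂ := ((2 * p - 1 : ℝ) : ℂ) + ((-(2 * s * r) : ℝ) : ℂ) * Complex.I with hμ
  have hμn : ‖μ‖ = 1 := by
    rw [← sq_eq_sq₀ (norm_nonneg _) zero_le_one, ← Complex.normSq_eq_norm_sq, hμ,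
      Complex.normSq_add_mul_I, neg_sq, mul_pow, mul_pow, hs2, hr2]
    ring
  have hexp : Complex.exp (μ.arg * Complex.I) = μ := by
    have := Complex.norm_mul_exp_arg_mul_I μ
    rwa [hμn, Complex.ofReal_one, one_mul] at this
  have hcos : Real.cos μ.arg = 2 * p - 1 := by
    have := congrArg Complex.re hexp
    rw [Complex.exp_ofReal_mul_I_re] at this
    rw [this, hμ]
    simp
  have hsin : Real.sin μ.arg = -(2 * s * r) := by
    have := congrArg Complex.im hexp
    rw [Complex.exp_ofReal_mul_I_im] at this
    rw [this, hμ]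
    simp
  have hexp' : Complex.exp ((-μ.arg : ℝ) * Complex.I) =
      ((2 * p - 1 : ℝ) : ℂ) + ((2 * s * r : ℝ) : ℂ) * Complex.I := by
    rw [Complex.exp_mul_I, ← Complex.ofReal_cos, ← Complex.ofReal_sin, Real.cos_neg, Real.sin_neg,
      hcos, hsin, neg_neg]
  have hsC : (s : ℂ) ≠ 0 := Complex.ofReal_ne_zero.2 hs0.ne'
  have hrC : (r : ℂ) ≠ 0 := Complex.ofReal_ne_zero.2 hr0.ne'
  have hs2C : (p : ℂ) = (s : ℂ) ^ 2 := by rw [← hs2]; push_cast; ring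
  have hr2C : ((1 - p : ℝ) : ℂ) = (r : ℂ) ^ 2 := by rw [← hr2]; push_cast; ring
  have hsr : (s : ℂ) ^ 2 + (r : ℂ) ^ 2 = 1 := by rw [← hs2C, ← hr2C]; push_cast; ring
  have hI := Complex.I_sq
  -- The components of ψ along (1, i) and (1, -i) in that basis. The division by s and r converts
  -- coordinates to multiples of the parts of ψ, which is why 0 < p < 1 is required.
  refine ⟨μ.arg, scaled ψ f ((1 - Complex.I * (r / s)) / 2) ((1 + Complex.I * (s / r)) / 2),
    scaled ψ f ((1 + Complex.I * (r / s)) / 2) ((1 - Complex.I * (s / r)) / 2), ?_, ?_, ?_, ?_⟩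
  · have := smul_scaled_add (ψ := ψ) (f := f) 1 1 ((1 - Complex.I * (r / s)) / 2)
      ((1 + Complex.I * (s / r)) / 2) ((1 + Complex.I * (r / s)) / 2)
      ((1 - Complex.I * (s / r)) / 2)
    rw [one_smul, one_smul] at this
    rw [this]
    ring_nf
    exact scaled_one_one.symm
  · rw [Real.cos_sq, mul_div_cancel₀ _ (two_ne_zero), hcos]
    ring
  · intro a b
    rw [smul_scaled_add, groverOp_scaled hψ, ← hp, smul_scaled_add, hexp, hexp', hμ, hr2C, hs2C]
    have h2p : ((2 * p - 1 : ℝ) : ℂ) = (s : ℂ) ^ 2 - (r : ℂ) ^ 2 := by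
      push_cast
      rw [hs2C]
      linear_combination hsr
    rw [h2p]
    push_cast
    congr 1
    · field_simp
      ring_nf
      simp only [hI]
      linear_combination (s * (a + b) + r * Complex.I * (b - a)) * hsr
    · field_simp
      ring_nf
      simp only [hI]
      linear_combination (s * Complex.I * (b - a) - r * (a + b)) * hsr
  · intro a b
    rw [smul_scaled_add, sum_norm_scaled_sq hψ, ← hp, ← Complex.normSq_eq_norm_sq,
      ← Complex.normSq_eq_norm_sq, ← Complex.normSq_eq_norm_sq, ← Complex.normSq_eq_norm_sq]
    obtain ⟨x, y⟩ := a
    obtain ⟨x', y'⟩ := b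
    have e1 : (⟨x, y⟩ : ℂ) * ((1 - Complex.I * (r / s)) / 2) +
        ⟨x', y'⟩ * ((1 + Complex.I * (r / s)) / 2) =
        (((x + x' + r / s * (y - y')) / 2 : ℝ) : ℂ) +
          (((y + y' - r / s * (x - x')) / 2 : ℝ) : ℂ) * Complex.I := by
      rw [Complex.mk_eq_add_mul_I, Complex.mk_eq_add_mul_I]
      push_cast
      linear_combination (r / s : ℂ) * (y' - y) / 2 * hI
    have e2 : (⟨x, y⟩ : ℂ) * ((1 + Complex.I * (s / r)) / 2) +
        ⟨x', y'⟩ * ((1 - Complex.I * (s / r)) / 2) =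
        (((x + x' - s / r * (y - y')) / 2 : ℝ) : ℂ) +
          (((y + y' + s / r * (x - x')) / 2 : ℝ) : ℂ) * Complex.I := by
      rw [Complex.mk_eq_add_mul_I, Complex.mk_eq_add_mul_I]
      push_cast
      linear_combination (s / r : ℂ) * (y - y') / 2 * hI
    rw [e1, e2, Complex.normSq_add_mul_I, Complex.normSq_add_mul_I, Complex.normSq_mk,
      Complex.normSq_mk, ← hr2, ← hs2]
    have hsr' : s ^ 2 + r ^ 2 = 1 := by rw [hs2, hr2]; ring
    field_simp
    linear_combination ((x + x') ^ 2 + (y + y') ^ 2 + (y - y') ^ 2 + (x - x') ^ 2) * hsr'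

end Grover

/-! ### Amplitude estimation -/

/-- A control register and a further register, as one register. -/
def joinState {n : ℕ} {C : Type} (Φ : CtrlState n C) : QState (Fin n ⊕ C) :=
  fun x => Φ (x ∘ Sum.inl) (x ∘ Sum.inr)

/-- The encoding of states on a control register and a further register, with ancillas. -/
def encode {n N : ℕ} {C A : Type} [Fintype A] (e : (Fin n ⊕ C) ⊕ A ≃ Fin N) (Φ : CtrlState n C) :
    QState (Fin N) :=
  relabel e (withZeros (joinState Φ))

/-! ### Gates acting on the control register, the coins and clean ancillas. -/

section Encode

variable {q t w n N : ℕ} {C A : Type} [Fintype A]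
  (e : (Fin n ⊕ C) ⊕ A ≃ Fin N)

lemma impl_ctrlHadamard [DecidableEq C] [DecidableEq A] (k : Fin n) :
    Impl (q := q) (t := t) (w := w) (encode e) 1 (fun _ _ => ctrlHadamard k) := by
  refine Impl.transfer (impl_op1 e (Sum.inl (Sum.inl k)) hadamard_mem_unitary)
    (fun Φ : CtrlState n C => withZeros (joinState Φ)) fun V f Φ => ?_
  rw [op1_withZeros]
  congr 1
  funext x
  simp only [op1, joinState, ctrlHadamard, Sum.update_inl_comp_inl, Sum.update_inl_comp_inr]
  rfl

lemma impl_op1_right [DecidableEq C] [DecidableEq A] (a : C) {u : Matrix Bool Bool ℂ}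
    (hu : u ∈ Matrix.unitaryGroup Bool ℂ) :
    Impl (q := q) (t := t) (w := w) (encode e) 1 (fun _ _ Φ y => op1 a u (Φ y)) := by
  refine Impl.transfer (impl_op1 e (Sum.inl (Sum.inr a)) hu)
    (fun Φ : CtrlState n C => withZeros (joinState Φ)) fun V f Φ => ?_
  rw [op1_withZeros]
  congr 1
  funext x
  simp only [op1, joinState, Sum.update_inr_comp_inl, Sum.update_inr_comp_inr]
  rfl

lemma extend_inr {α β ι : Type} (r : ι ↪ β) (x : α ⊕ β → Bool) (z : ι → Bool) :
    Function.extend (r.trans (Function.Embedding.inr : β ↪ α ⊕ β)) z x =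
      Sum.elim (x ∘ Sum.inl) (Function.extend r z (x ∘ Sum.inr)) := by
  funext c
  rcases c with c | c
  · exact Function.extend_apply' _ _ _ (by simp)
  · by_cases h : ∃ i, r i = c
    · obtain ⟨i, rfl⟩ := h
      have := (r.trans (Function.Embedding.inr : β ↪ α ⊕ β)).injective.extend_apply z x i
      simp only [Function.Embedding.trans_apply, Function.Embedding.inr_apply] at this
      simp [r.injective.extend_apply, this]
    · have h' : ¬ ∃ i, (r.trans (Function.Embedding.inr : β ↪ α ⊕ β)) i = Sum.inr c := by
        simpa using h
      simp [Function.extend_apply' _ _ _ h, Function.extend_apply' _ _ _ h']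

lemma applyReg_joinState {ι : Type} [Fintype ι] [DecidableEq ι] (r : ι ↪ C) (U : QMatrix ι)
    (Φ : CtrlState n C) :
    applyReg (r.trans (Function.Embedding.inr : C ↪ Fin n ⊕ C)) U (joinState Φ) =
      joinState fun y => applyReg r U (Φ y) := by
  funext x
  simp only [applyReg, joinState, extend_inr, Sum.elim_comp_inl, Sum.elim_comp_inr]
  rfl

lemma impl_initial_right (r : Fin q ↪ C) :
    Impl (t := t) (w := w) (encode e) 1
      (fun (V : InitialOracle q) _ Φ y => applyReg r V.1 (Φ y)) := by
  refine Impl.transfer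
    (impl_initial e ((r.trans Function.Embedding.inr).trans Function.Embedding.inl))
    (fun Φ : CtrlState n C => withZeros (joinState Φ)) fun V f Φ => ?_
  rw [applyReg_withZeros, applyReg_joinState]

lemma impl_initialInv_right (r : Fin q ↪ C) :
    Impl (t := t) (w := w) (encode e) 1
      (fun (V : InitialOracle q) _ Φ y => applyReg r V.1.conjTranspose (Φ y)) := by
  refine Impl.transfer
    (impl_initialInv e ((r.trans Function.Embedding.inr).trans Function.Embedding.inl))
    (fun Φ : CtrlState n C => withZeros (joinState Φ)) fun V f Φ => ?_
  rw [applyReg_withZeros, applyReg_joinState]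

lemma ImplPhase.encode {l : ℕ} {D : InitialOracle q → Table q t w → ((Fin n ⊕ C) ⊕ A → Bool) → ℂ}
    (h : ImplPhase (relabel e) l D)
    {D' : InitialOracle q → Table q t w → (Fin n → Bool) → (C → Bool) → ℂ}
    (hD : ∀ V f y c, D V f (Sum.elim (Sum.elim y c) fun _ => false) = D' V f y c) :
    Impl (encode e) l (fun V f Φ y c => D' V f y c * Φ y c) := by
  refine Impl.transfer h
    (fun Φ : CtrlState n C => withZeros (joinState Φ)) fun V f Φ => ?_
  rw [phase_withZeros (D' := fun x => D' V f (x ∘ Sum.inl) (x ∘ Sum.inr))]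
  · rfl
  · intro x
    rw [← hD, Sum.elim_comp_inl_inr]

lemma impl_ctrlPhase [DecidableEq C] [DecidableEq A] [Nonempty ((Fin n ⊕ C) ⊕ A)]
    {D : (Fin n → Bool) → ℂ}
    (hD : ∀ y, ‖D y‖ = 1) :
    Impl (q := q) (t := t) (w := w) (encode e) (diagCost n) (fun _ _ => ctrlPhase D) := by
  have h := implPhase_dependsOn (q := q) (t := t) (w := w) e
    (Finset.univ.image fun k : Fin n => Sum.inl (Sum.inl k))
    (D := fun x => D (x ∘ Sum.inl ∘ Sum.inl)) (fun x y hxy => by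
      dsimp only
      congr 1
      funext k
      exact hxy _ (by simp)) fun x => hD _
  refine Impl.congr (ImplPhase.encode e (Impl.mono h (diagCost_mono ?_))
    (D' := fun _ _ y _ => D y) fun V f y c => rfl) fun V f Φ => rfl
  exact Finset.card_image_le.trans (by simp)

lemma norm_readPhase (k : Fin n) (y : Fin n → Bool) : ‖readPhase k y‖ = 1 := by
  unfold readPhase
  split_ifs
  · exact Complex.norm_exp_ofReal_mul_I _
  · simp

/-- Each power 2^(n-1-k) is estimated by 2^n. Compared with the geometric sum this loses a factor n,
which is only logarithmic in the accuracy. -/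
lemma impl_readBits [DecidableEq C] [DecidableEq A] [Nonempty ((Fin n ⊕ C) ⊕ A)]
    {G : InitialOracle q → Table q t w → QState C → QState C} {g : ℕ}
    (hG : ∀ k : Fin n, Impl (encode e) g (fun V f => ctrlApply k (G V f))) (k : ℕ) :
    Impl (encode e) (k * (2 ^ n * g + diagCost n + 2)) (fun V f => readBits (G V f) k) := by
  induction k with
  | zero => exact (Impl.id.mono (by simp)).congr fun V f Φ => rfl
  | succ k ih =>
    by_cases hk : k < n
    · have hH := impl_ctrlHadamard (q := q) (t := t) (w := w) e ⟨k, hk⟩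
      have hD := impl_ctrlPhase (q := q) (t := t) (w := w) e (norm_readPhase ⟨k, hk⟩)
      have hp : 2 ^ (n - 1 - k) * g ≤ 2 ^ n * g :=
        Nat.mul_le_mul_right _ (Nat.pow_le_pow_right (by norm_num) (by omega))
      refine (Impl.mono (Impl.comp ih (Impl.comp (Impl.comp (Impl.comp hH
        ((hG ⟨k, hk⟩).iterate (2 ^ (n - 1 - k)))) hD) hH)) ?_).congr fun V f Φ => ?_
      · rw [add_mul, one_mul]
        omega
      · rw [readBits, dif_pos hk]
        rfl
    · refine (Impl.mono ih (Nat.mul_le_mul_right _ (by omega))).congr fun V f Φ => ?_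
      rw [readBits, dif_neg hk]

end Encode

end

end OptionPricing

namespace OptionPricing

noncomputable section

/-! ### State preparation -/

/-- The all-zero state. -/
def zeroState (Q : Type) [Fintype Q] : QState Q := fun x => if ∀ a, x a = false then 1 else 0

/-- The rotation that prepares a coin with probability `p` of `true`. -/
def rotation (p : ℝ) : Matrix Bool Bool ℂ :=
  fun a b => if a = b then (√(1 - p) : ℝ) else if a then (√p : ℝ) else (-√p : ℝ)

lemma rotation_mem_unitary {p : ℝ} (h0 : 0 ≤ p) (h1 : p ≤ 1) :
    rotation p ∈ Matrix.unitaryGroup Bool ℂ := by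
  rw [Matrix.mem_unitaryGroup_iff]
  have hs : (√p : ℂ) ^ 2 = p := by
    rw [← Complex.ofReal_pow, Real.sq_sqrt h0]
  have hr : (√(1 - p) : ℂ) ^ 2 = 1 - p := by
    rw [← Complex.ofReal_pow, Real.sq_sqrt (by linarith)]
    push_cast
    ring
  ext a b
  cases a <;> cases b <;>
    simp [Matrix.mul_apply, Matrix.star_apply, rotation] <;>
    [linear_combination hs + hr; ring; ring; linear_combination hs + hr]

lemma rotation_mul_conjTranspose {p : ℝ} (h0 : 0 ≤ p) (h1 : p ≤ 1) :
    rotation p * (rotation p).conjTranspose = 1 :=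
  Matrix.mem_unitaryGroup_iff.1 (rotation_mem_unitary h0 h1)

lemma rotation_conjTranspose_mem_unitary {p : ℝ} (h0 : 0 ≤ p) (h1 : p ≤ 1) :
    (rotation p).conjTranspose ∈ Matrix.unitaryGroup Bool ℂ := by
  rw [Matrix.mem_unitaryGroup_iff, Matrix.star_eq_conjTranspose, Matrix.conjTranspose_conjTranspose]
  exact Matrix.mem_unitaryGroup_iff'.1 (rotation_mem_unitary h0 h1)

section Layer

variable {q : ℕ} {Co : Type} [DecidableEq Co]

/-- Rotate the coins in the list `L`. -/
def layer (prob : Co → ℝ) (L : List Co) (φ : QState (Fin q ⊕ Co)) : QState (Fin q ⊕ Co) :=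
  L.foldl (fun φ k => op1 (Sum.inr k) (rotation (prob k)) φ) φ

/-- The inverse of `layer`. -/
def layerInv (prob : Co → ℝ) (L : List Co) (φ : QState (Fin q ⊕ Co)) : QState (Fin q ⊕ Co) :=
  L.foldr (fun k φ => op1 (Sum.inr k) (rotation (prob k)).conjTranspose φ) φ

/-- Prepare the label of the initial price and the coins. -/
def prepare [Fintype Co] (prob : Co → ℝ) (V : InitialOracle q) (φ : QState (Fin q ⊕ Co)) :
    QState (Fin q ⊕ Co) :=
  layer prob Finset.univ.toList (applyReg Function.Embedding.inl V.1 φ)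

/-- The inverse of `prepare`. -/
def unprepare [Fintype Co] (prob : Co → ℝ) (V : InitialOracle q) (φ : QState (Fin q ⊕ Co)) :
    QState (Fin q ⊕ Co) :=
  applyReg Function.Embedding.inl V.1.conjTranspose (layerInv prob Finset.univ.toList φ)

variable {prob : Co → ℝ}

lemma op1_add_smul {Q : Type} [DecidableEq Q] (a : Q) (u : Matrix Bool Bool ℂ) (φ χ : QState Q)
    (z : ℂ) : op1 a u (φ + z • χ) = op1 a u φ + z • op1 a u χ := by
  simp only [← applyReg_single, applyReg_add, applyReg_smul]

lemma layer_add_smul (L : List Co) (φ χ : QState (Fin q ⊕ Co)) (z : ℂ) :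
    layer prob L (φ + z • χ) = layer prob L φ + z • layer prob L χ := by
  induction L generalizing φ χ with
  | nil => rfl
  | cons k L ih =>
    simp only [layer, List.foldl_cons] at ih ⊢
    rw [op1_add_smul, ih]

lemma prepare_add_smul [Fintype Co] (V : InitialOracle q) (φ χ : QState (Fin q ⊕ Co)) (z : ℂ) :
    prepare prob V (φ + z • χ) = prepare prob V φ + z • prepare prob V χ := by
  rw [prepare, applyReg_add, applyReg_smul, layer_add_smul]
  rfl

lemma layer_layerInv (hp : ∀ k, 0 ≤ prob k ∧ prob k ≤ 1) (L : List Co)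
    (φ : QState (Fin q ⊕ Co)) : layer prob L (layerInv prob L φ) = φ := by
  induction L with
  | nil => rfl
  | cons k L ih =>
    simp only [layer, layerInv, List.foldl_cons, List.foldr_cons] at ih ⊢
    rw [op1_op1, rotation_mul_conjTranspose (hp k).1 (hp k).2, op1_one, ih]

lemma prepare_unprepare [Fintype Co] (hp : ∀ k, 0 ≤ prob k ∧ prob k ≤ 1) (V : InitialOracle q)
    (φ : QState (Fin q ⊕ Co)) : prepare prob V (unprepare prob V φ) = φ := by
  have hV : V.1 * V.1.conjTranspose = 1 := Matrix.mem_unitaryGroup_iff.1 V.2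
  rw [prepare, unprepare, applyReg_applyReg, hV, applyReg_one, layer_layerInv hp]

lemma dot_layer [Fintype Co] (L : List Co) (φ χ : QState (Fin q ⊕ Co)) :
    dot (layer prob L φ) χ = dot φ (layerInv prob L χ) := by
  induction L generalizing φ with
  | nil => rfl
  | cons k L ih =>
    simp only [layer, layerInv, List.foldl_cons, List.foldr_cons] at ih ⊢
    rw [ih, dot_op1]

lemma dot_prepare [Fintype Co] (V : InitialOracle q) (φ χ : QState (Fin q ⊕ Co)) :
    dot (prepare prob V φ) χ = dot φ (unprepare prob V χ) := by
  rw [prepare, unprepare, dot_layer, dot_applyReg]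

lemma dot_zeroState {Q : Type} [Fintype Q] [DecidableEq Q] (φ : QState Q) :
    dot (zeroState Q) φ = φ fun _ => false := by
  have : ∀ x : Q → Bool, (∀ a, x a = false) ↔ x = fun _ => false := fun x => funext_iff.symm
  simp [dot, zeroState, this]

/-- The reflection about the prepared state. -/
lemma prepare_reflect [Fintype Co] (hp : ∀ k, 0 ≤ prob k ∧ prob k ≤ 1) (V : InitialOracle q)
    (φ : QState (Fin q ⊕ Co)) :
    prepare prob V (fun c => (if ∀ a, c a = false then -1 else 1) * unprepare prob V φ c) =
      fun c => φ c - 2 * dot (prepare prob V (zeroState _)) φ * prepare prob V (zeroState _) c := by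
  -- The reflection about zero is the identity minus twice a rank one projection. Conjugation by the
  -- preparation moves this projection to the prepared state.
  have h : (fun c => (if ∀ a, c a = false then -1 else 1) * unprepare prob V φ c) =
      unprepare prob V φ +
        (-2 * dot (zeroState _) (unprepare prob V φ)) • zeroState (Fin q ⊕ Co) := by
    funext c
    rw [dot_zeroState]
    simp only [Pi.add_apply, Pi.smul_apply, smul_eq_mul, zeroState]
    split_ifs with hc
    · rw [funext hc]
      ring
    · ring
  rw [h, prepare_add_smul, prepare_unprepare hp, dot_prepare]
  funext c
  simp only [Pi.add_apply, Pi.smul_apply, smul_eq_mul]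
  ring

/-- The amplitude of a coin. -/
def coinAmp (p : ℝ) (v : Bool) : ℂ := if v then (√p : ℝ) else (√(1 - p) : ℝ)

/-- The invariant of the rotations: coins in S have their amplitudes, coins not yet rotated are
pinned at zero, and the amplitude stays a product. -/
lemma layer_product [Fintype Co] (B : (Fin q → Bool) → ℂ) (L : List Co) :
    ∀ S : Finset Co, L.Nodup → (∀ k ∈ L, k ∉ S) →
    layer prob L (fun c => B (c ∘ Sum.inl) * ∏ k, if k ∈ S then coinAmp (prob k) (c (Sum.inr k))
      else if c (Sum.inr k) then 0 else 1) =
    fun c => B (c ∘ Sum.inl) * ∏ k, if k ∈ S ∪ L.toFinset then coinAmp (prob k) (c (Sum.inr k))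
      else if c (Sum.inr k) then 0 else 1 := by
  induction L with
  | nil => intro S _ _; simp [layer]
  | cons a L ih =>
    intro S hL hS
    have ha : a ∉ S := hS a (by simp)
    obtain ⟨haL, hL⟩ := List.nodup_cons.1 hL
    have ih := ih (insert a S) hL (fun k hk => by
      rw [Finset.mem_insert, not_or]
      exact ⟨by rintro rfl; exact haL hk, hS k (by simp [hk])⟩)
    have hstep : op1 (Sum.inr a) (rotation (prob a))
        (fun c : Fin q ⊕ Co → Bool => B (c ∘ Sum.inl) * ∏ k, if k ∈ S then
          coinAmp (prob k) (c (Sum.inr k)) else if c (Sum.inr k) then 0 else 1) =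
        fun c => B (c ∘ Sum.inl) * ∏ k, if k ∈ insert a S then
          coinAmp (prob k) (c (Sum.inr k)) else if c (Sum.inr k) then 0 else 1 := by
      funext c
      have hu : ∀ v, Function.update c (Sum.inr a) v ∘ Sum.inl = c ∘ Sum.inl := fun v =>
        Sum.update_inr_comp_inl
      simp only [op1, Fintype.sum_bool, hu]
      have h1 : ∀ v, (∏ k, if k ∈ S then
          coinAmp (prob k) (Function.update c (Sum.inr a) v (Sum.inr k)) else
          if Function.update c (Sum.inr a) v (Sum.inr k) then 0 else 1) =
          (if v then 0 else 1) * ∏ k ∈ Finset.univ.erase a, if k ∈ S then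
          coinAmp (prob k) (c (Sum.inr k)) else if c (Sum.inr k) then 0 else 1 := by
        intro v
        rw [← Finset.mul_prod_erase _ _ (Finset.mem_univ a)]
        congr 1
        · simp [ha]
        · refine Finset.prod_congr rfl fun k hk => ?_
          have : (Sum.inr k : Fin q ⊕ Co) ≠ Sum.inr a := by
            simpa using Finset.ne_of_mem_erase hk
          simp [Function.update_of_ne this]
      rw [h1, h1, ← Finset.mul_prod_erase (f := fun k => if k ∈ insert a S then _ else _) _
        (Finset.mem_univ a)]
      have h2 : ∏ k ∈ Finset.univ.erase a, (if k ∈ insert a S then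
          coinAmp (prob k) (c (Sum.inr k)) else if c (Sum.inr k) then 0 else 1) =
          ∏ k ∈ Finset.univ.erase a, if k ∈ S then
          coinAmp (prob k) (c (Sum.inr k)) else if c (Sum.inr k) then 0 else 1 := by
        refine Finset.prod_congr rfl fun k hk => ?_
        simp [Finset.mem_insert, Finset.ne_of_mem_erase hk]
      rw [h2]
      cases hc : c (Sum.inr a) <;> simp [rotation, coinAmp] <;> ring
    have hU : S ∪ (a :: L).toFinset = insert a S ∪ L.toFinset := by
      ext k
      simp only [List.toFinset_cons, Finset.mem_union, Finset.mem_insert]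
      tauto
    rw [hU, ← ih, layer, List.foldl_cons, hstep]
    rfl

lemma prepare_zeroState [Fintype Co] (V : InitialOracle q) :
    prepare prob V (zeroState _) = fun c => V.1 (c ∘ Sum.inl) (fun _ => false) *
      ∏ k, coinAmp (prob k) (c (Sum.inr k)) := by
  have h : applyReg Function.Embedding.inl V.1 (zeroState (Fin q ⊕ Co)) =
      fun c => V.1 (c ∘ Sum.inl) (fun _ => false) *
        ∏ k, if k ∈ (∅ : Finset Co) then coinAmp (prob k) (c (Sum.inr k))
          else if c (Sum.inr k) then 0 else 1 := by
    funext c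
    have hx : ∀ z, (∀ a, Function.extend (Function.Embedding.inl : Fin q ↪ Fin q ⊕ Co) z c a = false) ↔
        z = (fun _ => false) ∧ ∀ k, c (Sum.inr k) = false := by
      intro z
      rw [Sum.forall, funext_iff]
      refine and_congr (forall_congr' fun i => ?_) (forall_congr' fun k => ?_)
      · rw [show (Sum.inl i : Fin q ⊕ Co) = (Function.Embedding.inl : Fin q ↪ Fin q ⊕ Co) i from rfl,
          (Function.Embedding.inl : Fin q ↪ Fin q ⊕ Co).injective.extend_apply]
      · rw [Function.extend_apply' _ _ _ (by simp)]
    simp only [applyReg, zeroState, hx]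
    by_cases hc : ∀ k, c (Sum.inr k) = false
    · simp [hc]
      rfl
    · have hc' := hc
      push Not at hc'
      obtain ⟨k, hk⟩ := hc'
      rw [Finset.prod_eq_zero (Finset.mem_univ k) (by simpa using hk)]
      simp [hc]
  rw [prepare, h]
  refine (layer_product (fun i => V.1 i fun _ => false) _ ∅ (Finset.nodup_toList _)
    (by simp)).trans ?_
  simp

variable {t w n N : ℕ} {A : Type} [Fintype A] [DecidableEq A]
  (e : (Fin n ⊕ (Fin q ⊕ Co)) ⊕ A ≃ Fin N)

lemma impl_prepare [Fintype Co] (hp : ∀ k, 0 ≤ prob k ∧ prob k ≤ 1) :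
    Impl (t := t) (w := w) (encode e) (Fintype.card Co + 1)
      (fun V _ Φ y => prepare prob V (Φ y)) := by
  have h := Impl.foldl (q := q) (t := t) (w := w) (enc := encode e) Finset.univ.toList
    (H := fun k _ _ Φ y => op1 (Sum.inr k) (rotation (prob k)) (Φ y))
    fun k _ => impl_op1_right e _ (rotation_mem_unitary (hp k).1 (hp k).2)
  refine (Impl.mono (Impl.comp (impl_initial_right e Function.Embedding.inl) h)
    (by simp; omega)).congr fun V f Φ => ?_
  have : ∀ (L : List Co) (Φ : CtrlState n (Fin q ⊕ Co)), L.foldl (fun Φ k y =>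
      op1 (Sum.inr k) (rotation (prob k)) (Φ y)) Φ = fun y => layer prob L (Φ y) := by
    intro L
    induction L with
    | nil => intro Φ; rfl
    | cons k L ih => intro Φ; rw [List.foldl_cons, ih]; rfl
  rw [this]
  rfl

lemma impl_unprepare [Fintype Co] (hp : ∀ k, 0 ≤ prob k ∧ prob k ≤ 1) :
    Impl (t := t) (w := w) (encode e) (Fintype.card Co + 1)
      (fun V _ Φ y => unprepare prob V (Φ y)) := by
  have h := Impl.foldl (q := q) (t := t) (w := w) (enc := encode e) Finset.univ.toList.reverse
    (H := fun k _ _ Φ y => op1 (Sum.inr k) (rotation (prob k)).conjTranspose (Φ y))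
    fun k _ => impl_op1_right e _ (rotation_conjTranspose_mem_unitary (hp k).1 (hp k).2)
  refine (Impl.mono (Impl.comp h (impl_initialInv_right e Function.Embedding.inl))
    (by simp)).congr fun V f Φ => ?_
  have : ∀ (L : List Co) (Φ : CtrlState n (Fin q ⊕ Co)), L.foldr (fun k Φ y =>
      op1 (Sum.inr k) (rotation (prob k)).conjTranspose (Φ y)) Φ =
        fun y => layerInv prob L (Φ y) := by
    intro L
    induction L with
    | nil => intro Φ; rfl
    | cons k L ih => intro Φ; rw [List.foldr_cons, ih]; rfl
  rw [List.foldl_reverse, this]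
  rfl

/-- Only the two diagonal operators need the control: when it is off, the preparation and its
inverse cancel. No controlled version of the initial price oracle is needed. -/
lemma impl_ctrlGrover [Fintype Co] (hp : ∀ k, 0 ≤ prob k ∧ prob k ≤ 1)
    {f : Table q t w → ((Fin q ⊕ Co) → Bool) → Bool} {g g' : ℕ} (k : Fin n)
    (hf : Impl (encode e) g (fun (_ : InitialOracle q) tb Φ y c =>
      (if y k && f tb c then -1 else 1) * Φ y c))
    (h0 : Impl (encode e) g' (fun (_ : InitialOracle q) (_ : Table q t w) Φ y c =>
      (if y k = true ∧ ∀ a, c a = false then -1 else 1) * Φ y c)) :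
    Impl (encode e) (g + g' + 2 * (Fintype.card Co + 1)) (fun V tb =>
      ctrlApply k (groverOp (prepare prob V (zeroState _)) (f tb))) := by
  refine (Impl.mono (Impl.comp (Impl.comp (Impl.comp hf (impl_unprepare e hp)) h0)
    (impl_prepare e hp)) (by omega)).congr fun V tb Φ => ?_
  funext y
  dsimp only [ctrlApply]
  cases y k
  · simp only [Bool.false_and, Bool.false_eq_true, false_and, if_false, one_mul]
    exact prepare_unprepare hp V _
  · simp only [Bool.true_and, true_and, if_true]
    rw [prepare_reflect hp]
    rfl

end Layer

end

end OptionPricing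

namespace OptionPricing

noncomputable section

/-! ### The complete estimation circuit -/

lemma encode_zero {q n N : ℕ} {Co A : Type} [Fintype Co] [Fintype A]
    (e : (Fin n ⊕ (Fin q ⊕ Co)) ⊕ A ≃ Fin N) :
    encode e (fun y => if ∀ j, y j = false then zeroState (Fin q ⊕ Co) else 0) =
    Pi.single (fun _ => false) 1 := by
  funext x
  have hx : x = (fun _ => false) ↔ ∀ c, x (e c) = false := by
    rw [funext_iff]
    exact e.forall_congr_right.symm
  simp only [encode, relabel, withZeros, joinState, Pi.single_apply, hx, Sum.forall,
    Function.comp_apply]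
  by_cases h1 : ∀ a, x (e (Sum.inr a)) = false <;>
  by_cases h2 : ∀ k : Fin n, x (e (Sum.inl (Sum.inl k))) = false <;>
  simp [h1, h2, zeroState]

section Estimation

variable {q t w n N ow : ℕ} {Co A : Type} [DecidableEq Co] [DecidableEq A]
  (e : (Fin n ⊕ (Fin q ⊕ Co)) ⊕ A ≃ Fin N)

/-- The values written by a lookup in the table `tab` of the control register. -/
def lookup (o : Fin ow ↪ A) (tab : (Fin n → Bool) → Fin ow → Bool)
    (c : (Fin n ⊕ (Fin q ⊕ Co)) ⊕ A) (x : (Fin n ⊕ (Fin q ⊕ Co)) ⊕ A → Bool) : Bool :=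
  Function.extend (fun j => Sum.inr (o j)) (tab (x ∘ Sum.inl ∘ Sum.inl)) (fun _ => false) c

/-- The target qubits of a lookup. -/
def lookupTargets (o : Fin ow ↪ A) : Finset ((Fin n ⊕ (Fin q ⊕ Co)) ⊕ A) :=
  Finset.univ.image fun j => Sum.inr (o j)

lemma lookup_dependsOn (o : Fin ow ↪ A) (tab : (Fin n → Bool) → Fin ow → Bool)
    (c : (Fin n ⊕ (Fin q ⊕ Co)) ⊕ A) :
    DependsOn (lookup (q := q) (Co := Co) o tab c)
      ((Finset.univ.image fun k : Fin n => Sum.inl (Sum.inl k) :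
        Finset ((Fin n ⊕ (Fin q ⊕ Co)) ⊕ A)) : Set _) := by
  intro x y hxy
  have : x ∘ Sum.inl ∘ Sum.inl = y ∘ Sum.inl ∘ Sum.inl := by
    funext k
    exact hxy _ (by simp)
  simp only [lookup, this]

lemma disjoint_lookupTargets (o : Fin ow ↪ A) :
    Disjoint (Finset.univ.image fun k : Fin n => Sum.inl (Sum.inl k))
      (lookupTargets (n := n) (q := q) (Co := Co) o) := by
  rw [Finset.disjoint_left]
  intro c hc hc'
  simp only [lookupTargets, Finset.mem_image, Finset.mem_univ, true_and] at hc hc'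
  obtain ⟨k, rfl⟩ := hc
  obtain ⟨j, hj⟩ := hc'
  cases hj

/-- The table may be arbitrary. Its cost per output qubit is 2^n times a linear factor in n, no more
than phase estimation pays up to logarithms, so the arithmetic of decoding need not be implemented.
-/
lemma implMap_lookup [Nonempty ((Fin n ⊕ (Fin q ⊕ Co)) ⊕ A)] (o : Fin ow ↪ A)
    (tab : (Fin n → Bool) → Fin ow → Bool) :
    ImplMap (q := q) (t := t) (w := w) (relabel e) (ow * xorCost n)
      (fun _ _ => xorOn (lookupTargets o) (lookup o tab)) := by
  refine Impl.mono (implMap_xorOn e (lookupTargets o) (lookup o tab)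
    (fun _ => Finset.univ.image fun k : Fin n => Sum.inl (Sum.inl k)) (k := n)
    (fun c _ => lookup_dependsOn o tab c) (fun c _ => disjoint_lookupTargets o)
    fun c _ => Finset.card_image_le.trans (by simp)) ?_
  refine Nat.mul_le_mul_right _ (Finset.card_image_le.trans (by simp))

lemma xorOn_lookup_involutive (o : Fin ow ↪ A) (tab : (Fin n → Bool) → Fin ow → Bool) :
    Function.Involutive (xorOn (lookupTargets (q := q) (Co := Co) o) (lookup o tab)) :=
  fun x => xorOn_xorOn (fun c _ => (lookup_dependsOn o tab c).mono fun a ha => by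
    simpa using Finset.disjoint_left.1 (disjoint_lookupTargets o) ha) x

lemma xorOn_lookup_apply (o : Fin ow ↪ A) (tab : (Fin n → Bool) → Fin ow → Bool)
    (x : Fin n ⊕ (Fin q ⊕ Co) → Bool) (j : Fin ow) :
    xorOn (lookupTargets o) (lookup o tab) (Sum.elim x fun _ => false) (Sum.inr (o j)) =
      tab (x ∘ Sum.inl) j := by
  have h1 : (Sum.inr (o j) : (Fin n ⊕ (Fin q ⊕ Co)) ⊕ A) ∈
      lookupTargets (n := n) (q := q) (Co := Co) o :=
    Finset.mem_image_of_mem _ (Finset.mem_univ j)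
  have h2 : Function.Injective
      (fun j => (Sum.inr (o j) : (Fin n ⊕ (Fin q ⊕ Co)) ⊕ A)) :=
    Sum.inr_injective.comp o.injective
  rw [xorOn, if_pos h1]
  simp only [Sum.elim_inr, Bool.false_xor, lookup]
  rw [h2.extend_apply (tab _) (fun _ => false) j]
  rfl

variable [Fintype Co] [Fintype A]

-- The involution s permutes the computational basis, so measuring after the lookup amounts to
-- measuring before it and applying s to the result. Ancillas that are not zero carry no amplitude.
open Classical in
lemma sum_encode_map {Φ : CtrlState n (Fin q ⊕ Co)} {s : ((Fin n ⊕ (Fin q ⊕ Co)) ⊕ A → Bool) → _}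
    (hs : Function.Involutive s) (P : ((Fin n ⊕ (Fin q ⊕ Co)) ⊕ A → Bool) → Prop) :
    ∑ x : Fin N → Bool, (if P (x ∘ e) then
      ‖relabel e (fun z => (withZeros (joinState Φ) : QState ((Fin n ⊕ (Fin q ⊕ Co)) ⊕ A)) (s z)) x‖ ^ 2
        else 0) =
    ∑ y, ∑ c, if P (s (Sum.elim (Sum.elim y c) fun _ => false)) then ‖Φ y c‖ ^ 2 else 0 := by
  have h1 : ∑ x : Fin N → Bool, (if P (x ∘ e) then
      ‖relabel e (fun z => (withZeros (joinState Φ) : QState ((Fin n ⊕ (Fin q ⊕ Co)) ⊕ A)) (s z)) x‖ ^ 2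
        else 0) = ∑ z : (Fin n ⊕ (Fin q ⊕ Co)) ⊕ A → Bool, (if P (s z) then
      ‖(withZeros (joinState Φ) : QState ((Fin n ⊕ (Fin q ⊕ Co)) ⊕ A)) z‖ ^ 2 else 0) := by
    refine Fintype.sum_equiv ((e.symm.arrowCongr (Equiv.refl Bool)).trans hs.toPerm) _ _ fun x => ?_
    have : ((e.symm.arrowCongr (Equiv.refl Bool)).trans hs.toPerm) x = s (x ∘ e) := rfl
    rw [this, hs]
    rfl
  rw [h1, ← (Equiv.sumArrowEquivProdArrow _ _ _).symm.sum_comp, Fintype.sum_prod_type,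
    ← (Equiv.sumArrowEquivProdArrow _ _ _).symm.sum_comp, Fintype.sum_prod_type]
  refine Finset.sum_congr rfl fun y _ => Finset.sum_congr rfl fun c _ => ?_
  rw [Finset.sum_eq_single (fun _ => false)]
  · simp only [withZeros, Equiv.sumArrowEquivProdArrow, Equiv.coe_fn_symm_mk, Sum.elim_inr,
      implies_true, if_true, joinState]
    rfl
  · intro a _ ha
    have : ¬ ∀ b, a b = false := fun h => ha (funext h)
    simp only [withZeros, Equiv.sumArrowEquivProdArrow, Equiv.coe_fn_symm_mk, Sum.elim_inr, this,
      if_false, norm_zero]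
    simp
  · simp

/-- Orthogonality and equal lengths of the eigenvectors remove the interference between them: the
outcome is distributed as the even mixture of phase estimation for φ and for -φ. Both phases have
the same cos²(φ/2), so the sign ambiguity is harmless. -/
lemma sum_readBits_le {ψ : QState (Fin q ⊕ Co)} {f : ((Fin q ⊕ Co) → Bool) → Bool}
    (hψ : ∑ c, ‖ψ c‖ ^ 2 = 1) (h0 : 0 < predProb ψ f) (h1 : predProb ψ f < 1)
    {η : ℝ} (hη : 0 < η) (hn : (1 + (n : ℝ) / 2) / 2 ^ n / η ≤ 1 / 100) :
    99 / 100 ≤ ∑ y : Fin n → Bool,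
      if |Real.cos (outcomeAngle (pad y) n / 2) ^ 2 - predProb ψ f| ≤ η then
        ∑ c, ‖readBits (groverOp ψ f) n (fun y => if ∀ j, y j = false then ψ else 0) y c‖ ^ 2
      else 0 := by
  obtain ⟨φ, U₁, U₂, hU, hφ, hG, hnorm⟩ := exists_grover_eigen hψ h0 h1
  have hst : ∀ y : Fin n → Bool,
      ∑ c, ‖readBits (groverOp ψ f) n (fun y => if ∀ j, y j = false then ψ else 0) y c‖ ^ 2 =
        (outcomeProb n φ (pad y) + outcomeProb n (-φ) (pad y)) / 2 := by
    intro y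
    have := readBits_all hG y
    rw [← hU] at this
    rw [this, hnorm, norm_outcomeAmp_sq, norm_outcomeAmp_sq]
  have hφ' : Real.cos (-φ / 2) ^ 2 = predProb ψ f := by rw [neg_div, Real.cos_neg, hφ]
  have hb := sum_outcomeProb_bad_le n φ hη
  have hb' := sum_outcomeProb_bad_le n (-φ) hη
  have hs := sum_outcomeProb n φ
  have hs' := sum_outcomeProb n (-φ)
  rw [hφ] at hb
  rw [hφ'] at hb'
  have key : ∑ y : Fin n → Bool,
      (if |Real.cos (outcomeAngle (pad y) n / 2) ^ 2 - predProb ψ f| ≤ η then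
        ∑ c, ‖readBits (groverOp ψ f) n (fun y => if ∀ j, y j = false then ψ else 0) y c‖ ^ 2
      else 0) = 1 / 2 * (∑ y : Fin n → Bool, outcomeProb n φ (pad y) - ∑ y : Fin n → Bool,
        if |Real.cos (outcomeAngle (pad y) n / 2) ^ 2 - predProb ψ f| ≤ η then 0
        else outcomeProb n φ (pad y)) +
        1 / 2 * (∑ y : Fin n → Bool, outcomeProb n (-φ) (pad y) - ∑ y : Fin n → Bool,
        if |Real.cos (outcomeAngle (pad y) n / 2) ^ 2 - predProb ψ f| ≤ η then 0
        else outcomeProb n (-φ) (pad y)) := by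
    rw [← Finset.sum_sub_distrib, ← Finset.sum_sub_distrib, Finset.mul_sum, Finset.mul_sum,
      ← Finset.sum_add_distrib]
    refine Finset.sum_congr rfl fun y _ => ?_
    rw [hst]
    split_ifs <;> ring
  rw [key, hs, hs']
  linarith

open Classical in
/-- Amplitude estimation: from implementations of the controlled phase oracle for the predicate
`f` and of the controlled reflection about zero, an estimate of the probability of `f`, converted
by the table `tab`. -/
lemma exists_estimation_circuit (o : Fin ow ↪ A) {prob : Co → ℝ}
    (hp : ∀ k, 0 ≤ prob k ∧ prob k ≤ 1) {f : Table q t w → ((Fin q ⊕ Co) → Bool) → Bool} {g g' : ℕ}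
    (hf : ∀ k, Impl (encode e) g (fun (_ : InitialOracle q) tb Φ y c =>
      (if y k && f tb c then -1 else 1) * Φ y c))
    (h0 : ∀ k, Impl (encode e) g' (fun (_ : InitialOracle q) (_ : Table q t w) Φ y c =>
      (if y k = true ∧ ∀ a, c a = false then -1 else 1) * Φ y c))
    (tab : (Fin n → Bool) → Fin ow → Bool) [Nonempty ((Fin n ⊕ (Fin q ⊕ Co)) ⊕ A)] :
    ∃ gs : List (Gate q t w N),
      gs.length ≤ Fintype.card Co + 1 + n * (2 ^ n * (g + g' + 2 * (Fintype.card Co + 1)) +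
        diagCost n + 2) + ow * xorCost n ∧
      ∀ (V : InitialOracle q) (tb : Table q t w),
        ∑ c, ‖prepare prob V (zeroState _) c‖ ^ 2 = 1 →
        0 < predProb (prepare prob V (zeroState _)) (f tb) →
        predProb (prepare prob V (zeroState _)) (f tb) < 1 →
        ∀ (η : ℝ), 0 < η → (1 + (n : ℝ) / 2) / 2 ^ n / η ≤ 1 / 100 →
        ∀ Good : (Fin ow → Bool) → Prop,
        (∀ y, |Real.cos (outcomeAngle (pad y) n / 2) ^ 2 -
          predProb (prepare prob V (zeroState _)) (f tb)| ≤ η → Good (tab y)) →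
        99 / 100 ≤ ∑ x : Fin N → Bool, if Good fun j => x (e (Sum.inr (o j))) then
          ‖gs.foldl (fun φ g => g.apply V tb φ) (Pi.single (fun _ => false) 1) x‖ ^ 2 else 0 := by
  obtain ⟨gs₁, hl₁, hgs₁⟩ := Impl.comp (impl_prepare (t := t) (w := w) e hp)
    (impl_readBits e (fun k => impl_ctrlGrover e hp k (hf k) (h0 k)) n)
  obtain ⟨gs₂, hl₂, hgs₂⟩ := implMap_lookup (t := t) (w := w) e o tab
  refine ⟨gs₁ ++ gs₂, by rw [List.length_append]; omega, ?_⟩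
  intro V tb hψ hpos hlt η hη hn Good hGood
  have hprep : (fun y : Fin n → Bool => prepare prob V
      (if ∀ j, y j = false then zeroState (Fin q ⊕ Co) else 0)) =
      fun y => if ∀ j, y j = false then prepare prob V (zeroState (Fin q ⊕ Co)) else 0 := by
    funext y
    split_ifs
    · rfl
    · have := prepare_add_smul (prob := prob) V 0 (0 : QState (Fin q ⊕ Co)) (-1)
      simpa using this
  have hfin := hgs₁ V tb (fun y => if ∀ j, y j = false then zeroState (Fin q ⊕ Co) else 0)
  dsimp only at hfin hgs₂
  rw [encode_zero, hprep] at hfin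
  rw [List.foldl_append, hfin, encode, hgs₂]
  have h2 := sum_encode_map e (Φ := readBits (groverOp (prepare prob V (zeroState _)) (f tb)) n
    (fun y => if ∀ j, y j = false then prepare prob V (zeroState (Fin q ⊕ Co)) else 0))
    (xorOn_lookup_involutive o tab) (fun z => Good fun j => z (Sum.inr (o j)))
  refine le_trans (sum_readBits_le hψ hpos hlt hη hn) (le_trans ?_ h2.ge)
  refine Finset.sum_le_sum fun y _ => ?_
  split_ifs with hy
  · refine Finset.sum_le_sum fun c _ => ?_
    rw [if_pos]
    simp only [xorOn_lookup_apply, Sum.elim_comp_inl]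
    exact hGood y hy
  · exact Finset.sum_nonneg fun c _ => by split_ifs <;> positivity

end Estimation

end

end OptionPricing

namespace OptionPricing

noncomputable section

/-! ### Binary representations -/

lemma natOfBits_eq_ofBits : ∀ {t : ℕ} (x : Fin t → Bool), natOfBits x = Nat.ofBits x
  | 0, x => by simp [natOfBits]
  | t + 1, x => by
    rw [Nat.ofBits_succ, ← natOfBits_eq_ofBits, natOfBits, Fin.sum_univ_succ, natOfBits,
      Finset.mul_sum, add_comm]
    congr 1
    · refine Finset.sum_congr rfl fun j _ => ?_
      simp only [Function.comp_apply, Fin.val_succ, pow_succ]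
      split_ifs <;> ring
    · cases x 0 <;> simp

lemma natOfBits_testBit {m t : ℕ} (h : m < 2 ^ t) :
    natOfBits (fun j : Fin t => m.testBit j) = m := by
  rw [natOfBits_eq_ofBits, Nat.ofBits_testBit, Nat.mod_eq_of_lt h]

lemma natOfBits_lt {t : ℕ} (x : Fin t → Bool) : natOfBits x < 2 ^ t := by
  rw [natOfBits_eq_ofBits]
  exact Nat.ofBits_lt_two_pow x

lemma testBit_natOfBits {t : ℕ} (x : Fin t → Bool) (j : ℕ) :
    (natOfBits x).testBit j = pad x j := by
  rw [natOfBits_eq_ofBits, Nat.testBit_ofBits]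
  rfl

/-- The number of up steps encoded by the sign `s` and the distance `m` from the centre `2 ^ H`. -/
def centred (H : ℕ) (s : Bool) (m : ℕ) : ℕ := if s then 2 ^ H + m else 2 ^ H - (m + 1)

/-- The `j`-th digit of `centred H s m`, given the `j`-th digit `v` of `m`. -/
def centredBit (H : ℕ) (s v : Bool) (j : ℕ) : Bool :=
  if s then v || decide (j = H) else decide (j < H) && !v

/-- Below the centre, 2^H - (m + 1) is the digitwise complement of m. So every digit of the number
of up steps is a function of the sign and of one digit of the distance, and no carries occur; this
is the reason for using m + 1 on that side. -/
lemma testBit_centred {H m : ℕ} (hm : m < 2 ^ H) (s : Bool) (j : ℕ) :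
    (centred H s m).testBit j = centredBit H s (m.testBit j) j := by
  cases s
  · simp only [centred, centredBit, Bool.false_eq_true, if_false]
    exact Nat.testBit_two_pow_sub_succ hm j
  · simp only [centred, centredBit, if_true]
    rcases lt_trichotomy j H with h | h | h
    · rw [Nat.testBit_two_pow_add_gt h]
      simp [h.ne]
    · subst h
      rw [Nat.testBit_two_pow_add_eq, Nat.testBit_lt_two_pow hm]
      simp
    · have h1 : 2 ^ (H + 1) ≤ 2 ^ j := Nat.pow_le_pow_right (by norm_num) h
      rw [pow_succ] at h1
      rw [Nat.testBit_lt_two_pow (by omega), Nat.testBit_lt_two_pow (by omega)]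
      simp [h.ne']

/-! ### The qubits of the pricing circuit -/

/-- The coins: a sign, a distance from the centre, one coin for every pair of its digits, and one
for every digit of the payoff. -/
abbrev Coins (b w : ℕ) : Type := Unit ⊕ Fin b ⊕ (Fin b × Fin b) ⊕ Fin w

/-- The ancillas: the number of up steps, the payoff, a chain of flags, the output. -/
abbrev Anc (t w L ow : ℕ) : Type := Fin t ⊕ Fin w ⊕ Fin (L + 1) ⊕ Fin ow

/-- The control register of phase estimation, the label of the initial price with the coins, and
the ancillas. -/
abbrev Qubit (q t w b n L ow : ℕ) : Type := (Fin n ⊕ (Fin q ⊕ Coins b w)) ⊕ Anc t w L ow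

section Oracle

variable {q t w b n L ow : ℕ}

/-- The sign. -/
abbrev cSign : Fin q ⊕ Coins b w := Sum.inr (Sum.inl ())
/-- A digit of the distance. -/
abbrev cDigit (i : Fin b) : Fin q ⊕ Coins b w := Sum.inr (Sum.inr (Sum.inl i))
/-- The coin for a pair of digits. -/
abbrev cPair (p : Fin b × Fin b) : Fin q ⊕ Coins b w := Sum.inr (Sum.inr (Sum.inr (Sum.inl p)))
/-- The coin for a digit of the payoff. -/
abbrev cSelect (j : Fin w) : Fin q ⊕ Coins b w := Sum.inr (Sum.inr (Sum.inr (Sum.inr j)))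
/-- A qubit of the control register. -/
abbrev qCtrl (k : Fin n) : Qubit q t w b n L ow := Sum.inl (Sum.inl k)
/-- A coin, or a qubit of the label. -/
abbrev qCoin (c : Fin q ⊕ Coins b w) : Qubit q t w b n L ow := Sum.inl (Sum.inr c)
/-- A qubit of the number of up steps. -/
abbrev qSteps (j : Fin t) : Qubit q t w b n L ow := Sum.inr (Sum.inl j)
/-- A qubit of the payoff. -/
abbrev qValue (j : Fin w) : Qubit q t w b n L ow := Sum.inr (Sum.inr (Sum.inl j))
/-- A qubit of the chain. -/
def qChain (k : ℕ) : Qubit q t w b n L ow :=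
  -- Indices beyond L are clamped, so injectivity holds only up to L.
  Sum.inr (Sum.inr (Sum.inr (Sum.inl ⟨min k L, by omega⟩)))

lemma qChain_injOn {l : ℕ} (hl : l ≤ L) :
    Set.InjOn (qChain : ℕ → Qubit q t w b n L ow) (Set.Iic l) := by
  intro i hi j hj h
  simp only [qChain, Sum.inr.injEq, Sum.inl.injEq, Fin.mk.injEq] at h
  simp only [Set.mem_Iic] at hi hj
  omega

/-- The digits of the number of up steps. -/
def stepBits (H t : ℕ) (c : Fin q ⊕ Coins b w → Bool) (j : Fin t) : Bool :=
  centredBit H (c cSign) (pad (fun i => c (cDigit i)) j) j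

/-- The digits of the payoff. -/
def valueBits (H : ℕ) (tb : Table q t w) (c : Fin q ⊕ Coins b w → Bool) (j : Fin w) : Bool :=
  tb (c ∘ Sum.inl) (stepBits H t c) j

/-- One step of the computation of the flag: first select a digit of the payoff in offset binary,
then test the coins of the pairs of digits. -/
def flagStep (v : Fin w → Bool) (c : Fin q ⊕ Coins b w → Bool) (j : ℕ) (r : Bool) : Bool :=
  if h : j < w then if c (cSelect ⟨j, h⟩) then xor (v ⟨j, h⟩) (decide (j + 1 = w)) else r
  else if h' : j - w < b * b then
    r && !(c (cDigit (finProdFinEquiv.symm ⟨j - w, h'⟩).1) &&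
      c (cDigit (finProdFinEquiv.symm ⟨j - w, h'⟩).2) && !c (cPair (finProdFinEquiv.symm ⟨j - w, h'⟩)))
  else r

/-- The flag. -/
def flag (H : ℕ) (tb : Table q t w) (c : Fin q ⊕ Coins b w → Bool) : Bool :=
  chainFold (fun j r c => flagStep (valueBits H tb c) c j r) c (w + b * b)

/-- The targets of the computation of the number of up steps. -/
def stepTargets : Finset (Qubit q t w b n L ow) := Finset.univ.image qSteps

/-- The values added in the computation of the number of up steps. -/
def stepValue (H : ℕ) (a : Qubit q t w b n L ow) (x : Qubit q t w b n L ow → Bool) : Bool :=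
  match a with
  | Sum.inr (Sum.inl j) => centredBit H (x (qCoin cSign)) (pad (fun i => x (qCoin (cDigit i))) j) j
  | _ => false

/-- The qubits used in the computation of the number of up steps. -/
def stepSupport (a : Qubit q t w b n L ow) : Finset (Qubit q t w b n L ow) :=
  match a with
  | Sum.inr (Sum.inl j) => if h : (j : ℕ) < b then {qCoin cSign, qCoin (cDigit ⟨j, h⟩)}
      else {qCoin cSign}
  | _ => ∅

lemma stepValue_dependsOn (H : ℕ) (a : Qubit q t w b n L ow) :
    DependsOn (stepValue H a) (stepSupport a : Set (Qubit q t w b n L ow)) := by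
  intro x y hxy
  rcases a with a | a | a
  · rfl
  · simp only [stepValue, stepSupport, pad] at hxy ⊢
    by_cases h : (a : ℕ) < b
    · simp only [h, dif_pos] at hxy ⊢
      rw [hxy (qCoin cSign) (by simp), hxy (qCoin (cDigit ⟨a, h⟩)) (by simp)]
    · simp only [h, dif_neg, not_false_eq_true] at hxy ⊢
      rw [hxy (qCoin cSign) (by simp)]
  · rfl

lemma stepSupport_disjoint (a : Qubit q t w b n L ow) :
    Disjoint (stepSupport a) (stepTargets : Finset (Qubit q t w b n L ow)) := by
  rw [Finset.disjoint_left]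
  intro c hc hc'
  simp only [stepTargets, Finset.mem_image, Finset.mem_univ, true_and] at hc'
  obtain ⟨j, rfl⟩ := hc'
  rcases a with a | a | a
  · simp [stepSupport] at hc
  · simp only [stepSupport] at hc
    split_ifs at hc <;> simp at hc
  · simp [stepSupport] at hc

lemma card_stepSupport_le (a : Qubit q t w b n L ow) : (stepSupport a).card ≤ 2 := by
  rcases a with a | a | a
  · simp [stepSupport]
  · simp only [stepSupport]
    split_ifs
    · exact Finset.card_le_two
    · simp
  · simp [stepSupport]

lemma implMap_steps {N : ℕ} (e : Qubit q t w b n L ow ≃ Fin N) (H : ℕ) :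
    ImplMap (q := q) (t := t) (w := w) (relabel e) (t * xorCost 2)
      (fun _ _ => xorOn stepTargets (stepValue H)) := by
  have : Nonempty (Qubit q t w b n L ow) := ⟨qCoin cSign⟩
  refine Impl.mono (implMap_xorOn e stepTargets (stepValue H) stepSupport
    (fun c _ => stepValue_dependsOn H c) (fun c _ => stepSupport_disjoint c)
    fun c _ => card_stepSupport_le c) ?_
  exact Nat.mul_le_mul_right _ (Finset.card_image_le.trans (by simp))

/-- The register of the payoff oracle. -/
def oracleReg : (Fin q ⊕ Fin t) ⊕ Fin w ↪ Qubit q t w b n L ow where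
  toFun := Sum.elim (Sum.elim (fun i => qCoin (Sum.inl i)) qSteps) qValue
  inj' := by
    rintro ((i | i) | i) ((j | j) | j) h <;> simp_all

lemma oracleReg_apply (i : (Fin q ⊕ Fin t) ⊕ Fin w) :
    (oracleReg i : Qubit q t w b n L ow) =
      Sum.elim (Sum.elim (fun i => qCoin (Sum.inl i)) qSteps) qValue i := rfl

/-- The payoff oracle as a map of basis states. -/
def payoffMap (tb : Table q t w) (x : Qubit q t w b n L ow → Bool) : Qubit q t w b n L ow → Bool :=
  fun a => match a with
  | Sum.inr (Sum.inr (Sum.inl j)) => xor (x (qValue j))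
      (tb (fun i => x (qCoin (Sum.inl i))) (fun i => x (qSteps i)) j)
  | a => x a

lemma payoffMap_payoffMap (tb : Table q t w) (x : Qubit q t w b n L ow → Bool) :
    payoffMap tb (payoffMap tb x) = x := by
  funext a
  rcases a with a | a | a | a
  · rfl
  · rfl
  · simp [payoffMap]
  · rfl

lemma implMap_payoff {N : ℕ} (e : Qubit q t w b n L ow ≃ Fin N) :
    ImplMap (relabel e) 1 (fun (_ : InitialOracle q) tb => payoffMap tb) := by
  refine (impl_payoff e oracleReg).congr fun V tb φ => ?_
  funext x
  congr 1
  funext a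
  have h1 : ∀ z : (Fin q ⊕ Fin t) ⊕ Fin w → Bool, ∀ i,
      Function.extend (oracleReg : _ ↪ Qubit q t w b n L ow) z x (oracleReg i) = z i := fun z i =>
    (oracleReg : _ ↪ Qubit q t w b n L ow).injective.extend_apply _ _ _
  have hne : ∀ z : (Fin q ⊕ Fin t) ⊕ Fin w → Bool, ∀ a : Qubit q t w b n L ow,
      (∀ i, (oracleReg : _ ↪ Qubit q t w b n L ow) i ≠ a) →
      Function.extend (oracleReg : _ ↪ Qubit q t w b n L ow) z x a = x a := fun z a ha =>
    Function.extend_apply' _ _ _ (by simpa using ha)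
  rcases a with (a | a | a) | a | a | a
  · refine hne _ _ ?_
    rintro ((i | i) | i) <;> simp [oracleReg_apply]
  · exact h1 _ (Sum.inl (Sum.inl a))
  · refine hne _ _ ?_
    rintro ((i | i) | i) <;> simp [oracleReg_apply]
  · exact h1 _ (Sum.inl (Sum.inr a))
  · exact h1 _ (Sum.inr a)
  · refine hne _ _ ?_
    rintro ((i | i) | i) <;> simp [oracleReg_apply]

/-- The step of the chain that computes the flag. -/
def flagChainStep (j : ℕ) (r : Bool) (x : Qubit q t w b n L ow → Bool) : Bool :=
  flagStep (fun i => x (qValue i)) (fun c => x (qCoin c)) j r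

/-- The qubits used in a step of the computation of the flag. -/
def flagSupport (j : ℕ) : Finset (Qubit q t w b n L ow) :=
  if h : j < w then {qCoin (cSelect ⟨j, h⟩), qValue ⟨j, h⟩}
  else if h' : j - w < b * b then
    {qCoin (cDigit (finProdFinEquiv.symm ⟨j - w, h'⟩).1),
      qCoin (cDigit (finProdFinEquiv.symm ⟨j - w, h'⟩).2),
      qCoin (cPair (finProdFinEquiv.symm ⟨j - w, h'⟩))}
  else ∅

lemma flagChainStep_dependsOn (j : ℕ) (r : Bool) :
    DependsOn (flagChainStep (q := q) (t := t) (w := w) (b := b) (n := n) (L := L) (ow := ow) j r)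
      ((flagSupport j : Finset (Qubit q t w b n L ow)) : Set (Qubit q t w b n L ow)) := by
  intro x y hxy
  unfold flagSupport at hxy
  unfold flagChainStep flagStep
  by_cases h : j < w
  · simp only [h, dif_pos] at hxy ⊢
    rw [hxy (qCoin (cSelect ⟨j, h⟩)) (by simp), hxy (qValue ⟨j, h⟩) (by simp)]
  · by_cases h' : j - w < b * b
    · simp only [h, h', dif_pos, dif_neg, not_false_eq_true] at hxy ⊢
      rw [hxy (qCoin (cDigit (finProdFinEquiv.symm ⟨j - w, h'⟩).1)) (by simp),
        hxy (qCoin (cDigit (finProdFinEquiv.symm ⟨j - w, h'⟩).2)) (by simp),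
        hxy (qCoin (cPair (finProdFinEquiv.symm ⟨j - w, h'⟩))) (by simp)]
    · simp only [h, h', dif_neg, not_false_eq_true]

lemma qChain_notMem_flagSupport (j k : ℕ) :
    (qChain k : Qubit q t w b n L ow) ∉ (flagSupport j : Finset (Qubit q t w b n L ow)) := by
  unfold flagSupport qChain
  split_ifs <;> simp

lemma card_flagSupport_le (j : ℕ) :
    (flagSupport j : Finset (Qubit q t w b n L ow)).card ≤ 3 := by
  unfold flagSupport
  split_ifs
  · exact Finset.card_le_two.trans (by norm_num)
  · exact Finset.card_le_three
  · simp

lemma chainFold_congr {X Y : Type} {h : ℕ → Bool → X → Bool} {h' : ℕ → Bool → Y → Bool} {x : X}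
    {y : Y} (hh : ∀ j r, h j r x = h' j r y) : ∀ k, chainFold h x k = chainFold h' y k
  | 0 => rfl
  | k + 1 => by rw [chainFold, chainFold, chainFold_congr hh k, hh]

/-- Three nested conjugations: write the number of up steps, call the payoff oracle, run the flag
chain, apply a controlled sign, and undo everything in reverse order. One use of the flag thus makes
two payoff calls. -/
lemma impl_flag {N : ℕ} (e : Qubit q t w b n L ow ≃ Fin N) (H : ℕ) (hL : w + b * b ≤ L)
    (k : Fin n) :
    Impl (encode e) (1 + (w + b * b) * (2 * xorCost 4) + 2 + 2 * (t * xorCost 2))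
      (fun (_ : InitialOracle q) (tb : Table q t w) Φ y c =>
        (if y k && flag H tb c then -1 else 1) * Φ y c) := by
  have : Nonempty (Qubit q t w b n L ow) := ⟨qCoin cSign⟩
  have hcz := implPhase_cz (q := q) (t := t) (w := w) e
    (a := qCtrl k) (b := qChain (w + b * b)) (by simp [qChain])
  have h1 := implPhase_chainRun e (qChain_injOn hL) (h := flagChainStep) flagSupport
    (fun j _ r => flagChainStep_dependsOn j r) (fun j _ => qChain_notMem_flagSupport j (j + 1))
    (fun j _ => card_flagSupport_le j) _ _ hcz
  have h2 := ImplPhase.conj h1 (implMap_payoff e) fun V tb x => payoffMap_payoffMap tb x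
  have h3 := ImplPhase.conj h2 (implMap_steps e H) fun V tb x => xorOn_xorOn (fun c _ =>
    (stepValue_dependsOn H c).mono fun a ha => by
      simpa using Finset.disjoint_left.1 (stepSupport_disjoint c) ha) x
  refine (ImplPhase.encode e h3 (D' := fun V tb y c => if y k && flag H tb c then -1 else 1) ?_)
  intro V tb y c
  set x₀ : Qubit q t w b n L ow → Bool := Sum.elim (Sum.elim y c) fun _ => false with hx₀
  set x₁ := xorOn stepTargets (stepValue H) x₀ with hx₁
  set x₂ := payoffMap tb x₁ with hx₂
  have e1 : ∀ a, (∀ j, a ≠ qSteps j) → x₁ a = x₀ a := by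
    intro a ha
    rw [hx₁, xorOn, if_neg]
    simp only [stepTargets, Finset.mem_image, Finset.mem_univ, true_and, not_exists]
    exact fun j hj => ha j hj.symm
  have e1' : ∀ j, x₁ (qSteps j) = stepBits H t c j := by
    intro j
    rw [hx₁, xorOn, if_pos (by simp [stepTargets])]
    simp [hx₀, stepValue, stepBits]
  have e2 : ∀ i, x₂ (qValue i) = valueBits H tb c i := by
    intro i
    have h4 : (fun i => x₁ (qCoin (Sum.inl i))) = c ∘ Sum.inl := by
      funext i
      rw [e1 _ (by simp)]
      rfl
    simp only [hx₂, payoffMap, valueBits, h4, e1']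
    rw [e1 _ (by simp)]
    simp [hx₀]
  have e3 : ∀ d, x₂ (qCoin d) = c d := by
    intro d
    change x₁ (qCoin d) = _
    rw [e1 _ (by simp)]
    rfl
  have e4 : x₂ (qCtrl k) = y k := by
    change x₁ (qCtrl k) = _
    rw [e1 _ (by simp)]
    rfl
  have e5 : ∀ j, x₂ (qChain j) = false := by
    intro j
    change x₁ (qChain j) = _
    rw [e1 _ (by simp [qChain])]
    rfl
  obtain ⟨s1, s2⟩ := chainRun_spec (h := flagChainStep) (qChain_injOn hL) (fun j r x y hxy =>
    flagChainStep_dependsOn j r fun i hi => hxy i (by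
      rintro ⟨m, _, rfl⟩
      exact qChain_notMem_flagSupport j m hi)) x₂ (fun j _ => e5 j) (w + b * b) le_rfl
  rw [s2, s1 (qCtrl k) (by simp [qChain]), e4, flag]
  rw [chainFold_congr (y := c) (h' := fun j r c => flagStep (valueBits H tb c) c j r)]
  intro j r
  simp only [flagChainStep, e2, e3]

/-! ### The reflection about the zero state of the coins -/

/-- The step of the chain that detects a coin that is not zero. -/
def orStep (j : ℕ) (r : Bool) (x : Qubit q t w b n L ow → Bool) : Bool :=
  if h : j < Fintype.card (Fin q ⊕ Coins b w) then
    r || x (qCoin ((Fintype.equivFin _).symm ⟨j, h⟩)) else r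

/-- The qubits used in a step of the detection. -/
def orSupport (j : ℕ) : Finset (Qubit q t w b n L ow) :=
  if h : j < Fintype.card (Fin q ⊕ Coins b w) then
    {qCoin ((Fintype.equivFin _).symm ⟨j, h⟩)} else ∅

lemma orStep_dependsOn (j : ℕ) (r : Bool) :
    DependsOn (orStep (q := q) (t := t) (w := w) (b := b) (n := n) (L := L) (ow := ow) j r)
      ((orSupport j : Finset (Qubit q t w b n L ow)) : Set (Qubit q t w b n L ow)) := by
  intro x y hxy
  unfold orSupport at hxy
  unfold orStep
  split_ifs with h
  · rw [hxy (qCoin ((Fintype.equivFin _).symm ⟨j, h⟩)) (by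
      rw [Finset.mem_coe, dif_pos h]
      exact Finset.mem_singleton_self _)]
  · rfl

lemma qChain_notMem_orSupport (j k : ℕ) :
    (qChain k : Qubit q t w b n L ow) ∉ (orSupport j : Finset (Qubit q t w b n L ow)) := by
  unfold orSupport qChain
  split_ifs <;> simp

lemma card_orSupport_le (j : ℕ) : (orSupport j : Finset (Qubit q t w b n L ow)).card ≤ 1 := by
  unfold orSupport
  split_ifs <;> simp

lemma chainFold_orStep (x : Qubit q t w b n L ow → Bool) (k : ℕ) :
    chainFold orStep x k = true ↔ ∃ j, ∃ h : j < Fintype.card (Fin q ⊕ Coins b w), j < k ∧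
      x (qCoin ((Fintype.equivFin _).symm ⟨j, h⟩)) = true := by
  induction k with
  | zero => simp [chainFold]
  | succ k ih =>
    rw [chainFold, orStep]
    by_cases h : k < Fintype.card (Fin q ⊕ Coins b w)
    · rw [dif_pos h, Bool.or_eq_true, ih]
      constructor
      · rintro (⟨j, hj, hjk, hx⟩ | hx)
        · exact ⟨j, hj, by omega, hx⟩
        · exact ⟨k, h, by omega, hx⟩
      · rintro ⟨j, hj, hjk, hx⟩
        rcases Nat.lt_succ_iff_lt_or_eq.1 hjk with hlt | rfl
        · exact Or.inl ⟨j, hj, hlt, hx⟩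
        · exact Or.inr hx
    · rw [dif_neg h, ih]
      refine exists_congr fun j => exists_congr fun hj => and_congr_left fun _ => ?_
      omega

/-- A chain of disjunctions detects a nonzero coin or label qubit; the sign is applied when it ends
in false and the control is on. -/
lemma impl_reflect {N : ℕ} (e : Qubit q t w b n L ow ≃ Fin N)
    (hL : Fintype.card (Fin q ⊕ Coins b w) ≤ L) (k : Fin n) :
    Impl (encode e) (diagCost 2 + Fintype.card (Fin q ⊕ Coins b w) * (2 * xorCost 2))
      (fun (_ : InitialOracle q) (_ : Table q t w) Φ y c =>
        (if y k = true ∧ ∀ a, c a = false then -1 else 1) * Φ y c) := by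
  have : Nonempty (Qubit q t w b n L ow) := ⟨qCoin cSign⟩
  set K := Fintype.card (Fin q ⊕ Coins b w) with hK
  have h0 := implPhase_dependsOn (q := q) (t := t) (w := w) e {qCtrl k, qChain K}
    (D := fun x => if x (qCtrl k) = true ∧ x (qChain K) = false then -1 else 1)
    (fun x y hxy => by
      have h1 : x (qCtrl k) = y (qCtrl k) := hxy _ (by simp)
      have h2 : x (qChain K) = y (qChain K) := hxy _ (by simp)
      simp only [h1, h2]) (fun x => by split_ifs <;> simp)
  have h1 := implPhase_chainRun e (qChain_injOn hL) (h := orStep) orSupport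
    (fun j _ r => orStep_dependsOn j r) (fun j _ => qChain_notMem_orSupport j (j + 1))
    (fun j _ => card_orSupport_le j) _ _ (Impl.mono h0 (diagCost_mono Finset.card_le_two))
  refine (ImplPhase.encode e h1
    (D' := fun V tb y c => if y k = true ∧ ∀ a, c a = false then -1 else 1) ?_)
  intro V tb y c
  set x₀ : Qubit q t w b n L ow → Bool := Sum.elim (Sum.elim y c) fun _ => false with hx₀
  obtain ⟨s1, s2⟩ := chainRun_spec (h := orStep) (qChain_injOn hL) (fun j r x y hxy =>
    orStep_dependsOn j r fun i hi => hxy i (by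
      rintro ⟨m, _, rfl⟩
      exact qChain_notMem_orSupport j m hi)) x₀ (fun j _ => rfl) K le_rfl
  rw [s2, s1 (qCtrl k) (by simp [qChain])]
  have : chainFold orStep x₀ K = false ↔ ∀ a, c a = false := by
    rw [← Bool.not_eq_true, chainFold_orStep]
    push Not
    constructor
    · intro h a
      have := h (Fintype.equivFin _ a) (Fin.is_lt _) (Fin.is_lt _)
      simpa [hx₀] using this
    · intro h j hj _
      simpa [hx₀] using h _
  simp only [this]
  rfl

end Oracle

end

end OptionPricing

namespace OptionPricing

noncomputable section

/-! ### Expectations over independent coins -/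

/-- The probability that a coin with probability `p` of `true` shows `v`. -/
def coinProb (p : ℝ) (v : Bool) : ℝ := if v then p else 1 - p

/-- The expectation of `F` over independent coins. -/
def coinMean {κ : Type} [Fintype κ] [DecidableEq κ] (prob : κ → ℝ) (F : (κ → Bool) → ℝ) : ℝ :=
  ∑ x, (∏ k, coinProb (prob k) (x k)) * F x

section CoinMean

variable {κ κ' : Type} [Fintype κ] [DecidableEq κ] [Fintype κ'] [DecidableEq κ']

lemma coinMean_sum (prob : κ ⊕ κ' → ℝ) (F : (κ ⊕ κ' → Bool) → ℝ) :
    coinMean prob F = coinMean (prob ∘ Sum.inl) fun x => coinMean (prob ∘ Sum.inr) fun y =>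
      F (Sum.elim x y) := by
  simp only [coinMean, Finset.mul_sum]
  rw [← (Equiv.sumArrowEquivProdArrow _ _ _).symm.sum_comp, Fintype.sum_prod_type]
  refine Finset.sum_congr rfl fun x _ => Finset.sum_congr rfl fun y _ => ?_
  rw [Fintype.prod_sum_type]
  simp only [Equiv.sumArrowEquivProdArrow, Equiv.coe_fn_symm_mk, Sum.elim_inl, Sum.elim_inr,
    Function.comp_apply]
  ring_nf

lemma coinMean_prod (prob : κ → ℝ) (g : κ → Bool → ℝ) :
    coinMean prob (fun x => ∏ k, g k (x k)) =
      ∏ k, (prob k * g k true + (1 - prob k) * g k false) := by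
  have h : ∀ k, prob k * g k true + (1 - prob k) * g k false =
      ∑ v : Bool, coinProb (prob k) v * g k v := fun k => by
    rw [Fintype.sum_bool]
    rfl
  simp only [h, coinMean, Finset.prod_univ_sum, Fintype.piFinset_univ, Finset.prod_mul_distrib]

lemma coinMean_const (prob : κ → ℝ) (c : ℝ) : coinMean prob (fun _ => c) = c := by
  have h := coinMean_prod prob fun _ _ => 1
  simp only [Finset.prod_const_one, coinMean, mul_one, add_sub_cancel] at h
  rw [coinMean, ← Finset.sum_mul, h, one_mul]

lemma coinMean_mul_left (prob : κ → ℝ) (c : ℝ) (F : (κ → Bool) → ℝ) :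
    coinMean prob (fun x => c * F x) = c * coinMean prob F := by
  simp only [coinMean, Finset.mul_sum]
  exact Finset.sum_congr rfl fun x _ => by ring

lemma coinMean_mul_right (prob : κ → ℝ) (c : ℝ) (F : (κ → Bool) → ℝ) :
    coinMean prob (fun x => F x * c) = coinMean prob F * c := by
  simp only [coinMean, Finset.sum_mul]
  exact Finset.sum_congr rfl fun x _ => by ring

lemma coinMean_half (F : (κ → Bool) → ℝ) :
    coinMean (fun _ => 1 / 2) F = (1 / 2) ^ Fintype.card κ * ∑ x, F x := by
  have h : ∀ v, coinProb (1 / 2) v = 1 / 2 := fun v => by cases v <;> norm_num [coinProb]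
  simp only [coinMean, h, Finset.prod_const, Finset.card_univ, Finset.mul_sum]

end CoinMean

/-- The result of scanning the digits `v`, keeping the last one selected by `x`. -/
lemma sum_chainFold_select (v : ℕ → Bool) : ∀ w : ℕ,
    ∑ x : Fin w → Bool, (if chainFold (fun j r (x : ℕ → Bool) => if x j then v j else r) (pad x) w
      then (1 : ℝ) else 0) = ∑ j ∈ Finset.range w, if v j then 2 ^ j else 0
  | 0 => by simp [chainFold]
  | w + 1 => by
    have hc : ∀ (x : Fin w → Bool) (u : Bool) (k : ℕ), k ≤ w →
        chainFold (fun j r (x : ℕ → Bool) => if x j then v j else r)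
          (pad (Fin.snoc (α := fun _ => Bool) x u)) k =
        chainFold (fun j r (x : ℕ → Bool) => if x j then v j else r) (pad x) k := by
      intro x u k
      induction k with
      | zero => intro _; rfl
      | succ k ih =>
        intro hk
        rw [chainFold, chainFold, ih (by omega), pad_snoc_of_lt x u (by omega)]
    -- If the coin of the top digit shows true, the result is that digit for all 2^w settings of the
    -- other coins; otherwise the shorter scan decides.
    rw [sum_snoc, Finset.sum_range_succ, ← sum_chainFold_select v w, Finset.sum_add_distrib,
      add_comm]
    congr 1
    · refine Finset.sum_congr rfl fun x _ => ?_
      rw [chainFold, hc x false w le_rfl, pad_snoc_self]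
      simp
    · simp only [chainFold, pad_snoc_self, if_true]
      split_ifs <;> simp

lemma sum_natOfBits {α : Type*} [AddCommMonoid α] (b : ℕ) (g : ℕ → α) :
    ∑ z : Fin b → Bool, g (natOfBits z) = ∑ m ∈ Finset.range (2 ^ b), g m := by
  refine Finset.sum_bij' (fun z _ => natOfBits z) (fun m _ (j : Fin b) => m.testBit j)
    (fun z _ => Finset.mem_range.2 (natOfBits_lt z)) (fun _ _ => Finset.mem_univ _)
    (fun z _ => ?_) (fun m hm => natOfBits_testBit (Finset.mem_range.1 hm)) fun _ _ => rfl
  funext j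
  rw [testBit_natOfBits]
  simp [pad]

lemma natOfBits_eq_sum_range {w : ℕ} (v : Fin w → Bool) :
    (natOfBits v : ℝ) = ∑ j ∈ Finset.range w, if pad v j then (2 : ℝ) ^ j else 0 := by
  rw [← Fin.sum_univ_eq_sum_range (fun j => if pad v j then (2 : ℝ) ^ j else 0) w, natOfBits]
  push_cast
  exact Finset.sum_congr rfl fun j _ => by rw [pad_apply]

/-! ### Two's complement -/

/-- Flipping the sign digit of a two's complement number adds 2^w. The result is nonnegative, so
that it can serve as a probability. -/
lemma natOfBits_offset {w : ℕ} {x : ℤ} (h1 : -2 ^ w ≤ x) (h2 : x < 2 ^ w) :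
    (natOfBits fun j : Fin (w + 1) => xor (x.testBit j) (decide ((j : ℕ) + 1 = w + 1)) : ℤ) =
      x + 2 ^ w := by
  rcases x with m | m
  · have hm : m < 2 ^ w := by
      simp only [Int.ofNat_eq_natCast] at h2
      exact_mod_cast h2
    have : (fun j : Fin (w + 1) => xor ((Int.ofNat m).testBit j) (decide ((j : ℕ) + 1 = w + 1))) =
        fun j : Fin (w + 1) => (2 ^ w + m).testBit j := by
      funext j
      change xor (m.testBit j) _ = _
      rcases Nat.lt_succ_iff_lt_or_eq.1 j.2 with h | h
      · rw [Nat.testBit_two_pow_add_gt h]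
        simp [h.ne]
      · rw [h, Nat.testBit_two_pow_add_eq]
        simp
    rw [this, natOfBits_testBit (by rw [pow_succ]; omega)]
    push_cast
    simp only [Int.ofNat_eq_natCast]
    ring
  · have hm : m < 2 ^ w := by
      rw [Int.negSucc_eq] at h1
      have : (m : ℤ) < 2 ^ w := by linarith
      exact_mod_cast this
    have : (fun j : Fin (w + 1) => xor ((Int.negSucc m).testBit j) (decide ((j : ℕ) + 1 = w + 1))) =
        fun j : Fin (w + 1) => (2 ^ w - (m + 1)).testBit j := by
      -- A negative number -(m + 1) is shifted to 2^w - (m + 1), whose lower digits are the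
      -- complements of those of m.
      funext j
      rw [Nat.testBit_two_pow_sub_succ hm]
      change xor (!m.testBit j) _ = _
      rcases Nat.lt_succ_iff_lt_or_eq.1 j.2 with h | h
      · simp [h, h.ne]
      · rw [h, Nat.testBit_lt_two_pow hm]
        simp
    rw [this, natOfBits_testBit (by rw [pow_succ]; omega), Int.negSucc_eq,
      Nat.cast_sub (by omega)]
    push_cast
    ring

lemma intOfBits_eq {w : ℕ} (v : Fin (w + 1) → Bool) :
    intOfBits v = (natOfBits fun j : Fin (w + 1) => xor (v j) (decide ((j : ℕ) + 1 = w + 1)) : ℤ) -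
      2 ^ w := by
  rw [intOfBits, natOfBits, Fin.sum_univ_castSucc, Fin.sum_univ_castSucc]
  push_cast
  have h2 : ∀ j : Fin w, (j : ℕ) ≠ w := fun j => j.2.ne
  simp only [Fin.val_castSucc, if_true, decide_true, Bool.xor_true, h2, if_false, decide_false,
    Bool.xor_false]
  cases v (Fin.last w) <;> simp [sub_eq_add_neg]

lemma intOfBits_testBit {w : ℕ} {x : ℤ} (h1 : -2 ^ w ≤ x) (h2 : x < 2 ^ w) :
    intOfBits (fun j : Fin (w + 1) => x.testBit j) = x := by
  rw [intOfBits_eq, natOfBits_offset h1 h2]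
  ring

/-! ### The probability of the flag -/

section Flag

variable {q t w b : ℕ}

/-- The bias of the coins. -/
def coinBias (lam : ℝ) : Coins b w → ℝ :=
  Sum.elim (fun _ => 1 / 2) (Sum.elim (fun _ => 1 / 2) (Sum.elim
    (fun p => Real.exp (-(lam * (2 ^ ((p.1 : ℕ) + p.2) + if p.1 = p.2 then 2 ^ (p.1 : ℕ) else 0))))
    fun _ => 1 / 2))

lemma coinBias_mem {lam : ℝ} (hlam : 0 ≤ lam) (k : Coins b w) :
    0 ≤ coinBias lam k ∧ coinBias lam k ≤ 1 := by
  rcases k with k | k | k | k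
  · norm_num [coinBias]
  · norm_num [coinBias]
  · refine ⟨Real.exp_nonneg _, Real.exp_le_one_iff.2 ?_⟩
    simp only [neg_nonpos]
    refine mul_nonneg hlam (add_nonneg (by positivity) ?_)
    split_ifs <;> positivity
  · norm_num [coinBias]

lemma norm_coinAmp_sq {p : ℝ} (h0 : 0 ≤ p) (h1 : p ≤ 1) (v : Bool) :
    ‖coinAmp p v‖ ^ 2 = coinProb p v := by
  cases v
  · simp [coinAmp, coinProb, Real.sq_sqrt (sub_nonneg.2 h1)]
  · simp [coinAmp, coinProb, Real.sq_sqrt h0]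

lemma sum_initialProb (V : InitialOracle q) : ∑ i, initialProb V i = 1 := by
  have h := Matrix.mem_unitaryGroup_iff'.1 V.2
  have h1 := congrFun (congrFun h fun _ => false) fun _ => false
  rw [Matrix.mul_apply, Matrix.one_apply_eq] at h1
  have h2 : ∑ i, ((initialProb V i : ℝ) : ℂ) = 1 := by
    rw [← h1]
    refine Finset.sum_congr rfl fun i _ => ?_
    rw [initialProb, Matrix.star_apply, Complex.star_def, mul_comm, Complex.mul_conj,
      Complex.normSq_eq_norm_sq]
  exact_mod_cast h2

lemma initialProb_nonneg (V : InitialOracle q) (i : Fin q → Bool) : 0 ≤ initialProb V i :=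
  sq_nonneg _

/-- Born's rule: the prepared state is a product, so the squared amplitudes describe the random
label together with independent coins. -/
lemma sum_prepared {Co : Type} [Fintype Co] [DecidableEq Co] {prob : Co → ℝ}
    (hp : ∀ k, 0 ≤ prob k ∧ prob k ≤ 1) (V : InitialOracle q) (F : (Fin q ⊕ Co → Bool) → ℝ) :
    ∑ c, ‖prepare prob V (zeroState _) c‖ ^ 2 * F c =
      ∑ i, initialProb V i * coinMean prob fun x => F (Sum.elim i x) := by
  rw [← (Equiv.sumArrowEquivProdArrow _ _ _).symm.sum_comp, Fintype.sum_prod_type]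
  refine Finset.sum_congr rfl fun i _ => ?_
  rw [coinMean, Finset.mul_sum]
  refine Finset.sum_congr rfl fun x _ => ?_
  rw [prepare_zeroState, norm_mul, mul_pow, norm_prod, ← Finset.prod_pow, ← mul_assoc]
  congr 2
  exact Finset.prod_congr rfl fun k _ => norm_coinAmp_sq (hp k).1 (hp k).2 _

lemma sum_norm_prepared {Co : Type} [Fintype Co] [DecidableEq Co] {prob : Co → ℝ}
    (hp : ∀ k, 0 ≤ prob k ∧ prob k ≤ 1) (V : InitialOracle q) :
    ∑ c, ‖prepare prob V (zeroState (Fin q ⊕ Co)) c‖ ^ 2 = 1 := by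
  have := sum_prepared hp V fun _ => 1
  simpa [coinMean_const, sum_initialProb] using this

/-- The first w steps produce the selected payoff digit. The remaining steps are a rejection test,
which fails exactly when two set digits meet a pair coin showing false. -/
lemma chainFold_flagStep (v : Fin w → Bool) (c : Fin q ⊕ Coins b w → Bool) :
    chainFold (fun j r c => flagStep v c j r) c (w + b * b) = true ↔
      chainFold (fun j r (x : ℕ → Bool) => if x j then
        pad (fun j : Fin w => xor (v j) (decide ((j : ℕ) + 1 = w))) j else r)
        (pad fun j => c (cSelect j)) w = true ∧
      ∀ p : Fin b × Fin b, (c (cDigit p.1) && c (cDigit p.2) && !c (cPair p)) = false := by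
  have h1 : ∀ k ≤ w, chainFold (fun j r c => flagStep v c j r) c k =
      chainFold (fun j r (x : ℕ → Bool) => if x j then
        pad (fun j : Fin w => xor (v j) (decide ((j : ℕ) + 1 = w))) j else r)
        (pad fun j => c (cSelect j)) k := by
    intro k
    induction k with
    | zero => intro _; rfl
    | succ k ih =>
      intro hk
      have hk' : k < w := hk
      rw [chainFold, chainFold, ih (by omega), flagStep, dif_pos hk']
      simp only [pad, hk', dif_pos]
  have h2 : ∀ k ≤ b * b, chainFold (fun j r c => flagStep v c j r) c (w + k) = true ↔
      chainFold (fun j r c => flagStep v c j r) c w = true ∧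
      ∀ j (hj : j < b * b), j < k → (c (cDigit (finProdFinEquiv.symm ⟨j, hj⟩).1) &&
        c (cDigit (finProdFinEquiv.symm ⟨j, hj⟩).2) &&
        !c (cPair (finProdFinEquiv.symm ⟨j, hj⟩))) = false := by
    intro k
    induction k with
    | zero => intro _; simp
    | succ k ih =>
      intro hk
      have hk' : k < b * b := hk
      rw [← add_assoc, chainFold, flagStep, dif_neg (by omega)]
      simp only [Nat.add_sub_cancel_left, hk', dif_pos]
      rw [Bool.and_eq_true, ih (by omega), and_assoc, Bool.not_eq_true']
      refine and_congr_right fun _ => ⟨fun ⟨h3, h4⟩ j hj hjk => ?_, fun h3 =>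
        ⟨fun j hj hjk => h3 j hj (by omega), h3 k hk' (by omega)⟩⟩
      rcases Nat.lt_succ_iff_lt_or_eq.1 hjk with h | rfl
      · exact h3 j hj h
      · exact h4
  rw [h2 _ le_rfl, h1 w le_rfl]
  refine and_congr_right fun _ => ⟨fun h p => ?_, fun h j hj _ => h _⟩
  have := h (finProdFinEquiv p) (Fin.is_lt _) (Fin.is_lt _)
  simpa only [Fin.eta, Equiv.symm_apply_apply] using this

/-- The weight exp(-λ(m² + m)) factors over pairs of digits because m² = Σ z_i z_j 2^(i+j), while
the linear term is attached to the diagonal pairs. Each factor is at most one and can be the bias of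
a coin. -/
lemma pair_weight (lam : ℝ) (z : Fin b → Bool) :
    ∏ p : Fin b × Fin b, (if z p.1 && z p.2 then
      Real.exp (-(lam * (2 ^ ((p.1 : ℕ) + p.2) + if p.1 = p.2 then 2 ^ (p.1 : ℕ) else 0))) else 1) =
    Real.exp (-(lam * ((natOfBits z : ℝ) ^ 2 + natOfBits z))) := by
  have h1 : ∀ p : Fin b × Fin b, (if z p.1 && z p.2 then
      Real.exp (-(lam * (2 ^ ((p.1 : ℕ) + p.2) + if p.1 = p.2 then 2 ^ (p.1 : ℕ) else 0))) else 1) =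
      Real.exp (-(lam * ((if z p.1 then 2 ^ (p.1 : ℕ) else 0) * (if z p.2 then 2 ^ (p.2 : ℕ) else 0) +
        if p.1 = p.2 then (if z p.1 then 2 ^ (p.1 : ℕ) else 0) else 0))) := by
    rintro ⟨i, j⟩
    by_cases hij : i = j
    · subst hij
      cases z i <;> simp [pow_add]
    · cases z i <;> cases z j <;> simp [pow_add, hij]
  rw [Finset.prod_congr rfl fun p _ => h1 p, ← Real.exp_sum]
  congr 1
  rw [Finset.sum_neg_distrib, ← Finset.mul_sum, Finset.sum_add_distrib, Fintype.sum_prod_type,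
    Fintype.sum_prod_type, natOfBits]
  push_cast
  congr 3
  · rw [sq, Finset.sum_mul_sum]
  · exact Finset.sum_congr rfl fun i _ => by simp

/-- The probability of the flag: the expectation of the payoff under discrete Gaussian weights. -/
lemma predProb_flag {lam : ℝ} (hlam : 0 ≤ lam) {H : ℕ} (hb : b ≤ H)
    (V : InitialOracle q) (tb : Table q t w) :
    predProb (prepare (coinBias (b := b) (w := w) lam) V (zeroState _)) (flag H tb) =
      ∑ i, initialProb V i * (1 / 2 * ∑ s : Bool, (1 / 2) ^ b * ∑ m ∈ Finset.range (2 ^ b),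
        Real.exp (-(lam * ((m : ℝ) ^ 2 + m))) * ((1 / 2) ^ w *
          natOfBits fun j : Fin w => xor (tb i (fun l => (centred H s m).testBit l) j)
            (decide ((j : ℕ) + 1 = w)))) := by
  have hp := coinBias_mem (b := b) (w := w) hlam
  have h0 : predProb (prepare (coinBias (b := b) (w := w) lam) V (zeroState _)) (flag H tb) =
      ∑ c, ‖prepare (coinBias (b := b) (w := w) lam) V (zeroState _) c‖ ^ 2 *
        (if flag H tb c then 1 else 0) :=
    Finset.sum_congr rfl fun c _ => by split_ifs <;> simp
  rw [h0, sum_prepared hp]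
  refine Finset.sum_congr rfl fun i _ => ?_
  congr 1
  -- The indicator of the flag splits into a factor for the pair coins and one for the selection
  -- coins; given sign and digits these coins are independent, and the means multiply.
  have hflag : ∀ (sg : Unit → Bool) (z : Fin b → Bool) (d : Fin b × Fin b → Bool) (se : Fin w → Bool),
      (if flag H tb (Sum.elim i (Sum.elim sg (Sum.elim z (Sum.elim d se)))) then (1 : ℝ) else 0) =
      (∏ p, if z p.1 && z p.2 && !d p then 0 else 1) *
      if chainFold (fun j r (x : ℕ → Bool) => if x j then
        pad (fun j : Fin w => xor (tb i (fun l => centredBit H (sg ()) (pad z l) l) j)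
          (decide ((j : ℕ) + 1 = w))) j else r) (pad se) w then 1 else 0 := by
    intro sg z d se
    have h := chainFold_flagStep (valueBits H tb
      (Sum.elim i (Sum.elim sg (Sum.elim z (Sum.elim d se)))))
      (Sum.elim i (Sum.elim sg (Sum.elim z (Sum.elim d se))))
    have hv : ∀ j, valueBits H tb (Sum.elim i (Sum.elim sg (Sum.elim z (Sum.elim d se)))) j =
      tb i (fun l => centredBit H (sg ()) (pad z l) l) j := fun j => rfl
    simp only [hv, Sum.elim_inr, Sum.elim_inl] at h
    have hprod : (∏ p : Fin b × Fin b, if z p.1 && z p.2 && !d p then (0 : ℝ) else 1) =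
        if ∀ p : Fin b × Fin b, (z p.1 && z p.2 && !d p) = false then 1 else 0 := by
      split_ifs with hall
      · exact Finset.prod_eq_one fun p _ => by simp [hall p]
      · push Not at hall
        obtain ⟨p, hpp⟩ := hall
        refine Finset.prod_eq_zero (Finset.mem_univ p) (if_pos ?_)
        exact Bool.eq_true_of_not_eq_false hpp
    rw [hprod, ite_zero_mul_ite_zero, one_mul]
    refine if_congr ?_ rfl rfl
    rw [and_comm]
    refine Iff.trans (Eq.to_iff ?_) h
    congr 1
    exact chainFold_congr
      (h := fun j r c => flagStep (valueBits H tb c) c j r)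
      (h' := fun j r c => flagStep (valueBits H tb
        (Sum.elim i (Sum.elim sg (Sum.elim z (Sum.elim d se))))) c j r) (fun _ _ => rfl) _
  have hdig : ∀ (s : Bool) (z : Fin b → Bool),
      (fun l : Fin t => centredBit H s (pad z l) l) =
        fun l : Fin t => (centred H s (natOfBits z)).testBit l := by
    intro s z
    funext l
    rw [testBit_centred ((natOfBits_lt z).trans_le (Nat.pow_le_pow_right (by norm_num) hb)),
      testBit_natOfBits]
  rw [coinMean_sum]
  simp only [coinMean_sum, hflag, coinMean_mul_left]
  have hsel : ∀ (sg : Unit → Bool) (z : Fin b → Bool),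
      coinMean ((((coinBias (b := b) (w := w) lam ∘ Sum.inr) ∘ Sum.inr) ∘ Sum.inr)) (fun se =>
        if chainFold (fun j r (x : ℕ → Bool) => if x j then
        pad (fun j : Fin w => xor (tb i (fun l => centredBit H (sg ()) (pad z l) l) j)
          (decide ((j : ℕ) + 1 = w))) j else r) (pad se) w then (1 : ℝ) else 0) =
      (1 / 2) ^ w * natOfBits fun j : Fin w =>
        xor (tb i (fun l => (centred H (sg ()) (natOfBits z)).testBit l) j)
          (decide ((j : ℕ) + 1 = w)) := by
    intro sg z
    have := coinMean_half (κ := Fin w) (fun se =>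
        if chainFold (fun j r (x : ℕ → Bool) => if x j then
        pad (fun j : Fin w => xor (tb i (fun l => centredBit H (sg ()) (pad z l) l) j)
          (decide ((j : ℕ) + 1 = w))) j else r) (pad se) w then (1 : ℝ) else 0)
    rw [sum_chainFold_select, ← natOfBits_eq_sum_range, Fintype.card_fin, hdig] at this
    simp only [hdig]
    rw [← this]
    rfl
  have hpair : ∀ z : Fin b → Bool,
      coinMean ((((coinBias (b := b) (w := w) lam ∘ Sum.inr) ∘ Sum.inr) ∘ Sum.inl)) (fun d =>
        ∏ p : Fin b × Fin b, if z p.1 && z p.2 && !d p then (0 : ℝ) else 1) =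
      Real.exp (-(lam * ((natOfBits z : ℝ) ^ 2 + natOfBits z))) := by
    intro z
    rw [← pair_weight]
    refine (coinMean_prod _ fun (p : Fin b × Fin b) (v : Bool) =>
      if z p.1 && z p.2 && !v then (0 : ℝ) else 1).trans ?_
    refine Finset.prod_congr rfl fun p _ => ?_
    simp only [Function.comp_apply, coinBias, Sum.elim_inr, Sum.elim_inl]
    cases z p.1 <;> cases z p.2 <;> simp
  simp only [hsel, coinMean_mul_right, hpair]
  have hz : ∀ sg : Unit → Bool, coinMean ((coinBias (b := b) (w := w) lam ∘ Sum.inr) ∘ Sum.inl)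
      (fun z => Real.exp (-(lam * ((natOfBits z : ℝ) ^ 2 + natOfBits z))) *
        ((1 / 2) ^ w * natOfBits fun j : Fin w =>
        xor (tb i (fun l => (centred H (sg ()) (natOfBits z)).testBit l) j)
          (decide ((j : ℕ) + 1 = w)))) =
      (1 / 2) ^ b * ∑ m ∈ Finset.range (2 ^ b), Real.exp (-(lam * ((m : ℝ) ^ 2 + m))) *
        ((1 / 2) ^ w * natOfBits fun j : Fin w =>
        xor (tb i (fun l => (centred H (sg ()) m).testBit l) j) (decide ((j : ℕ) + 1 = w))) := by
    intro sg
    have := coinMean_half (κ := Fin b) (fun z =>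
      Real.exp (-(lam * ((natOfBits z : ℝ) ^ 2 + natOfBits z))) *
        ((1 / 2) ^ w * natOfBits fun j : Fin w =>
        xor (tb i (fun l => (centred H (sg ()) (natOfBits z)).testBit l) j)
          (decide ((j : ℕ) + 1 = w))))
    rw [Fintype.card_fin, sum_natOfBits b fun m => Real.exp (-(lam * ((m : ℝ) ^ 2 + m))) *
        ((1 / 2) ^ w * (natOfBits fun j : Fin w =>
        xor (tb i (fun l => (centred H (sg ()) m).testBit l) j)
          (decide ((j : ℕ) + 1 = w)) : ℝ))] at this
    rw [← this]
    rfl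
  simp only [hz]
  have := coinMean_half (κ := Unit) (fun sg => (1 / 2) ^ b * ∑ m ∈ Finset.range (2 ^ b),
    Real.exp (-(lam * ((m : ℝ) ^ 2 + m))) * ((1 / 2) ^ w * (natOfBits fun j : Fin w =>
        xor (tb i (fun l => (centred H (sg ()) m).testBit l) j) (decide ((j : ℕ) + 1 = w)) : ℝ)))
  rw [Fintype.card_unit, pow_one] at this
  refine Eq.trans rfl (this.trans (congrArg _ ?_))
  exact Fintype.sum_equiv (Equiv.funUnique Unit Bool) _ _ fun sg => rfl

end Flag

end

end OptionPricing

namespace OptionPricing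

noncomputable section

/-! ### The central limit theorem with a rate -/

/-- `f` is bounded by one and has a second-order Taylor expansion at every point, with coefficients
bounded by `B` and a cubic remainder. -/
structure HasTaylorBound (B : ℝ) (f f₁ f₂ : ℝ → ℝ) : Prop where
  continuous : Continuous f
  abs_le_one : ∀ x, |f x| ≤ 1
  abs_first_le : ∀ x, |f₁ x| ≤ B
  abs_second_le : ∀ x, |f₂ x| ≤ B
  remainder_le : ∀ x h, |f (x + h) - f x - f₁ x * h - f₂ x * h ^ 2 / 2| ≤ B * |h| ^ 3

/-- One step of the random walk with steps `h` and `-h`. -/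
def walkStep (p h : ℝ) (f : ℝ → ℝ) (x : ℝ) : ℝ := p * f (x + h) + (1 - p) * f (x - h)

lemma abs_convex_le {p a b C : ℝ} (hp0 : 0 ≤ p) (hp1 : p ≤ 1) (ha : |a| ≤ C) (hb : |b| ≤ C) :
    |p * a + (1 - p) * b| ≤ C := by
  have h1 := abs_le.1 ha
  have h2 := abs_le.1 hb
  have : 0 ≤ 1 - p := by linarith
  exact abs_le.2 ⟨by nlinarith, by nlinarith⟩

/-- All the bounds survive convex combinations of translates with the same constant, so smoothness
does not deteriorate along the exchange argument. -/
lemma HasTaylorBound.walkStep {B p h : ℝ} {f f₁ f₂ : ℝ → ℝ} (hp0 : 0 ≤ p) (hp1 : p ≤ 1)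
    (hf : HasTaylorBound B f f₁ f₂) :
    HasTaylorBound B (walkStep p h f) (walkStep p h f₁) (walkStep p h f₂) where
  continuous := by
    have := hf.continuous
    unfold OptionPricing.walkStep
    fun_prop
  abs_le_one x := abs_convex_le hp0 hp1 (hf.abs_le_one _) (hf.abs_le_one _)
  abs_first_le x := abs_convex_le hp0 hp1 (hf.abs_first_le _) (hf.abs_first_le _)
  abs_second_le x := abs_convex_le hp0 hp1 (hf.abs_second_le _) (hf.abs_second_le _)
  remainder_le x k := by
    have := abs_convex_le hp0 hp1 (hf.remainder_le (x + h) k) (hf.remainder_le (x - h) k)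
    convert this using 2
    simp only [OptionPricing.walkStep, add_right_comm x k h, show x + k - h = x - h + k by ring]
    ring

/-- The expectation over `k` steps of the random walk. -/
lemma walkStep_iterate (p h : ℝ) : ∀ (k : ℕ) (f : ℝ → ℝ) (x : ℝ),
    (walkStep p h)^[k] f x = ∑ y : Fin k → Bool, (∏ j, if y j then p else 1 - p) *
      f (x + ∑ j, if y j then h else -h)
  | 0, f, x => by simp
  | k + 1, f, x => by
    rw [Function.iterate_succ_apply, walkStep_iterate p h k, sum_snoc]
    refine Finset.sum_congr rfl fun y _ => ?_
    simp only [Fin.prod_univ_castSucc, Fin.sum_univ_castSucc, Fin.snoc_castSucc, Fin.snoc_last,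
      walkStep, if_true, Bool.false_eq_true, if_false]
    rw [show x + ((∑ j, if y j then h else -h) + h) = x + (∑ j, if y j then h else -h) + h by ring,
      show x + ((∑ j, if y j then h else -h) + -h) = x + (∑ j, if y j then h else -h) - h by ring]
    ring

/-- A bound for the third absolute moment of a Gaussian variable with variance one. -/
def thirdMoment (κ : ℝ) : ℝ := ∫ x, (|κ| + |x|) ^ 3 ∂gaussianReal 0 1

lemma integrable_thirdMoment (κ : ℝ) :
    Integrable (fun x => (|κ| + |x|) ^ 3) (gaussianReal 0 1) := by
  have h1 : MemLp (fun x : ℝ => ‖id x‖) ((3 : ℕ) : ℝ≥0∞) (gaussianReal 0 1) :=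
    (memLp_id_gaussianReal' _ (ENNReal.natCast_ne_top 3)).norm
  have h2 : MemLp (fun _ : ℝ => |κ|) ((3 : ℕ) : ℝ≥0∞) (gaussianReal 0 1) := memLp_const _
  refine ((h2.add h1).integrable_norm_pow (by norm_num)).congr
    (Filter.Eventually.of_forall fun x => ?_)
  simp only [Pi.add_apply, Real.norm_eq_abs, id]
  rw [abs_of_nonneg (by positivity)]

lemma gaussianReal_eq_map (κ h : ℝ) :
    gaussianReal (κ * h ^ 2) (Real.toNNReal (h ^ 2)) =
      (gaussianReal 0 1).map fun g => h * g + κ * h ^ 2 := by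
  have h1 : Measurable fun g : ℝ => h * g := measurable_const_mul h
  have : (fun g : ℝ => h * g + κ * h ^ 2) = (fun y => y + κ * h ^ 2) ∘ fun g => h * g := rfl
  rw [this, ← Measure.map_map (measurable_add_const _) h1, gaussianReal_map_const_mul,
    gaussianReal_map_add_const]
  congr 1
  · ring
  · ext
    simp [sq_nonneg]

lemma HasTaylorBound.integrable {B : ℝ} {f f₁ f₂ : ℝ → ℝ} (hf : HasTaylorBound B f f₁ f₂)
    (μ : Measure ℝ) [IsFiniteMeasure μ] {φ : ℝ → ℝ} (hφ : Measurable φ) :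
    Integrable (fun z => f (φ z)) μ :=
  Integrable.of_bound (hf.continuous.measurable.comp hφ).aestronglyMeasurable 1
    (Filter.Eventually.of_forall fun _ => hf.abs_le_one _)

lemma integral_gaussianReal_sq : ∫ g, g ^ 2 ∂gaussianReal 0 1 = 1 := by
  have := variance_id_gaussianReal (μ := 0) (v := 1)
  rw [variance_eq_integral measurable_id.aemeasurable] at this
  simpa using this

/-- The smoothing of `f` by a Gaussian of variance `h ^ 2` and mean `κ * h ^ 2`. -/
lemma HasTaylorBound.gaussian_step {B κ h : ℝ} {f f₁ f₂ : ℝ → ℝ} (hf : HasTaylorBound B f f₁ f₂)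
    (hB : 0 ≤ B) (hh0 : 0 ≤ h) (hh1 : h ≤ 1) (x : ℝ) :
    |∫ z, f (x + z) ∂gaussianReal (κ * h ^ 2) (Real.toNNReal (h ^ 2)) -
      (f x + f₁ x * (κ * h ^ 2) + f₂ x * (h ^ 2 + κ ^ 2 * h ^ 4) / 2)| ≤
      B * thirdMoment κ * h ^ 3 := by
  have hm : Measurable fun g : ℝ => h * g + κ * h ^ 2 := by fun_prop
  have hfx : Continuous fun z => f (x + z) := hf.continuous.comp (by fun_prop)
  rw [gaussianReal_eq_map, integral_map hm.aemeasurable hfx.aestronglyMeasurable]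
  have hi1 : Integrable (fun g : ℝ => g) (gaussianReal 0 1) :=
    (memLp_id_gaussianReal 1).integrable (by norm_num)
  have hi2 : Integrable (fun g : ℝ => g ^ 2) (gaussianReal 0 1) := by
    have := (memLp_id_gaussianReal (μ := 0) (v := 1) 2).integrable_sq
    simpa using this
  have hi3 : ∀ a b : ℝ, Integrable (fun g : ℝ => a * g + b * g ^ 2) (gaussianReal 0 1) :=
    fun a b => (hi1.const_mul a).add (hi2.const_mul b)
  have hpoly : ∫ g, (f x + f₁ x * (h * g + κ * h ^ 2) + f₂ x * (h * g + κ * h ^ 2) ^ 2 / 2)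
      ∂gaussianReal 0 1 = f x + f₁ x * (κ * h ^ 2) + f₂ x * (h ^ 2 + κ ^ 2 * h ^ 4) / 2 := by
    have : ∀ g : ℝ, f x + f₁ x * (h * g + κ * h ^ 2) + f₂ x * (h * g + κ * h ^ 2) ^ 2 / 2 =
        (f x + f₁ x * (κ * h ^ 2) + f₂ x * (κ ^ 2 * h ^ 4) / 2) +
        ((f₁ x * h + f₂ x * κ * h ^ 3) * g + (f₂ x * h ^ 2 / 2) * g ^ 2) := fun g => by ring
    simp only [this]
    rw [integral_add (integrable_const _) (hi3 _ _),
      integral_add (hi1.const_mul _) (hi2.const_mul _), integral_const_mul, integral_const_mul,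
      integral_gaussianReal_sq, integral_id_gaussianReal]
    simp
    ring
  have hipoly : Integrable (fun g : ℝ => f x + f₁ x * (h * g + κ * h ^ 2) +
      f₂ x * (h * g + κ * h ^ 2) ^ 2 / 2) (gaussianReal 0 1) := by
    have : ∀ g : ℝ, f x + f₁ x * (h * g + κ * h ^ 2) + f₂ x * (h * g + κ * h ^ 2) ^ 2 / 2 =
        (f x + f₁ x * (κ * h ^ 2) + f₂ x * (κ ^ 2 * h ^ 4) / 2) +
        ((f₁ x * h + f₂ x * κ * h ^ 3) * g + (f₂ x * h ^ 2 / 2) * g ^ 2) := fun g => by ring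
    simp only [this]
    exact (integrable_const _).add (hi3 _ _)
  rw [← hpoly, ← integral_sub (hf.integrable _ (hm.const_add x)) hipoly]
  calc |∫ g, (f (x + (h * g + κ * h ^ 2)) - (f x + f₁ x * (h * g + κ * h ^ 2) +
        f₂ x * (h * g + κ * h ^ 2) ^ 2 / 2)) ∂gaussianReal 0 1|
      ≤ ∫ g, B * h ^ 3 * (|κ| + |g|) ^ 3 ∂gaussianReal 0 1 := by
        refine (abs_integral_le_integral_abs).trans (integral_mono ?_ ?_ fun g => ?_)
        · exact ((hf.integrable _ (hm.const_add x)).sub hipoly).abs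
        · exact (integrable_thirdMoment κ).const_mul _
        · refine (le_of_eq ?_).trans ((hf.remainder_le x (h * g + κ * h ^ 2)).trans ?_)
          · congr 1
            ring
          -- Uses h ≤ 1 to absorb the mean κh² into the scale h.
          · have : |h * g + κ * h ^ 2| ≤ h * (|κ| + |g|) := by
              refine (abs_add_le _ _).trans ?_
              rw [abs_mul, abs_mul, abs_of_nonneg hh0, abs_of_nonneg (sq_nonneg h)]
              nlinarith [abs_nonneg κ, mul_nonneg (abs_nonneg κ) hh0]
            calc B * |h * g + κ * h ^ 2| ^ 3 ≤ B * (h * (|κ| + |g|)) ^ 3 := by gcongr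
              _ = _ := by ring
    _ = B * thirdMoment κ * h ^ 3 := by
        rw [integral_const_mul, thirdMoment]
        ring

/-- The walk step has mean (2p - 1)h and second moment h², the Gaussian step has mean κh² and second
moment h² + κ²h⁴. With 2p - 1 = κh + O(h²) the second-order expansions differ by O(h³), as do the
remainders. -/
lemma HasTaylorBound.step_le {B κ h p c : ℝ} {f f₁ f₂ : ℝ → ℝ} (hf : HasTaylorBound B f f₁ f₂)
    (hB : 0 ≤ B) (hh0 : 0 ≤ h) (hh1 : h ≤ 1) (hp0 : 0 ≤ p) (hp1 : p ≤ 1)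
    (hpc : |2 * p - 1 - κ * h| ≤ c * h ^ 2) (x : ℝ) :
    |OptionPricing.walkStep p h f x - ∫ z, f (x + z) ∂gaussianReal (κ * h ^ 2) (Real.toNNReal (h ^ 2))| ≤
      B * (1 + thirdMoment κ + c + κ ^ 2) * h ^ 3 := by
  have h1 := hf.gaussian_step (κ := κ) hB hh0 hh1 x
  have h2 := abs_convex_le hp0 hp1 (hf.remainder_le x h)
    ((hf.remainder_le x (-h)).trans_eq (by rw [abs_neg]))
  rw [abs_of_nonneg hh0] at h2
  have h3 : |f₁ x * h * (2 * p - 1 - κ * h)| ≤ B * h * (c * h ^ 2) := by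
    rw [abs_mul, abs_mul, abs_of_nonneg hh0]
    have := hf.abs_first_le x
    gcongr
  have h4 : |f₂ x * (κ ^ 2 * h ^ 4) / 2| ≤ B * (κ ^ 2 * h ^ 3) := by
    rw [abs_div, abs_mul, abs_of_nonneg (show 0 ≤ κ ^ 2 * h ^ 4 by positivity), abs_two]
    have h5 := hf.abs_second_le x
    have h6 : h ^ 4 ≤ h ^ 3 := pow_le_pow_of_le_one hh0 hh1 (by norm_num)
    calc |f₂ x| * (κ ^ 2 * h ^ 4) / 2 ≤ |f₂ x| * (κ ^ 2 * h ^ 4) :=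
          half_le_self (by positivity)
      _ ≤ _ := by gcongr
  rw [abs_le] at *
  simp only [OptionPricing.walkStep, sub_eq_add_neg x h]
  constructor <;> nlinarith

/-- Lindeberg's exchange argument. -/
lemma HasTaylorBound.walk_le {B κ h p c : ℝ} (hB : 0 ≤ B) (hh0 : 0 ≤ h) (hh1 : h ≤ 1)
    (hp0 : 0 ≤ p) (hp1 : p ≤ 1) (hpc : |2 * p - 1 - κ * h| ≤ c * h ^ 2) :
    ∀ (k : ℕ) {f f₁ f₂ : ℝ → ℝ} (_ : HasTaylorBound B f f₁ f₂) (x : ℝ),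
    |(OptionPricing.walkStep p h)^[k] f x -
      ∫ z, f (x + z) ∂gaussianReal (k * (κ * h ^ 2)) (k * Real.toNNReal (h ^ 2))| ≤
      k * (B * (1 + thirdMoment κ + c + κ ^ 2) * h ^ 3)
  | 0, f, f₁, f₂, hf, x => by
    simp [gaussianReal_zero_var]
  | k + 1, f, f₁, f₂, hf, x => by
    -- One walk step is moved into the test function and the induction hypothesis replaces the other
    -- k; then that step itself is exchanged for a Gaussian one, and convolution adds means and
    -- variances.
    have ih := walk_le hB hh0 hh1 hp0 hp1 hpc k (hf.walkStep (h := h) hp0 hp1) x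
    rw [Function.iterate_succ_apply]
    have hconv : gaussianReal ((k + 1 : ℕ) * (κ * h ^ 2)) ((k + 1 : ℕ) * Real.toNNReal (h ^ 2)) =
        gaussianReal (k * (κ * h ^ 2)) (k * Real.toNNReal (h ^ 2)) ∗
          gaussianReal (κ * h ^ 2) (Real.toNNReal (h ^ 2)) := by
      rw [gaussianReal_conv_gaussianReal]
      congr 1 <;> push_cast <;> ring
    have hint : Integrable (fun z => f (x + z))
        (gaussianReal (k * (κ * h ^ 2)) (k * Real.toNNReal (h ^ 2)) ∗
          gaussianReal (κ * h ^ 2) (Real.toNNReal (h ^ 2))) :=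
      hf.integrable _ (measurable_const_add x)
    rw [hconv, integral_conv hint]
    have hintP := (hf.walkStep (h := h) hp0 hp1).integrable
      (gaussianReal (k * (κ * h ^ 2)) (k * Real.toNNReal (h ^ 2))) (measurable_const_add x)
    have hintQ : Integrable
        (fun y => ∫ z, f (x + (y + z)) ∂gaussianReal (κ * h ^ 2) (Real.toNNReal (h ^ 2)))
        (gaussianReal (k * (κ * h ^ 2)) (k * Real.toNNReal (h ^ 2))) := by
      refine Integrable.integral_prod_left (f := fun yz : ℝ × ℝ => f (x + (yz.1 + yz.2))) ?_
      refine Integrable.of_bound (hf.continuous.comp (by fun_prop)).aestronglyMeasurable 1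
        (Filter.Eventually.of_forall fun _ => hf.abs_le_one _)
    have hstep : |∫ y, OptionPricing.walkStep p h f (x + y)
        ∂gaussianReal (k * (κ * h ^ 2)) (k * Real.toNNReal (h ^ 2)) -
        ∫ y, (∫ z, f (x + (y + z)) ∂gaussianReal (κ * h ^ 2) (Real.toNNReal (h ^ 2)))
          ∂gaussianReal (k * (κ * h ^ 2)) (k * Real.toNNReal (h ^ 2))| ≤
        B * (1 + thirdMoment κ + c + κ ^ 2) * h ^ 3 := by
      rw [← integral_sub hintP hintQ, ← Real.norm_eq_abs]
      refine (norm_integral_le_of_norm_le_const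
        (μ := gaussianReal (k * (κ * h ^ 2)) (k * Real.toNNReal (h ^ 2)))
        (C := B * (1 + thirdMoment κ + c + κ ^ 2) * h ^ 3)
        (Filter.Eventually.of_forall fun y => ?_)).trans_eq
          (by rw [probReal_univ, mul_one])
      rw [Real.norm_eq_abs]
      have := hf.step_le hB hh0 hh1 hp0 hp1 hpc (x + y)
      simpa only [add_assoc] using this
    calc _ ≤ _ := abs_sub_le _ _ _
      _ ≤ _ := add_le_add ih hstep
      _ = _ := by push_cast; ring

end

end OptionPricing

namespace OptionPricing

noncomputable section

/-! ### Smoothed indicators, Gaussian tails and the rate of convergence. -/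

/-- The mean value inequality on the interval between 0 and x. Three applications turn a bound on
the third derivative into a cubic Taylor remainder; the missing factorials do not matter. -/
lemma abs_sub_zero_le_of_deriv_le {φ φ' : ℝ → ℝ} {C : ℝ} {k : ℕ} (hC : 0 ≤ C)
    (h : ∀ x, HasDerivAt φ (φ' x) x) (hb : ∀ x, |φ' x| ≤ C * |x| ^ k) (x : ℝ) :
    |φ x - φ 0| ≤ C * |x| ^ (k + 1) := by
  have := (convex_uIcc (0 : ℝ) x).norm_image_sub_le_of_norm_hasDerivWithin_le
    (f := φ) (f' := φ') (C := C * |x| ^ k) (fun y _ => (h y).hasDerivWithinAt) (fun y hy => ?_)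
    Set.left_mem_uIcc Set.right_mem_uIcc
  · rwa [sub_zero, Real.norm_eq_abs, Real.norm_eq_abs, mul_assoc, ← pow_succ] at this
  · refine (hb y).trans ?_
    have : |y| ≤ |x| := by simpa using Set.abs_sub_left_of_mem_uIcc hy
    gcongr

/-- A smooth function that rises from zero to one on the unit interval. -/
lemma exists_smooth_step : ∃ (B : ℝ) (g g₁ g₂ : ℝ → ℝ), 0 ≤ B ∧ HasTaylorBound B g g₁ g₂ ∧
    (∀ x, 0 ≤ g x) ∧ (∀ x, g x ≤ 1) ∧ (∀ x ≤ 0, g x = 0) ∧ ∀ x, 1 ≤ x → g x = 1 := by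
  set g := Real.smoothTransition with hg
  have hs : ContDiff ℝ 3 g := Real.smoothTransition.contDiff
  have hs1 : ContDiff ℝ 2 (deriv g) := hs.deriv' (n := 2)
  have hs2 : ContDiff ℝ 1 (deriv (deriv g)) := hs1.deriv' (n := 1)
  have hs3 : ContDiff ℝ 0 (deriv (deriv (deriv g))) := hs2.deriv' (n := 0)
  have hc1 : HasCompactSupport (deriv g) := by
    refine HasCompactSupport.of_support_subset_isCompact (isCompact_Icc (a := (0 : ℝ)) (b := 1))
      fun x hx => ?_
    by_contra hx'
    refine hx ?_
    rcases not_and_or.1 hx' with h | h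
    · have : g =ᶠ[nhds x] fun _ => 0 := by
        filter_upwards [Iio_mem_nhds (not_le.1 h)] with y hy
        exact Real.smoothTransition.zero_of_nonpos hy.le
      rw [this.deriv_eq, deriv_const]
    · have : g =ᶠ[nhds x] fun _ => 1 := by
        filter_upwards [Ioi_mem_nhds (not_le.1 h)] with y hy
        exact Real.smoothTransition.one_of_one_le (le_of_lt hy)
      rw [this.deriv_eq, deriv_const]
  obtain ⟨B1, hB1⟩ := hs1.continuous.bounded_above_of_compact_support hc1
  obtain ⟨B2, hB2⟩ := hs2.continuous.bounded_above_of_compact_support hc1.deriv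
  obtain ⟨B3, hB3⟩ := hs3.continuous.bounded_above_of_compact_support hc1.deriv.deriv
  have hB10 : 0 ≤ B1 := (norm_nonneg _).trans (hB1 0)
  have hB20 : 0 ≤ B2 := (norm_nonneg _).trans (hB2 0)
  have hB30 : 0 ≤ B3 := (norm_nonneg _).trans (hB3 0)
  have d1 : ∀ x, HasDerivAt g (deriv g x) x := fun x =>
    (hs.differentiable (by norm_num) x).hasDerivAt
  have d2 : ∀ x, HasDerivAt (deriv g) (deriv (deriv g) x) x := fun x =>
    (hs1.differentiable (by norm_num) x).hasDerivAt
  have d3 : ∀ x, HasDerivAt (deriv (deriv g)) (deriv (deriv (deriv g)) x) x := fun x =>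
    (hs2.differentiable (by norm_num) x).hasDerivAt
  refine ⟨B1 + B2 + B3, g, deriv g, deriv (deriv g), by positivity,
    ⟨hs.continuous, fun x => ?_, fun x => ?_, fun x => ?_, fun x h => ?_⟩,
    Real.smoothTransition.nonneg, Real.smoothTransition.le_one,
    fun x hx => Real.smoothTransition.zero_of_nonpos hx,
    fun x hx => Real.smoothTransition.one_of_one_le hx⟩
  · exact abs_le.2 ⟨by linarith [Real.smoothTransition.nonneg x], Real.smoothTransition.le_one x⟩
  · exact (hB1 x).trans (by linarith)
  · exact (hB2 x).trans (by linarith)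
  · have e2 : ∀ s, |deriv (deriv g) (x + s) - deriv (deriv g) x| ≤ B3 * |s| ^ 1 := fun s => by
      have := abs_sub_zero_le_of_deriv_le (φ := fun s => deriv (deriv g) (x + s)) (k := 0) hB30
        (fun s => (d3 (x + s)).comp_const_add x s) (fun s => by simpa using hB3 (x + s)) s
      simpa using this
    have e1 : ∀ s, |deriv g (x + s) - deriv g x - deriv (deriv g) x * s| ≤ B3 * |s| ^ 2 :=
      fun s => by
      have := abs_sub_zero_le_of_deriv_le (k := 1)
        (φ := fun s => deriv g (x + s) - deriv g x - deriv (deriv g) x * s) hB30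
        (fun s => (((d2 (x + s)).comp_const_add x s).sub_const (deriv g x)).sub
          ((hasDerivAt_id s).const_mul (deriv (deriv g) x))) (fun s => by simpa using e2 s) s
      simpa using this
    have e0 := abs_sub_zero_le_of_deriv_le (k := 2)
        (φ := fun s => g (x + s) - g x - deriv g x * s - deriv (deriv g) x * s ^ 2 / 2) hB30
        (fun s => ((((d1 (x + s)).comp_const_add x s).sub_const (g x)).sub
          ((hasDerivAt_id s).const_mul (deriv g x))).sub
          ((((hasDerivAt_id s).pow 2).const_mul (deriv (deriv g) x)).div_const 2))
        (fun s => by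
          refine (le_of_eq ?_).trans (e1 s)
          congr 1
          simp
          ring) h
    simp only [add_zero, sub_self, mul_zero, sub_zero, ne_eq, OfNat.ofNat_ne_zero,
      not_false_eq_true, zero_pow, zero_div] at e0
    refine e0.trans ?_
    gcongr
    linarith

/-- Compression to width δ multiplies derivatives of order j by δ^(-j); since δ ≤ 1, the power
δ^(-3) dominates all of them. -/
lemma HasTaylorBound.comp_scale {B : ℝ} {g g₁ g₂ : ℝ → ℝ} (hg : HasTaylorBound B g g₁ g₂)
    (hB : 0 ≤ B) {δ : ℝ} (h0 : 0 < δ) (h1 : δ ≤ 1) (τ : ℝ) :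
    HasTaylorBound (B / δ ^ 3) (fun x => g ((x - τ) / δ)) (fun x => g₁ ((x - τ) / δ) / δ)
      (fun x => g₂ ((x - τ) / δ) / δ ^ 2) where
  continuous := hg.continuous.comp (by fun_prop)
  abs_le_one x := hg.abs_le_one _
  abs_first_le x := by
    rw [abs_div, abs_of_pos h0]
    have := hg.abs_first_le ((x - τ) / δ)
    gcongr
    exact pow_le_of_le_one h0.le h1 (by norm_num)
  abs_second_le x := by
    rw [abs_div, abs_of_pos (pow_pos h0 2)]
    exact (div_le_div_of_nonneg_right (hg.abs_second_le _) (by positivity)).trans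
      (div_le_div_of_nonneg_left hB (by positivity)
        (pow_le_pow_of_le_one h0.le h1 (by norm_num)))
  remainder_le x h := by
    have := hg.remainder_le ((x - τ) / δ) (h / δ)
    rw [abs_div, abs_of_pos h0, div_pow] at this
    convert this using 1
    · congr 1
      rw [show (x + h - τ) / δ = (x - τ) / δ + h / δ by ring]
      field_simp
    · ring

/-- The density is at most 1/√(2π) ≤ 1. This makes the tail 1-Lipschitz in its threshold, so moving
a threshold by δ costs at most δ. -/
lemma gaussian_interval_le (κ a b : ℝ) (hab : a ≤ b) :
    (gaussianReal κ 1).real (Set.Ico a b) ≤ b - a := by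
  have hle : gaussianReal κ 1 (Set.Ico a b) ≤ ENNReal.ofReal (b - a) := by
    rw [gaussianReal_apply _ one_ne_zero]
    calc ∫⁻ x in Set.Ico a b, gaussianPDF κ 1 x ≤ ∫⁻ _ in Set.Ico a b, 1 := by
          refine lintegral_mono fun x => ?_
          rw [gaussianPDF, ENNReal.ofReal_le_one, gaussianPDFReal]
          have h1 : (√(2 * Real.pi * (1 : ℝ≥0)))⁻¹ ≤ 1 := by
            refine inv_le_one_of_one_le₀ (Real.one_le_sqrt.2 ?_)
            push_cast
            nlinarith [Real.pi_gt_three]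
          have h2 : Real.exp (-(x - κ) ^ 2 / (2 * (1 : ℝ≥0))) ≤ 1 := by
            refine Real.exp_le_one_iff.2 (div_nonpos_of_nonpos_of_nonneg ?_ (by positivity))
            nlinarith [sq_nonneg (x - κ)]
          exact mul_le_one₀ h1 (Real.exp_nonneg _) h2
      _ = ENNReal.ofReal (b - a) := by simp
  exact ENNReal.toReal_le_of_le_ofReal (sub_nonneg.2 hab) hle

/-- The mass that the normal distribution with mean `κ` and variance one gives to `[τ, ∞)`. -/
def gaussianTail (κ τ : ℝ) : ℝ := (gaussianReal κ 1).real (Set.Ici τ)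

lemma gaussianTail_sub_le (κ : ℝ) {a b : ℝ} (hab : a ≤ b) :
    gaussianTail κ b ≤ gaussianTail κ a ∧ gaussianTail κ a ≤ gaussianTail κ b + (b - a) := by
  refine ⟨measureReal_mono (Set.Ici_subset_Ici.2 hab), ?_⟩
  have := gaussian_interval_le κ a b hab
  have h2 : gaussianTail κ a = (gaussianReal κ 1).real (Set.Ico a b) + gaussianTail κ b := by
    rw [gaussianTail, gaussianTail, ← measureReal_union _ measurableSet_Ici,
      Set.Ico_union_Ici_eq_Ici hab]
    exact Set.disjoint_left.2 fun x hx hx' => (hx.2.trans_le hx').false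
  linarith

lemma abs_gaussianTail_sub_le (κ a b : ℝ) :
    |gaussianTail κ a - gaussianTail κ b| ≤ |a - b| := by
  rcases le_total a b with h | h
  · have := gaussianTail_sub_le κ h
    rw [abs_of_nonneg (by linarith), abs_of_nonpos (by linarith)]
    linarith
  · have := gaussianTail_sub_le κ h
    rw [abs_of_nonpos (by linarith), abs_of_nonneg (by linarith)]
    linarith

lemma integral_indicator_Ici (κ τ : ℝ) :
    ∫ x, (if τ ≤ x then (1 : ℝ) else 0) ∂gaussianReal κ 1 = gaussianTail κ τ := by
  have : (fun x : ℝ => if τ ≤ x then (1 : ℝ) else 0) = (Set.Ici τ).indicator 1 := by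
    funext x
    simp [Set.indicator_apply]
  rw [this, integral_indicator_one measurableSet_Ici, gaussianTail]

lemma integrable_indicator_Ici (κ τ : ℝ) :
    Integrable (fun x : ℝ => if τ ≤ x then (1 : ℝ) else 0) (gaussianReal κ 1) := by
  refine Integrable.of_bound (Measurable.ite measurableSet_Ici measurable_const
    measurable_const).aestronglyMeasurable 1 (Filter.Eventually.of_forall fun x => ?_)
  split_ifs <;> simp

/-- The distribution function of the random walk converges to that of the normal distribution. -/
lemma exists_walk_sub_gaussianTail_le (κ c : ℝ) (hc : 0 ≤ c) : ∃ C : ℝ, 0 ≤ C ∧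
    ∀ (n : ℕ) (p : ℝ), 0 < n → 0 ≤ p → p ≤ 1 → |2 * p - 1 - κ / √n| ≤ c / n →
    ∀ τ δ : ℝ, 0 < δ → δ ≤ 1 →
    |∑ y : Fin n → Bool, (∏ j, if y j then p else 1 - p) *
        (if τ ≤ ∑ j, (if y j then 1 / √(n : ℝ) else -(1 / √(n : ℝ))) then 1 else 0) -
      gaussianTail κ τ| ≤ δ + C / (δ ^ 3 * √n) := by
  obtain ⟨B, g, g₁, g₂, hB, hg, hg0, hg1, hgl, hgr⟩ := exists_smooth_step
  have hthird : 0 ≤ thirdMoment κ := integral_nonneg fun x => by positivity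
  refine ⟨B * (1 + thirdMoment κ + c + κ ^ 2), by positivity, ?_⟩
  intro n p hn hp0 hp1 hpc τ δ hδ0 hδ1
  have hn1 : (1 : ℝ) ≤ √n := Real.one_le_sqrt.2 (by exact_mod_cast hn)
  have hn0 : (0 : ℝ) < √n := by linarith
  have hsq : √(n : ℝ) ^ 2 = n := Real.sq_sqrt (Nat.cast_nonneg _)
  set h : ℝ := 1 / √n with hh
  have hh0 : 0 ≤ h := by positivity
  have hh1 : h ≤ 1 := by rw [hh]; exact (div_le_one hn0).2 hn1
  have hh2 : h ^ 2 = 1 / n := by rw [hh, div_pow, hsq, one_pow]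
  have hnh : (n : ℝ) * h ^ 2 = 1 := by rw [hh2]; field_simp
  have hpc' : |2 * p - 1 - κ * h| ≤ c * h ^ 2 := by
    rw [hh2, hh, mul_one_div, mul_one_div]
    exact hpc
  -- The n steps of size 1/√n make an error n · δ^(-3) · n^(-3/2), up to the constant.
  have key : ∀ τ' : ℝ, |∑ y : Fin n → Bool, (∏ j, if y j then p else 1 - p) *
      g ((∑ j, (if y j then h else -h) - τ') / δ) - ∫ z, g ((z - τ') / δ) ∂gaussianReal κ 1| ≤
      B * (1 + thirdMoment κ + c + κ ^ 2) / (δ ^ 3 * √n) := by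
    intro τ'
    have := HasTaylorBound.walk_le (κ := κ) (div_nonneg hB (pow_nonneg hδ0.le 3)) hh0 hh1 hp0 hp1
      hpc' n (hg.comp_scale hB hδ0 hδ1 τ') 0
    rw [walkStep_iterate] at this
    have hv : (n : ℝ≥0) * Real.toNNReal (h ^ 2) = 1 := by
      ext
      rw [NNReal.coe_mul, Real.coe_toNNReal _ (sq_nonneg h)]
      exact hnh
    have hmean : (n : ℝ) * (κ * h ^ 2) = κ := by
      rw [mul_left_comm, hnh, mul_one]
    simp only [zero_add, hv, hmean] at this
    refine this.trans_eq ?_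
    calc _ = (n * h ^ 2) * (B / δ ^ 3 * (1 + thirdMoment κ + c + κ ^ 2)) * h := by ring
      _ = _ := by
        rw [hnh, hh]
        field_simp
  have hint : ∀ τ', Integrable (fun z => g ((z - τ') / δ)) (gaussianReal κ 1) := fun τ' =>
    hg.integrable _ (by fun_prop)
  have hw : ∀ y : Fin n → Bool, 0 ≤ ∏ j, if y j then p else 1 - p := fun y =>
    Finset.prod_nonneg fun j _ => by split_ifs <;> linarith
  -- The indicator of [τ, ∞) lies between the smooth steps rising on [τ, τ + δ] and on [τ - δ, τ],
  -- and these lie between the indicators shifted by δ.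
  have hlow : ∀ x, g ((x - τ) / δ) ≤ if τ ≤ x then 1 else 0 := fun x => by
    split_ifs with hx
    · exact hg1 _
    · exact (hgl _ (div_nonpos_of_nonpos_of_nonneg (by linarith) hδ0.le)).le
  have hupp : ∀ x, (if τ ≤ x then 1 else 0) ≤ g ((x - (τ - δ)) / δ) := fun x => by
    split_ifs with hx
    · exact (hgr _ ((one_le_div hδ0).2 (by linarith))).ge
    · exact hg0 _
  have hlow' : ∀ x, (if τ + δ ≤ x then 1 else 0) ≤ g ((x - τ) / δ) := fun x => by
    split_ifs with hx
    · exact (hgr _ ((one_le_div hδ0).2 (by linarith))).ge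
    · exact hg0 _
  have hupp' : ∀ x, g ((x - (τ - δ)) / δ) ≤ if τ - δ ≤ x then 1 else 0 := fun x => by
    split_ifs with hx
    · exact hg1 _
    · exact (hgl _ (div_nonpos_of_nonpos_of_nonneg (by linarith) hδ0.le)).le
  have i1 := integral_mono (integrable_indicator_Ici κ (τ + δ)) (hint τ) hlow'
  have i2 := integral_mono (hint (τ - δ)) (integrable_indicator_Ici κ (τ - δ)) hupp'
  rw [integral_indicator_Ici] at i1 i2
  have t1 := gaussianTail_sub_le κ (show τ ≤ τ + δ by linarith)
  have t2 := gaussianTail_sub_le κ (show τ - δ ≤ τ by linarith)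
  have s1 : ∑ y : Fin n → Bool, (∏ j, if y j then p else 1 - p) *
      g ((∑ j, (if y j then h else -h) - τ) / δ) ≤ ∑ y : Fin n → Bool,
      (∏ j, if y j then p else 1 - p) * (if τ ≤ ∑ j, (if y j then h else -h) then 1 else 0) :=
    Finset.sum_le_sum fun y _ => mul_le_mul_of_nonneg_left (hlow _) (hw y)
  have s2 : ∑ y : Fin n → Bool,
      (∏ j, if y j then p else 1 - p) * (if τ ≤ ∑ j, (if y j then h else -h) then 1 else 0) ≤
      ∑ y : Fin n → Bool, (∏ j, if y j then p else 1 - p) *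
      g ((∑ j, (if y j then h else -h) - (τ - δ)) / δ) :=
    Finset.sum_le_sum fun y _ => mul_le_mul_of_nonneg_left (hupp _) (hw y)
  have k1 := abs_le.1 (key τ)
  have k2 := abs_le.1 (key (τ - δ))
  exact abs_le.2 ⟨by linarith, by linarith⟩

end

end OptionPricing

namespace OptionPricing

noncomputable section

/-! ### Discrete Gaussian weights -/

/-- The standard normal density. -/
def normalDensity (x : ℝ) : ℝ := (√(2 * Real.pi))⁻¹ * Real.exp (-(x ^ 2 / 2))

lemma normalConst_le_one : (√(2 * Real.pi))⁻¹ ≤ 1 :=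
  inv_le_one_of_one_le₀ (Real.one_le_sqrt.2 (by nlinarith [Real.pi_gt_three]))

/-- The derivative is bounded by |z| exp(-z²/2), and |z| ≤ 1 + z²/2 ≤ exp(z²/2). -/
lemma abs_normalDensity_sub_le (x y : ℝ) : |normalDensity x - normalDensity y| ≤ |x - y| := by
  have hd : ∀ z, HasDerivAt normalDensity ((√(2 * Real.pi))⁻¹ * (Real.exp (-(z ^ 2 / 2)) * -z)) z := by
    intro z
    have h1 : HasDerivAt (fun z : ℝ => -(z ^ 2 / 2)) (-z) z := by
      have h2 : HasDerivAt (fun z : ℝ => z ^ 2 / 2) z z := by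
        simpa using ((hasDerivAt_id z).pow 2).div_const 2
      exact h2.neg
    exact h1.exp.const_mul _
  have := convex_univ.norm_image_sub_le_of_norm_hasDerivWithin_le (f := normalDensity) (C := 1)
    (fun z _ => (hd z).hasDerivWithinAt) (fun z _ => ?_) (Set.mem_univ y) (Set.mem_univ x)
  · simpa using this
  · rw [Real.norm_eq_abs, abs_mul, abs_mul, Real.abs_exp, abs_neg, abs_of_nonneg (by positivity)]
    have h1 : |z| ≤ Real.exp (z ^ 2 / 2) := by
      refine le_trans ?_ (Real.add_one_le_exp _)
      nlinarith [sq_nonneg (|z| - 1), sq_abs z]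
    have h2 : Real.exp (-(z ^ 2 / 2)) * |z| ≤ 1 := by
      rw [Real.exp_neg, inv_mul_le_iff₀ (Real.exp_pos _), mul_one]
      exact h1
    exact mul_le_one₀ normalConst_le_one (by positivity) h2

lemma gaussianTail_sub_eq {a b : ℝ} (hab : a ≤ b) :
    gaussianTail 0 a - gaussianTail 0 b = ∫ x in Set.Ico a b, normalDensity x := by
  have h2 : gaussianTail 0 a = (gaussianReal 0 1).real (Set.Ico a b) + gaussianTail 0 b := by
    rw [gaussianTail, gaussianTail, ← measureReal_union _ measurableSet_Ici,
      Set.Ico_union_Ici_eq_Ici hab]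
    exact Set.disjoint_left.2 fun x hx hx' => (hx.2.trans_le hx').false
  have h3 : ∀ x, gaussianPDFReal 0 1 x = normalDensity x := fun x => by
    rw [gaussianPDFReal, normalDensity, NNReal.coe_one, mul_one, mul_one, sub_zero, neg_div]
  rw [h2, add_sub_cancel_right, measureReal_def, gaussianReal_apply_eq_integral _ one_ne_zero,
    ENNReal.toReal_ofReal]
  · simp only [h3]
  · exact setIntegral_nonneg measurableSet_Ico fun x _ => gaussianPDFReal_nonneg _ _ _

/-- On a cell of length 2h every point is within h of the midpoint, so the Lipschitz bound gives an
error at most h times the length. -/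
lemma abs_cell_sub_le {h : ℝ} (hh : 0 ≤ h) (a : ℝ) :
    |2 * h * normalDensity (a + h) - (gaussianTail 0 a - gaussianTail 0 (a + 2 * h))| ≤
      2 * h ^ 2 := by
  have hcont : Continuous normalDensity := by
    unfold normalDensity
    fun_prop
  have hint : IntegrableOn normalDensity (Set.Ico a (a + 2 * h)) :=
    hcont.integrableOn_Icc.mono_set Set.Ico_subset_Icc_self
  have hc : 2 * h * normalDensity (a + h) =
      ∫ _ in Set.Ico a (a + 2 * h), normalDensity (a + h) := by
    rw [setIntegral_const, measureReal_def, Real.volume_Ico, add_sub_cancel_left,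
      ENNReal.toReal_ofReal (by positivity), smul_eq_mul]
  have hintc : IntegrableOn (fun _ => normalDensity (a + h)) (Set.Ico a (a + 2 * h)) :=
    integrableOn_const (measure_Ico_lt_top (μ := volume)).ne
  rw [gaussianTail_sub_eq (by linarith), hc, ← integral_sub hintc hint]
  rw [← Real.norm_eq_abs]
  refine (norm_setIntegral_le_of_norm_le_const (C := h) (measure_Ico_lt_top (μ := volume))
    fun x hx => ?_).trans_eq ?_
  · refine (abs_normalDensity_sub_le _ _).trans (abs_le.2 ⟨?_, ?_⟩)
    · linarith [hx.2]
    · linarith [hx.1]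
  · rw [measureReal_def, Real.volume_Ico, add_sub_cancel_left,
      ENNReal.toReal_ofReal (by positivity)]
    ring

lemma gaussianTail_nonneg (κ τ : ℝ) : 0 ≤ gaussianTail κ τ := measureReal_nonneg

lemma gaussianTail_le_one (κ τ : ℝ) : gaussianTail κ τ ≤ 1 := measureReal_le_one

/-- Chernoff's bound with parameter one. An exponential tail is enough, since the truncation point
is logarithmic anyway. -/
lemma gaussianTail_le_exp (A : ℝ) : gaussianTail 0 A ≤ 2 * Real.exp (-A) := by
  have := measure_ge_le_exp_mul_mgf (μ := gaussianReal 0 1) (X := id) A zero_le_one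
    (by simpa using integrable_exp_mul_gaussianReal (μ := 0) (v := 1) 1)
  rw [mgf_id_gaussianReal] at this
  have h2 : Real.exp (1 / 2) ≤ 2 := by
    have h3 := Real.exp_one_lt_d9
    have : Real.exp (1 / 2) ^ 2 = Real.exp 1 := by
      rw [← Real.exp_nat_mul]
      norm_num
    nlinarith [Real.exp_pos (1 / 2)]
  refine (this.trans_eq ?_).trans (mul_le_mul_of_nonneg_right h2 (Real.exp_nonneg _))
  rw [mul_comm]
  norm_num

lemma one_sub_gaussianTail_le_exp (A : ℝ) : 1 - gaussianTail 0 (-A) ≤ 2 * Real.exp (-A) := by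
  have := measure_le_le_exp_mul_mgf (μ := gaussianReal 0 1) (X := id) (-A)
    (show (-1 : ℝ) ≤ 0 by norm_num)
    (by simpa using integrable_exp_mul_gaussianReal (μ := 0) (v := 1) (-1))
  rw [mgf_id_gaussianReal] at this
  have h2 : Real.exp (1 / 2) ≤ 2 := by
    have h3 := Real.exp_one_lt_d9
    have : Real.exp (1 / 2) ^ 2 = Real.exp 1 := by
      rw [← Real.exp_nat_mul]
      norm_num
    nlinarith [Real.exp_pos (1 / 2)]
  have h4 : 1 - gaussianTail 0 (-A) ≤ (gaussianReal 0 1).real {ω | id ω ≤ -A} := by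
    rw [gaussianTail, ← probReal_compl_eq_one_sub measurableSet_Ici]
    refine measureReal_mono fun x hx => ?_
    simp only [Set.mem_compl_iff, Set.mem_Ici, not_le] at hx
    exact hx.le
  refine h4.trans ((this.trans_eq ?_).trans (mul_le_mul_of_nonneg_right h2 (Real.exp_nonneg _)))
  rw [mul_comm]
  norm_num

/-- The cells telescope. Counting those whose left end is at least τ misses at most the cell
containing τ and the mass outside the truncated range; the maximum with 0 covers thresholds beyond
the last cell. -/
lemma sum_cells_mem (h τ A : ℝ) (hh : 0 ≤ h) (I : ℕ) :
    gaussianTail 0 (τ + 2 * h) - gaussianTail 0 (-A + 2 * I * h) - (1 - gaussianTail 0 (-A)) ≤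
      ∑ i ∈ Finset.range I, (if τ ≤ -A + 2 * i * h then
        gaussianTail 0 (-A + 2 * i * h) - gaussianTail 0 (-A + 2 * i * h + 2 * h) else 0) ∧
    ∑ i ∈ Finset.range I, (if τ ≤ -A + 2 * i * h then
        gaussianTail 0 (-A + 2 * i * h) - gaussianTail 0 (-A + 2 * i * h + 2 * h) else 0) ≤
      max 0 (gaussianTail 0 τ - gaussianTail 0 (-A + 2 * I * h)) := by
  induction I with
  | zero =>
    simp only [Finset.range_zero, Finset.sum_empty, Nat.cast_zero, mul_zero, zero_mul, add_zero]
    exact ⟨by linarith [gaussianTail_le_one 0 (τ + 2 * h)], le_max_left _ _⟩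
  | succ I ih =>
    have e : -A + 2 * ((I + 1 : ℕ) : ℝ) * h = -A + 2 * I * h + 2 * h := by push_cast; ring
    rw [Finset.sum_range_succ, e]
    have hpos : 0 ≤ ∑ i ∈ Finset.range I, (if τ ≤ -A + 2 * i * h then
        gaussianTail 0 (-A + 2 * i * h) - gaussianTail 0 (-A + 2 * i * h + 2 * h) else 0) := by
      refine Finset.sum_nonneg fun i _ => ?_
      split_ifs
      · exact sub_nonneg.2 (gaussianTail_sub_le 0 (by linarith)).1
      · exact le_rfl
    split_ifs with hτ
    · have h1 := (gaussianTail_sub_le 0 hτ).1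
      rw [max_eq_right (by linarith)] at ih
      exact ⟨by linarith [ih.1], (by linarith [ih.2] : _ ≤ _).trans (le_max_right _ _)⟩
    · have h1 := (gaussianTail_sub_le 0 (not_le.1 hτ).le).1
      have h2 := (gaussianTail_sub_le 0
        (show -A + 2 * I * h + 2 * h ≤ τ + 2 * h by linarith [not_le.1 hτ])).1
      rw [max_eq_left (by linarith)] at ih
      exact ⟨by linarith [gaussianTail_le_one 0 (-A)], by
        rw [add_zero]
        exact ih.2.trans (le_max_left _ _)⟩

/-- The weights of the discrete Gaussian distribution. -/
def gaussWeight (n m : ℕ) : ℝ := Real.exp (-(2 / n * ((m : ℝ) ^ 2 + m)))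

lemma gaussWeight_pos (n m : ℕ) : 0 < gaussWeight n m := Real.exp_pos _

/-- The points that carry the discrete Gaussian distribution. -/
def gaussPoint (n : ℕ) (s : Bool) (m : ℕ) : ℝ :=
  if s then 2 * m * (1 / √n) else -((2 * m + 2) * (1 / √n))

lemma sum_range_two_mul {F : ℕ → ℝ} (K : ℕ) :
    ∑ i ∈ Finset.range (2 * K), F i =
      ∑ m ∈ Finset.range K, F (K + m) + ∑ m ∈ Finset.range K, F (K - 1 - m) := by
  rw [two_mul, Finset.sum_range_add, Finset.sum_range_reflect, add_comm]

/-- The midpoints of the cells are ±(2m + 1)/√n, and (2m + 1)² = 4(m² + m) + 1. This is why the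
weights have exponent (2/n)(m² + m) and are the same for both signs; the constant 1 goes into the
normalization. -/
lemma normalDensity_cell {n : ℕ} (hn : 0 < n) (s : Bool) (m : ℕ) :
    normalDensity (gaussPoint n s m + 1 / √n) =
      (√(2 * Real.pi))⁻¹ * Real.exp (-(1 / (2 * n))) * gaussWeight n m := by
  have hn' : (0 : ℝ) < n := by exact_mod_cast hn
  have hsq : (1 / √(n : ℝ)) ^ 2 = 1 / n := by
    rw [div_pow, Real.sq_sqrt hn'.le, one_pow]
  rw [normalDensity, gaussWeight, mul_assoc, ← Real.exp_add]
  congr 2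
  have : (gaussPoint n s m + 1 / √n) ^ 2 = (2 * m + 1) ^ 2 * (1 / √n) ^ 2 := by
    rw [gaussPoint]
    split_ifs <;> ring
  rw [this, hsq]
  field_simp
  ring

lemma sum_weights_eq {n : ℕ} (hn : 0 < n) (K : ℕ) (P : ℝ → Prop) [DecidablePred P] :
    ∑ i ∈ Finset.range (2 * K), (if P (-(2 * K * (1 / √n)) + 2 * i * (1 / √n)) then
      2 * (1 / √n) * normalDensity (-(2 * K * (1 / √n)) + 2 * i * (1 / √n) + 1 / √n) else 0) =
    2 * (1 / √n) * ((√(2 * Real.pi))⁻¹ * Real.exp (-(1 / (2 * n)))) *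
      ∑ s : Bool, ∑ m ∈ Finset.range K, gaussWeight n m * if P (gaussPoint n s m) then 1 else 0 := by
  rw [sum_range_two_mul, Fintype.sum_bool, mul_add, Finset.mul_sum, Finset.mul_sum]
  congr 1
  · refine Finset.sum_congr rfl fun m _ => ?_
    rw [show -(2 * K * (1 / √(n : ℝ))) + 2 * ((K + m : ℕ) : ℝ) * (1 / √n) = gaussPoint n true m by
      rw [gaussPoint, if_pos rfl]; push_cast; ring, normalDensity_cell hn]
    split_ifs <;> ring
  · refine Finset.sum_congr rfl fun m hm => ?_
    have hm' : m + 1 ≤ K := Finset.mem_range.1 hm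
    rw [show -(2 * K * (1 / √(n : ℝ))) + 2 * ((K - 1 - m : ℕ) : ℝ) * (1 / √n) =
      gaussPoint n false m by
      rw [gaussPoint, if_neg (by simp), show K - 1 - m = K - (m + 1) by omega,
        Nat.cast_sub hm']; push_cast; ring, normalDensity_cell hn]
    split_ifs <;> ring

/-- The terms of the error are the 2K cells at 2/n each, the boundary cell of length 2/√n, and
truncation on both sides at 2K/√n. -/
lemma abs_sum_weights_sub_le {n : ℕ} (hn : 0 < n) (K : ℕ) (τ : ℝ) :
    |2 * (1 / √n) * ((√(2 * Real.pi))⁻¹ * Real.exp (-(1 / (2 * n)))) *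
      ∑ s : Bool, ∑ m ∈ Finset.range K, gaussWeight n m *
        (if τ ≤ gaussPoint n s m then 1 else 0) - gaussianTail 0 τ| ≤
      4 * K / n + 2 / √n + 4 * Real.exp (-(2 * K * (1 / √n))) := by
  have hn' : (0 : ℝ) < n := by exact_mod_cast hn
  have hsq : (1 / √(n : ℝ)) ^ 2 = 1 / n := by
    rw [div_pow, Real.sq_sqrt hn'.le, one_pow]
  rw [← sum_weights_eq hn K fun x => τ ≤ x]
  set h : ℝ := 1 / √n with hh
  have hh0 : 0 ≤ h := by positivity
  set A : ℝ := 2 * K * h with hA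
  have hcells := sum_cells_mem h τ A hh0 (2 * K)
  have hend : -A + 2 * ((2 * K : ℕ) : ℝ) * h = A := by rw [hA]; push_cast; ring
  rw [hend] at hcells
  have hdiff : |∑ i ∈ Finset.range (2 * K), (if τ ≤ -A + 2 * i * h then
      2 * h * normalDensity (-A + 2 * i * h + h) else 0) -
      ∑ i ∈ Finset.range (2 * K), (if τ ≤ -A + 2 * i * h then
        gaussianTail 0 (-A + 2 * i * h) - gaussianTail 0 (-A + 2 * i * h + 2 * h) else 0)| ≤
      4 * K / n := by
    rw [← Finset.sum_sub_distrib]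
    refine (Finset.abs_sum_le_sum_abs _ _).trans ((Finset.sum_le_card_nsmul _ _ (2 * h ^ 2)
      fun i _ => ?_).trans_eq ?_)
    · split_ifs
      · exact abs_cell_sub_le hh0 _
      · simp only [sub_self, abs_zero]
        positivity
    · rw [Finset.card_range, nsmul_eq_mul, hsq]
      push_cast
      ring
  have h1 := gaussianTail_le_exp A
  have h2 := one_sub_gaussianTail_le_exp A
  have h3 := gaussianTail_sub_le 0 (show τ ≤ τ + 2 * h by linarith)
  have h4 : max 0 (gaussianTail 0 τ - gaussianTail 0 A) ≤ gaussianTail 0 τ :=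
    max_le (gaussianTail_nonneg _ _) (by linarith [gaussianTail_nonneg 0 A])
  have h5 : 2 / √(n : ℝ) = 2 * h := by rw [hh]; ring
  rw [h5]
  have h6 := Real.exp_pos (-A)
  have h7 := abs_le.1 hdiff
  exact abs_le.2 ⟨by linarith [hcells.1], by linarith [hcells.2]⟩

lemma abs_total_weight_sub_le {n : ℕ} (hn : 0 < n) (K : ℕ) :
    |2 * (1 / √n) * ((√(2 * Real.pi))⁻¹ * Real.exp (-(1 / (2 * n)))) *
      (2 * ∑ m ∈ Finset.range K, gaussWeight n m) - 1| ≤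
      4 * K / n + 4 * Real.exp (-(2 * K * (1 / √n))) := by
  have hn' : (0 : ℝ) < n := by exact_mod_cast hn
  have hsq : (1 / √(n : ℝ)) ^ 2 = 1 / n := by
    rw [div_pow, Real.sq_sqrt hn'.le, one_pow]
  have hs := sum_weights_eq hn K fun _ => True
  simp only [if_true, mul_one, Fintype.sum_bool, ← two_mul] at hs
  rw [← hs]
  set h : ℝ := 1 / √n with hh
  have hh0 : 0 ≤ h := by positivity
  set A : ℝ := 2 * K * h with hA
  have hcells : ∑ i ∈ Finset.range (2 * K),
      (gaussianTail 0 (-A + 2 * i * h) - gaussianTail 0 (-A + 2 * i * h + 2 * h)) =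
      gaussianTail 0 (-A) - gaussianTail 0 A := by
    have := Finset.sum_range_sub' (fun i : ℕ => gaussianTail 0 (-A + 2 * i * h)) (2 * K)
    have hend : -A + 2 * ((2 * K : ℕ) : ℝ) * h = A := by rw [hA]; push_cast; ring
    simp only [hend, Nat.cast_zero, mul_zero, zero_mul, add_zero] at this
    rw [← this]
    refine Finset.sum_congr rfl fun i _ => ?_
    rw [show -A + 2 * ((i + 1 : ℕ) : ℝ) * h = -A + 2 * i * h + 2 * h by push_cast; ring]
  have hdiff : |∑ i ∈ Finset.range (2 * K), 2 * h * normalDensity (-A + 2 * i * h + h) -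
      ∑ i ∈ Finset.range (2 * K),
      (gaussianTail 0 (-A + 2 * i * h) - gaussianTail 0 (-A + 2 * i * h + 2 * h))| ≤ 4 * K / n := by
    rw [← Finset.sum_sub_distrib]
    refine (Finset.abs_sum_le_sum_abs _ _).trans ((Finset.sum_le_card_nsmul _ _ (2 * h ^ 2)
      fun i _ => abs_cell_sub_le hh0 _).trans_eq ?_)
    rw [Finset.card_range, nsmul_eq_mul, hsq]
    push_cast
    ring
  rw [hcells] at hdiff
  have h1 := gaussianTail_le_exp A
  have h2 := one_sub_gaussianTail_le_exp A
  have h3 := gaussianTail_nonneg 0 A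
  have h4 := gaussianTail_le_one 0 (-A)
  have h7 := abs_le.1 hdiff
  exact abs_le.2 ⟨by linarith, by linarith [Real.exp_pos (-A)]⟩

/-- The discrete Gaussian distribution is close to the normal distribution. -/
lemma abs_discrete_gaussian_sub_le {n : ℕ} (hn : 0 < n) {K : ℕ} (hK : 0 < K) (τ : ℝ) :
    |(∑ s : Bool, ∑ m ∈ Finset.range K, gaussWeight n m *
        (if τ ≤ gaussPoint n s m then 1 else 0)) / (2 * ∑ m ∈ Finset.range K, gaussWeight n m) -
      gaussianTail 0 τ| ≤
      8 * K / n + 2 / √n + 8 * Real.exp (-(2 * K * (1 / √n))) := by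
  have h1 := abs_sum_weights_sub_le hn K τ
  have h2 := abs_total_weight_sub_le hn K
  have hn' : (0 : ℝ) < n := by exact_mod_cast hn
  set c := 2 * (1 / √n) * ((√(2 * Real.pi))⁻¹ * Real.exp (-(1 / (2 * (n : ℝ))))) with hc
  have hc0 : 0 < c := by positivity
  set G := ∑ m ∈ Finset.range K, gaussWeight n m with hG
  have hG0 : 0 < G := Finset.sum_pos (fun m _ => gaussWeight_pos n m) (by simp [hK.ne'])
  set S := ∑ s : Bool, ∑ m ∈ Finset.range K, gaussWeight n m *
    (if τ ≤ gaussPoint n s m then (1 : ℝ) else 0) with hS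
  have hS0 : 0 ≤ S := Finset.sum_nonneg fun s _ => Finset.sum_nonneg fun m _ =>
    mul_nonneg (gaussWeight_pos n m).le (by split_ifs <;> norm_num)
  have hSG : S ≤ 2 * G := by
    have : ∀ s : Bool, ∑ m ∈ Finset.range K, gaussWeight n m *
        (if τ ≤ gaussPoint n s m then (1 : ℝ) else 0) ≤ G := fun s =>
      Finset.sum_le_sum fun m _ => mul_le_of_le_one_right (gaussWeight_pos n m).le
        (by split_ifs <;> norm_num)
    rw [hS, Fintype.sum_bool]
    linarith [this true, this false]
  -- Dividing by the true total instead of multiplying by c costs at most the error of the total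
  -- weight, because S/(2G) ≤ 1.
  have h3 : |S / (2 * G) - c * S| ≤ |c * (2 * G) - 1| := by
    have h4 : S / (2 * G) ≤ 1 := (div_le_one (by positivity)).2 hSG
    rw [show S / (2 * G) - c * S = (S / (2 * G)) * -(c * (2 * G) - 1) by field_simp; ring,
      abs_mul, abs_neg, abs_of_nonneg (by positivity)]
    exact mul_le_of_le_one_left (abs_nonneg _) h4
  calc _ ≤ _ := abs_sub_le _ (c * S) _
    _ ≤ _ := add_le_add (h3.trans h2) h1
    _ = _ := by ring

/-- The normalized total is at least 1/2 and the normalizing factor is at most 2/√n. The bound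
controls the acceptance probability from below. -/
lemma sum_gaussWeight_ge {n : ℕ} (hn : 0 < n) {K : ℕ}
    (h : 4 * K / n + 4 * Real.exp (-(2 * K * (1 / √n))) ≤ (1 / 2 : ℝ)) :
    √n / 8 ≤ ∑ m ∈ Finset.range K, gaussWeight n m := by
  have h2 := (abs_le.1 ((abs_total_weight_sub_le hn K).trans h)).1
  have hn' : (0 : ℝ) < n := by exact_mod_cast hn
  set G := ∑ m ∈ Finset.range K, gaussWeight n m with hG
  have hG0 : 0 ≤ G := Finset.sum_nonneg fun m _ => (gaussWeight_pos n m).le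
  have h3 : (√(2 * Real.pi))⁻¹ * Real.exp (-(1 / (2 * (n : ℝ)))) ≤ 1 :=
    mul_le_one₀ normalConst_le_one (Real.exp_nonneg _) (Real.exp_le_one_iff.2 (by
      rw [neg_nonpos]; positivity))
  have h4 : 1 / 2 ≤ 2 * (1 / √(n : ℝ)) * 1 * (2 * G) := by
    refine le_trans (by linarith) (mul_le_mul_of_nonneg_right
      (mul_le_mul_of_nonneg_left h3 (by positivity)) (by positivity))
  have h5 : (0 : ℝ) < √n := Real.sqrt_pos.2 hn'
  rw [show 2 * (1 / √(n : ℝ)) * 1 * (2 * G) = 4 * G / √n by ring, le_div_iff₀ h5] at h4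
  linarith

end

end OptionPricing

namespace OptionPricing

noncomputable section

/-! ### Piecewise constant payoffs -/

namespace PiecewiseConstantPayoff

variable {m : ℕ} (ψ : PiecewiseConstantPayoff m)

lemma breakpoint_le_iff (s : ℝ) (j : Fin (m + 1)) :
    ψ.breakpoint j ≤ s ↔ (j : ℕ) < (ψ.piece s : ℕ) := by
  constructor
  · intro h
    have : Finset.Iic j ⊆ Finset.univ.filter fun i => ψ.breakpoint i ≤ s := fun i hi => by
      rw [Finset.mem_filter]
      exact ⟨Finset.mem_univ _, (ψ.strictMono.monotone (Finset.mem_Iic.1 hi)).trans h⟩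
    have hc := Finset.card_le_card this
    rw [Fin.card_Iic] at hc
    exact hc
  · intro h
    by_contra hlt
    have : (Finset.univ.filter fun i => ψ.breakpoint i ≤ s) ⊆ Finset.Iio j := fun i hi => by
      rw [Finset.mem_filter] at hi
      rw [Finset.mem_Iio]
      by_contra hij
      exact hlt ((ψ.strictMono.monotone (not_lt.1 hij)).trans hi.2)
    have hc := Finset.card_le_card this
    rw [Fin.card_Iio] at hc
    exact (h.trans_le hc).false

/-- The value on the current piece is the leftmost value plus the jumps at all breakpoints already
passed, by telescoping. -/
lemma eval_eq (s : ℝ) : ψ.eval s = ψ.value 0 +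
    ∑ j : Fin (m + 1), (ψ.value j.succ - ψ.value j.castSucc) *
      if ψ.breakpoint j ≤ s then 1 else 0 := by
  set v : ℕ → ℝ := fun k => if h : k < m + 2 then ψ.value ⟨k, h⟩ else 0 with hv
  have hv' : ∀ k : Fin (m + 2), v k = ψ.value k := fun k => dif_pos k.2
  have h1 : ∀ j : Fin (m + 1), (ψ.value j.succ - ψ.value j.castSucc) *
      (if ψ.breakpoint j ≤ s then (1 : ℝ) else 0) =
      if (j : ℕ) < (ψ.piece s : ℕ) then v (j + 1) - v j else 0 := fun j => by
    rw [← hv', ← hv']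
    simp only [ψ.breakpoint_le_iff, Fin.val_succ, Fin.val_castSucc, mul_ite, mul_one, mul_zero]
  rw [Finset.sum_congr rfl fun j _ => h1 j,
    Fin.sum_univ_eq_sum_range (fun j => if j < (ψ.piece s : ℕ) then v (j + 1) - v j else 0),
    ← Finset.sum_filter]
  have h2 : (Finset.range (m + 1)).filter (fun j => j < (ψ.piece s : ℕ)) =
      Finset.range (ψ.piece s) := by
    ext j
    simp only [Finset.mem_filter, Finset.mem_range]
    have := (ψ.piece s).2
    omega
  rw [h2, Finset.sum_range_sub, hv']
  have h0 : v 0 = ψ.value 0 := hv' 0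
  rw [h0, eval]
  ring

lemma measurable_eval : Measurable ψ.eval := by
  have : ψ.eval = fun s => ψ.value 0 + ∑ j : Fin (m + 1),
      (ψ.value j.succ - ψ.value j.castSucc) * if ψ.breakpoint j ≤ s then 1 else 0 :=
    funext ψ.eval_eq
  rw [this]
  exact measurable_const.add (Finset.measurable_fun_sum _ fun j _ =>
    measurable_const.mul (Measurable.ite measurableSet_Ici measurable_const measurable_const))

lemma abs_eval_le {M : ℝ} (hM : ∀ j, |ψ.value j| ≤ M) (s : ℝ) : |ψ.eval s| ≤ M := hM _

/-- As a function of the logarithm of the price, the payoff is a combination of indicators of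
half-lines. -/
lemma exists_indicator_form {M : ℝ} (hM : ∀ j, |ψ.value j| ≤ M) {s : ℝ} (hs : 0 < s) (α : ℝ)
    {β : ℝ} (hβ : 0 < β) : ∃ (c₀ : ℝ) (c τ : Fin (m + 1) → ℝ), (∀ j, |c j| ≤ 2 * M) ∧
      ∀ x, ψ.eval (s * Real.exp (α + β * x)) = c₀ + ∑ j, c j * if τ j ≤ x then 1 else 0 := by
  set d : Fin (m + 1) → ℝ := fun j => ψ.value j.succ - ψ.value j.castSucc with hd
  have hd' : ∀ j, |d j| ≤ 2 * M := fun j => by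
    refine (abs_sub _ _).trans ?_
    linarith [hM j.succ, hM j.castSucc]
  have hM0 : 0 ≤ M := (abs_nonneg _).trans (hM 0)
  -- Prices are positive, so breakpoints at or below zero are always passed and their jumps go into
  -- the constant; the others have a logarithm, which gives the thresholds.
  refine ⟨ψ.value 0 + ∑ j, if ψ.breakpoint j ≤ 0 then d j else 0,
    fun j => if ψ.breakpoint j ≤ 0 then 0 else d j,
    fun j => (Real.log (ψ.breakpoint j / s) - α) / β, fun j => ?_, fun x => ?_⟩
  · simp only
    split_ifs
    · simpa using hM0
    · exact hd' j
  · rw [eval_eq, add_assoc, ← Finset.sum_add_distrib]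
    congr 1
    refine Finset.sum_congr rfl fun j _ => ?_
    have hpos : 0 < s * Real.exp (α + β * x) := by positivity
    beta_reduce
    by_cases hj : ψ.breakpoint j ≤ 0
    · rw [if_pos hj, if_pos hj, if_pos (hj.trans hpos.le)]
      ring
    · rw [if_neg hj, if_neg hj, zero_add]
      congr 1
      refine if_congr ?_ rfl rfl
      rw [div_le_iff₀ hβ, sub_le_iff_le_add, Real.log_le_iff_le_exp (div_pos (not_le.1 hj) hs),
        div_le_iff₀ hs, mul_comm s, mul_comm x, add_comm α]

/-- A discrete distribution close to the normal distribution gives almost the same mean of the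
payoff. -/
lemma abs_mean_sub_le {M : ℝ} (hM : ∀ j, |ψ.value j| ≤ M) {s : ℝ} (hs : 0 < s) (α : ℝ)
    {β : ℝ} (hβ : 0 < β) {ι : Type*} (I : Finset ι) (w x : ι → ℝ) (hw : ∑ i ∈ I, w i = 1)
    {κ D : ℝ} (hD : ∀ τ, |∑ i ∈ I, w i * (if τ ≤ x i then 1 else 0) - gaussianTail κ τ| ≤ D) :
    |∑ i ∈ I, w i * ψ.eval (s * Real.exp (α + β * x i)) -
      ∫ y, ψ.eval (s * Real.exp (α + β * y)) ∂gaussianReal κ 1| ≤ 2 * M * (m + 1) * D := by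
  obtain ⟨c₀, c, τ, hc, h⟩ := ψ.exists_indicator_form hM hs α hβ
  simp only [h]
  have h1 : ∑ i ∈ I, w i * (c₀ + ∑ j, c j * if τ j ≤ x i then 1 else 0) =
      c₀ + ∑ j, c j * ∑ i ∈ I, w i * (if τ j ≤ x i then 1 else 0) := by
    simp only [mul_add, Finset.sum_add_distrib, ← Finset.sum_mul, hw, one_mul, Finset.mul_sum]
    rw [Finset.sum_comm]
    congr 1
    exact Finset.sum_congr rfl fun j _ => Finset.sum_congr rfl fun i _ => by ring
  have h2 : ∫ y, (c₀ + ∑ j, c j * if τ j ≤ y then 1 else 0) ∂gaussianReal κ 1 =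
      c₀ + ∑ j, c j * gaussianTail κ (τ j) := by
    have hi : ∀ j, Integrable (fun y : ℝ => c j * if τ j ≤ y then 1 else 0) (gaussianReal κ 1) :=
      fun j => (integrable_indicator_Ici κ (τ j)).const_mul _
    rw [integral_add (integrable_const _) (integrable_finsetSum _ fun j _ => hi j),
      integral_finsetSum _ fun j _ => hi j]
    simp only [integral_const_mul, integral_indicator_Ici, integral_const, probReal_univ, one_smul]
  rw [h1, h2, add_sub_add_left_eq_sub, ← Finset.sum_sub_distrib]
  refine (Finset.abs_sum_le_sum_abs _ _).trans ((Finset.sum_le_card_nsmul _ _ (2 * M * D)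
    fun j _ => ?_).trans_eq ?_)
  · rw [← mul_sub, abs_mul]
    exact mul_le_mul (hc j) (hD _) (abs_nonneg _) ((abs_nonneg _).trans (hc j))
  · rw [Finset.card_univ, Fintype.card_fin, nsmul_eq_mul]
    push_cast
    ring

end PiecewiseConstantPayoff

/-! ### The lattices -/

namespace Lattice

/-- The deterministic part of the logarithm of the terminal price. -/
def drift (L : Lattice) (r σ T : ℝ) : ℝ :=
  match L with
  | .crr => 0
  | .jr => (r - σ ^ 2 / 2) * T

/-- The mean of the limit of the normalized random walk. -/
def tilt (L : Lattice) (r σ T : ℝ) : ℝ :=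
  match L with
  | .crr => (r - σ ^ 2 / 2) * √T / σ
  | .jr => 0

/-- Cox–Ross–Rubinstein puts the drift into the probabilities, Jarrow–Rudd into the factors. Either
way the limiting log-return has the same mean. -/
lemma drift_add_tilt (L : Lattice) (r : ℝ) {σ T : ℝ} (hσ : 0 < σ) (hT : 0 < T) :
    L.drift r σ T + σ * √T * L.tilt r σ T = (r - σ ^ 2 / 2) * T := by
  cases L
  · simp only [drift, tilt, zero_add]
    have := Real.mul_self_sqrt hT.le
    field_simp
    rw [sq, this]
    ring
  · simp [drift, tilt]

lemma up_eq (L : Lattice) (r σ : ℝ) {T : ℝ} (hT : 0 < T) (n : ℕ) :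
    L.up r σ (T / n) = Real.exp (L.drift r σ T / n + σ * √T * (1 / √n)) := by
  cases L <;> simp only [up, drift, Real.sqrt_div hT.le] <;> congr 1 <;> ring

lemma down_eq (L : Lattice) (r σ : ℝ) {T : ℝ} (hT : 0 < T) (n : ℕ) :
    L.down r σ (T / n) = Real.exp (L.drift r σ T / n - σ * √T * (1 / √n)) := by
  cases L <;> simp only [down, drift, Real.sqrt_div hT.le] <;> congr 1 <;> ring

lemma prod_factor (L : Lattice) (r σ : ℝ) {T : ℝ} (hT : 0 < T) {n : ℕ} (hn : 0 < n)
    (y : Fin n → Bool) :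
    ∏ k, (if y k then L.up r σ (T / n) else L.down r σ (T / n)) =
      Real.exp (L.drift r σ T + σ * √T * ∑ k, if y k then 1 / √(n : ℝ) else -(1 / √(n : ℝ))) := by
  have h : ∀ k, (if y k then L.up r σ (T / n) else L.down r σ (T / n)) =
      Real.exp (L.drift r σ T / n + σ * √T * if y k then 1 / √(n : ℝ) else -(1 / √(n : ℝ))) :=
    fun k => by
    rw [L.up_eq r σ hT, L.down_eq r σ hT]
    split_ifs
    · rfl
    · congr 1
      ring
  have hn' : (n : ℝ) ≠ 0 := by exact_mod_cast hn.ne'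
  rw [Finset.prod_congr rfl fun k _ => h k, ← Real.exp_sum, Finset.sum_add_distrib,
    ← Finset.mul_sum, Finset.sum_const, Finset.card_univ, Fintype.card_fin, nsmul_eq_mul,
    mul_div_cancel₀ _ hn']

lemma up_pow_mul_down_pow (L : Lattice) (r σ : ℝ) {T : ℝ} (hT : 0 < T) {n : ℕ} (hn : 0 < n)
    {k : ℕ} (hk : k ≤ n) :
    L.up r σ (T / n) ^ k * L.down r σ (T / n) ^ (n - k) =
      Real.exp (L.drift r σ T + σ * √T * ((2 * k - n) * (1 / √n))) := by
  have hn' : (n : ℝ) ≠ 0 := by exact_mod_cast hn.ne'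
  rw [L.up_eq r σ hT, L.down_eq r σ hT, ← Real.exp_nat_mul, ← Real.exp_nat_mul, ← Real.exp_add,
    Nat.cast_sub hk]
  congr 1
  field_simp
  ring

/-- With a = σ√T and x = 1/√n, the value of 2p - 1 for Cox–Ross–Rubinstein is (2e^(rTx²) - U - D)/(U
- D). The numerator is (2rT - a²)x² + O(x³) and the denominator is at least 2ax, whence κx + O(x²)
with κa = rT - a²/2. For Jarrow–Rudd, p = 1/2 exactly. -/
lemma exists_upProb_bound (L : Lattice) (r : ℝ) {σ T : ℝ} (hσ : 0 < σ) (hT : 0 < T) :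
    ∃ (c : ℝ) (n₀ : ℕ), 0 ≤ c ∧ ∀ n : ℕ, 0 < n → n₀ ≤ n →
      0 ≤ L.upProb r σ (T / n) ∧ L.upProb r σ (T / n) ≤ 1 ∧
      |2 * L.upProb r σ (T / n) - 1 - L.tilt r σ T / √n| ≤ c / n := by
  cases L
  · set a := σ * √T with ha
    set κ := tilt .crr r σ T with hκ
    have ha0 : 0 < a := by positivity
    have hκa : κ * a = r * T - a ^ 2 / 2 := by
      have := drift_add_tilt .crr r hσ hT
      have h2 : a ^ 2 = σ ^ 2 * T := by rw [ha, mul_pow, Real.sq_sqrt hT.le]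
      simp only [drift, zero_add] at this
      rw [mul_comm, this, h2]
      ring
    set c := ((r * T) ^ 2 + a ^ 3 + |κ| * a ^ 2) / a with hc
    have hc0 : 0 ≤ c := by positivity
    -- For n beyond this, |κ|x + cx ≤ 1, which forces |2p - 1| ≤ 1, that is, p is a probability; the
    -- other summands allow the Taylor bounds for the exponentials.
    obtain ⟨n₀, hn₀⟩ := exists_nat_ge ((1 + a + |r * T| + |κ| + c) ^ 2)
    refine ⟨c, n₀, hc0, fun n hn hnn => ?_⟩
    have hn1 : (0 : ℝ) < √n := Real.sqrt_pos.2 (by exact_mod_cast hn)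
    set x : ℝ := 1 / √n with hx
    have hx0 : 0 < x := by positivity
    have hxx : x ^ 2 = 1 / n := by rw [hx, div_pow, Real.sq_sqrt (Nat.cast_nonneg _), one_pow]
    have hxs : (1 + a + |r * T| + |κ| + c) * x ≤ 1 := by
      rw [hx, mul_one_div, div_le_one hn1]
      refine Real.le_sqrt_of_sq_le (hn₀.trans ?_)
      exact_mod_cast hnn
    have hx1 : x ≤ 1 := by
      nlinarith [mul_nonneg ha0.le hx0.le, mul_nonneg (abs_nonneg (r * T)) hx0.le,
        mul_nonneg (abs_nonneg κ) hx0.le, mul_nonneg hc0 hx0.le]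
    have hax : a * x ≤ 1 := by
      nlinarith [mul_nonneg (abs_nonneg (r * T)) hx0.le,
        mul_nonneg (abs_nonneg κ) hx0.le, mul_nonneg hc0 hx0.le]
    have hrx : |r * T| * x ≤ 1 := by
      nlinarith [mul_nonneg ha0.le hx0.le,
        mul_nonneg (abs_nonneg κ) hx0.le, mul_nonneg hc0 hx0.le]
    have hkx : |κ| * x + c * x ≤ 1 := by
      nlinarith [mul_nonneg ha0.le hx0.le, mul_nonneg (abs_nonneg (r * T)) hx0.le]
    have hp : upProb .crr r σ (T / n) =
        (Real.exp (r * T * x ^ 2) - Real.exp (-(a * x))) /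
          (Real.exp (a * x) - Real.exp (-(a * x))) := by
      have e1 : r * (T / n) = r * T * x ^ 2 := by rw [hxx]; ring
      have e2 : σ * (√T / √n) = a * x := by rw [ha, hx]; ring
      simp only [upProb, up, down, Real.sqrt_div hT.le, e1, e2]
    have hE : |Real.exp (r * T * x ^ 2) - 1 - r * T * x ^ 2| ≤ (r * T) ^ 2 * x ^ 3 := by
      have h1 : |r * T * x ^ 2| ≤ 1 := by
        rw [abs_mul, abs_of_nonneg (sq_nonneg x)]
        nlinarith [abs_nonneg (r * T), mul_nonneg (abs_nonneg (r * T)) hx0.le]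
      refine (Real.abs_exp_sub_one_sub_id_le h1).trans ?_
      rw [mul_pow, ← pow_mul]
      exact mul_le_mul_of_nonneg_left (pow_le_pow_of_le_one hx0.le hx1 (by norm_num))
        (sq_nonneg _)
    have hax0 : 0 < a * x := by positivity
    have hU := Real.exp_bound (x := a * x) (by rwa [abs_of_pos hax0]) (n := 3) (by norm_num)
    have hD := Real.exp_bound (x := -(a * x)) (by rwa [abs_neg, abs_of_pos hax0]) (n := 3)
      (by norm_num)
    rw [abs_neg] at hD
    rw [abs_of_pos hax0] at hU hD
    simp only [Finset.sum_range_succ, Finset.sum_range_zero, Nat.factorial] at hU hD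
    norm_num at hU hD
    set P := Real.exp (r * T * x ^ 2) with hP
    set U := Real.exp (a * x) with hU'
    set D := Real.exp (-(a * x)) with hD'
    have hUD : 2 * (a * x) ≤ U - D := by
      have h1 := Real.self_le_sinh_iff.2 hax0.le
      rw [Real.sinh_eq] at h1
      linarith
    have hUD0 : 0 < U - D := by linarith
    have hmain : |2 * upProb .crr r σ (T / n) - 1 - κ * x| ≤ c * x ^ 2 := by
      have e : 2 * upProb .crr r σ (T / n) - 1 - κ * x =
          (2 * P - U - D - κ * x * (U - D)) / (U - D) := by
        rw [hp]
        field_simp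
        ring
      rw [e, abs_div, abs_of_pos hUD0, div_le_iff₀ hUD0]
      have hsinh : |U - D - 2 * (a * x)| ≤ 2 * (a * x) ^ 3 := by
        have h1 := abs_le.1 hU
        have h2 := abs_le.1 hD
        have : 0 < (a * x) ^ 3 := by positivity
        exact abs_le.2 ⟨by linarith, by linarith⟩
      have hk : |κ * x * (U - D - 2 * (a * x))| ≤ 2 * (|κ| * a ^ 2 * x ^ 3) := by
        rw [abs_mul, abs_mul, abs_of_pos hx0]
        calc |κ| * x * |U - D - 2 * (a * x)| ≤ |κ| * x * (2 * (a * x) ^ 3) := by gcongr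
          _ = 2 * (|κ| * a ^ 2 * x ^ 3) * (a * x) := by ring
          _ ≤ 2 * (|κ| * a ^ 2 * x ^ 3) * 1 := by gcongr
          _ = _ := mul_one _
      have hnum : |2 * P - U - D - κ * x * (U - D)| ≤ 2 * (c * a * x ^ 3) := by
        have hca : c * a = (r * T) ^ 2 + a ^ 3 + |κ| * a ^ 2 := by
          rw [hc]
          field_simp
        rw [hca]
        have h1 := abs_le.1 hU
        have h2 := abs_le.1 hD
        have h3 := abs_le.1 hE
        have h4 := abs_le.1 hk
        have h5 : κ * x * (U - D - 2 * (a * x)) = κ * x * (U - D) - 2 * (κ * a) * x ^ 2 := by ring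
        rw [h5, hκa] at h4
        have : 0 < (a * x) ^ 3 := by positivity
        exact abs_le.2 ⟨by linarith, by linarith⟩
      calc _ ≤ _ := hnum
        _ = c * x ^ 2 * (2 * (a * x)) := by ring
        _ ≤ _ := by gcongr
    have hfin : |2 * upProb .crr r σ (T / n) - 1| ≤ 1 := by
      have h1 : |2 * upProb .crr r σ (T / n) - 1| ≤ c * x ^ 2 + |κ * x| := by
        have := abs_add_le (2 * upProb .crr r σ (T / n) - 1 - κ * x) (κ * x)
        rw [sub_add_cancel] at this
        linarith
      rw [abs_mul, abs_of_pos hx0] at h1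
      nlinarith [mul_nonneg hc0 hx0.le]
    have hfin' := abs_le.1 hfin
    refine ⟨by linarith [hfin'.1], by linarith [hfin'.2], ?_⟩
    rwa [hxx, hx, mul_one_div, mul_one_div] at hmain
  · refine ⟨0, 0, le_rfl, fun n _ _ => ?_⟩
    norm_num [upProb, tilt]

/-- Convergence of the binomial model, with a rate. -/
lemma exists_binomialExpectation_bound (L : Lattice) (r : ℝ) {σ T : ℝ} (hσ : 0 < σ) (hT : 0 < T) :
    ∃ (C : ℝ) (n₀ : ℕ), 0 ≤ C ∧ ∀ n : ℕ, 0 < n → n₀ ≤ n →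
      L.upProb r σ (T / n) ∈ Set.Icc (0 : ℝ) 1 ∧
      ∀ (m : ℕ) (ψ : PiecewiseConstantPayoff m) (M : ℝ), (∀ j, |ψ.value j| ≤ M) →
      ∀ s, 0 < s → ∀ δ, 0 < δ → δ ≤ 1 →
      |binomialExpectation L r σ T n ψ.eval s -
        ∫ y, ψ.eval (s * Real.exp (L.drift r σ T + σ * √T * y)) ∂gaussianReal (L.tilt r σ T) 1| ≤
        2 * M * (m + 1) * (δ + C / (δ ^ 3 * √n)) := by
  obtain ⟨c, n₀, hc, h1⟩ := L.exists_upProb_bound r hσ hT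
  obtain ⟨C, hC, h2⟩ := exists_walk_sub_gaussianTail_le (L.tilt r σ T) c hc
  refine ⟨C, n₀, hC, fun n hn hnn => ?_⟩
  obtain ⟨hp0, hp1, hp⟩ := h1 n hn hnn
  refine ⟨⟨hp0, hp1⟩, fun m ψ M hM s hs δ hδ0 hδ1 => ?_⟩
  have hw : ∑ y : Fin n → Bool, (∏ k, if y k then L.upProb r σ (T / n)
      else 1 - L.upProb r σ (T / n)) = 1 := by
    have := coinMean_const (κ := Fin n) (fun _ => L.upProb r σ (T / n)) 1
    simpa only [coinMean, coinProb, mul_one] using this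
  have := ψ.abs_mean_sub_le hM hs (L.drift r σ T) (show 0 < σ * √T by positivity) Finset.univ _
    (fun y : Fin n → Bool => ∑ k, if y k then 1 / √(n : ℝ) else -(1 / √(n : ℝ))) hw
    fun τ => h2 n _ hn hp0 hp1 hp τ δ hδ0 hδ1
  simpa only [binomialExpectation, L.prod_factor r σ hT hn] using this

end Lattice

/-! ### Geometric Brownian motion -/

lemma gaussianReal_tilt_eq_map {T : ℝ≥0} (hT : 0 < T) (κ : ℝ) :
    gaussianReal κ 1 = (gaussianReal 0 T).map fun w => (√(T : ℝ))⁻¹ * w + κ := by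
  have h1 : Measurable fun w : ℝ => (√(T : ℝ))⁻¹ * w := measurable_const_mul _
  have : (fun w : ℝ => (√(T : ℝ))⁻¹ * w + κ) = (fun y => y + κ) ∘ fun w => (√(T : ℝ))⁻¹ * w := rfl
  rw [this, ← Measure.map_map (measurable_add_const _) h1, gaussianReal_map_const_mul,
    gaussianReal_map_add_const]
  congr 1
  · ring
  · ext
    have hT' : (T : ℝ) ≠ 0 := by exact_mod_cast hT.ne'
    simp only [NNReal.coe_one, NNReal.coe_mul]
    change 1 = (√(T : ℝ))⁻¹ ^ 2 * (T : ℝ)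
    rw [inv_pow, Real.sq_sqrt T.coe_nonneg]
    field_simp

lemma integral_initialLaw {q : ℕ} (V : InitialOracle q) (price : (Fin q → Bool) → ℝ) (f : ℝ → ℝ) :
    ∫ s, f s ∂initialLaw V price = ∑ i, initialProb V i * f (price i) := by
  rw [initialLaw, integral_finsetSum_measure]
  · refine Finset.sum_congr rfl fun i _ => ?_
    rw [integral_smul_measure, integral_dirac, ENNReal.toReal_ofReal (initialProb_nonneg V i),
      smul_eq_mul]
  · intro i _
    exact (integrable_dirac (by simp)).smul_measure ENNReal.ofReal_ne_top

/-- The option price in the model of geometric Brownian motion. -/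
lemma integral_geometricBrownianMotion (L : Lattice) (r : ℝ) {σ : ℝ} {T : ℝ≥0} (hσ : 0 < σ)
    (hT : 0 < T) {m : ℕ} (ψ : PiecewiseConstantPayoff m) {q : ℕ} (V : InitialOracle q)
    (price : (Fin q → Bool) → ℝ) {Ω : Type*} [MeasurableSpace Ω] (μ : Measure Ω)
    [IsProbabilityMeasure μ] (W : ℝ≥0 → Ω → ℝ) (S₀ : Ω → ℝ) (hW : IsBrownianReal W μ)
    (hS : HasLaw S₀ (initialLaw V price) μ) (hind : IndepFun S₀ (fun ω t => W t ω) μ) :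
    ∫ ω, Real.exp (-(r * T)) * ψ.eval (geometricBrownianMotion r σ S₀ W T ω) ∂μ =
      ∑ i, initialProb V i * (Real.exp (-(r * T)) * ∫ y, ψ.eval (price i *
        Real.exp (L.drift r σ T + σ * √T * y)) ∂gaussianReal (L.tilt r σ T) 1) := by
  have hWT : HasLaw (W T) (gaussianReal 0 T) μ := hW.toIsPreBrownianReal.hasLaw_eval T
  have hind' : IndepFun S₀ (W T) μ := hind.comp measurable_id (measurable_pi_apply T)
  have hmap := (indepFun_iff_map_prod_eq_prod_map_map hS.aemeasurable hWT.aemeasurable).1 hind'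
  rw [hS.map_eq, hWT.map_eq] at hmap
  have : IsProbabilityMeasure (initialLaw V price) :=
    hS.map_eq ▸ Measure.isProbabilityMeasure_map hS.aemeasurable
  set g : ℝ × ℝ → ℝ := fun z => ψ.eval (z.1 * Real.exp ((r - σ ^ 2 / 2) * T + σ * z.2)) with hg
  have hgm : Measurable g := ψ.measurable_eval.comp (by fun_prop)
  obtain ⟨M, hM⟩ : ∃ M, ∀ j, |ψ.value j| ≤ M := by
    obtain ⟨M, hM⟩ := (Set.finite_range fun j => |ψ.value j|).bddAbove
    exact ⟨M, fun j => hM ⟨j, rfl⟩⟩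
  have h1 : ∫ ω, ψ.eval (geometricBrownianMotion r σ S₀ W T ω) ∂μ =
      ∫ z, g z ∂(initialLaw V price).prod (gaussianReal 0 T) := by
    rw [← hmap, integral_map (hS.aemeasurable.prodMk hWT.aemeasurable) hgm.aestronglyMeasurable]
    rfl
  rw [integral_const_mul, h1, integral_prod _ (Integrable.of_bound hgm.aestronglyMeasurable M
    (Filter.Eventually.of_forall fun z => ψ.abs_eval_le hM _)), integral_initialLaw,
    Finset.mul_sum]
  refine Finset.sum_congr rfl fun i _ => ?_
  rw [mul_left_comm]
  congr 2
  have hT' : (0 : ℝ) < T := by exact_mod_cast hT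
  have hm : Measurable fun y => ψ.eval (price i * Real.exp (L.drift r σ T + σ * √T * y)) :=
    ψ.measurable_eval.comp (by fun_prop)
  rw [gaussianReal_tilt_eq_map hT, integral_map (by fun_prop) hm.aestronglyMeasurable]
  refine integral_congr_ae (Filter.Eventually.of_forall fun w => ?_)
  simp only [hg]
  congr 3
  have h2 := L.drift_add_tilt r hσ hT'
  have h3 : √(T : ℝ) ≠ 0 := (Real.sqrt_pos.2 hT').ne'
  rw [← h2]
  field_simp
  ring

end

end OptionPricing

namespace OptionPricing

noncomputable section

/-! ### The circuit -/

/-- The number of coins. -/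
def coinCount (b w : ℕ) : ℕ := 1 + (b + (b * b + w))

lemma card_coins (b w : ℕ) : Fintype.card (Coins b w) = coinCount b w := by
  simp [coinCount]

/-- A bound for the number of gates of the circuit. -/
def circuitCost (q t w b n ow : ℕ) : ℕ :=
  coinCount b w + 1 + n * (2 ^ n * ((1 + (w + b * b) * (2 * xorCost 4) + 2 + 2 * (t * xorCost 2)) +
    (diagCost 2 + (q + coinCount b w) * (2 * xorCost 2)) + 2 * (coinCount b w + 1)) +
    diagCost n + 2) + ow * xorCost n

/-- The circuit that estimates the probability of the flag and decodes the estimate. -/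
lemma exists_flag_circuit (q t w b n ow H : ℕ) {lam : ℝ} (hlam : 0 ≤ lam)
    (dec : ℝ → Fin ow → Bool) :
    ∃ (N : ℕ) (gs : List (Gate q t w N)) (out : Fin ow ↪ Fin N),
      gs.length ≤ circuitCost q t w b n ow ∧
      ∀ (V : InitialOracle q) (tb : Table q t w) (a : ℝ),
        predProb (prepare (coinBias (b := b) (w := w) lam) V (zeroState _)) (flag H tb) = a →
        0 < a → a < 1 → ∀ η : ℝ, 0 < η → (1 + (n : ℝ) / 2) / 2 ^ n / η ≤ 1 / 100 →
        ∀ (Good : (Fin ow → Bool) → Prop)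
          [DecidablePred Good],
        (∀ x, |x - a| ≤ η → Good (dec x)) →
        99 / 100 ≤ ∑ x : Fin N → Bool, if Good (x ∘ out) then
          ‖gs.foldl (fun φ g => g.apply V tb φ) (Pi.single (fun _ => false) 1) x‖ ^ 2 else 0 := by
  set L := max (w + b * b) (Fintype.card (Fin q ⊕ Coins b w)) with hL
  have e : Qubit q t w b n L ow ≃ Fin (Fintype.card (Qubit q t w b n L ow)) :=
    Fintype.equivFin _
  let o : Fin ow ↪ Anc t w L ow := ⟨fun j => Sum.inr (Sum.inr (Sum.inr j)), fun i j h => by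
    simpa using h⟩
  have : Nonempty (Qubit q t w b n L ow) := ⟨qCoin cSign⟩
  obtain ⟨gs, hlen, hgs⟩ := exists_estimation_circuit e o (coinBias_mem hlam)
    (impl_flag e H (le_max_left _ _)) (impl_reflect e (le_max_right _ _))
    (fun y => dec (Real.cos (outcomeAngle (pad y) n / 2) ^ 2))
  refine ⟨_, gs, ⟨fun j => e (Sum.inr (o j)), fun i j h => by simpa using h⟩, ?_, ?_⟩
  · have hc : Fintype.card (Fin q ⊕ Coins b w) = q + coinCount b w := by simp [coinCount]
    rwa [hc, card_coins] at hlen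
  · intro V tb a ha h0 h1 η hη hn Good _ hGood
    subst ha
    have := hgs V tb (sum_norm_prepared (coinBias_mem hlam) V) h0 h1 η hη hn Good
      fun y hy => hGood _ hy
    refine this.trans_eq (Finset.sum_congr rfl fun x _ => ?_)
    by_cases hx : Good fun j => x (e (Sum.inr (o j)))
    · rw [if_pos hx]
      exact (if_pos hx).symm
    · rw [if_neg hx]
      exact (if_neg hx).symm

/-- Only the number n of phase estimation bits enters exponentially. The costs 994, 154 and 52 of
the fixed-size steps are evaluated numerically. -/
lemma circuitCost_le {q t w b n ow : ℕ} {u : ℝ} (hu : 1 ≤ u) (hq : q ≤ u) (ht : t ≤ u) (hw : w ≤ u)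
    (hb : b ≤ u) (hn : n ≤ u) (how : ow ≤ u) :
    (circuitCost q t w b n ow : ℝ) ≤ 6000 * 2 ^ n * u ^ 3 := by
  have hp : (1 : ℝ) ≤ 2 ^ n := one_le_pow₀ (by norm_num)
  have hcc : (coinCount b w : ℝ) ≤ 4 * u ^ 2 := by
    rw [coinCount]
    push_cast
    have : (b : ℝ) * b ≤ u * u := by gcongr
    nlinarith
  have hbb : (b : ℝ) * b ≤ u * u := by gcongr
  have hu2 : u ≤ u ^ 2 := by nlinarith
  have h1 : ((1 + (w + b * b) * 1988 + 2 + 2 * (t * 154)) + (52 + (q + coinCount b w) * 308) +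
      2 * (coinCount b w + 1) : ℝ) ≤ 5889 * u ^ 2 := by nlinarith
  have h2 : (diagCost n : ℝ) ≤ 2 ^ n * (7 * u) := by
    rw [diagCost]
    push_cast
    gcongr
    linarith
  have h3 : (xorCost n : ℝ) ≤ 2 ^ n * (28 * u) := by
    rw [xorCost, diagCost]
    push_cast
    rw [pow_succ]
    nlinarith
  have h4 : (circuitCost q t w b n ow : ℝ) = coinCount b w + 1 + n * (2 ^ n *
      ((1 + (w + b * b) * 1988 + 2 + 2 * (t * 154)) + (52 + (q + coinCount b w) * 308) +
      2 * (coinCount b w + 1) : ℝ) + diagCost n + 2) + ow * xorCost n := by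
    rw [circuitCost, show 2 * xorCost 4 = 1988 from rfl, show xorCost 2 = 154 from rfl,
      show diagCost 2 = 52 from rfl]
    push_cast
    ring
  have h5 : (n : ℝ) * (2 ^ n *
      ((1 + (w + b * b) * 1988 + 2 + 2 * (t * 154)) + (52 + (q + coinCount b w) * 308) +
      2 * (coinCount b w + 1) : ℝ) + diagCost n + 2) ≤
      u * (2 ^ n * (5889 * u ^ 2) + 2 ^ n * (7 * u) + 2) := by
    gcongr
  have h6 : (ow : ℝ) * xorCost n ≤ u * (2 ^ n * (28 * u)) := by gcongr
  have hu3 : u ^ 2 ≤ u ^ 3 := pow_le_pow_right₀ hu (by norm_num)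
  have e1 : u ^ 2 ≤ 2 ^ n * u ^ 3 := hu3.trans (le_mul_of_one_le_left (by positivity) hp)
  have e2 : (2 : ℝ) ^ n * u ^ 2 ≤ 2 ^ n * u ^ 3 := by gcongr
  have e3 : u ≤ 2 ^ n * u ^ 3 := hu2.trans e1
  have e4 : 1 ≤ 2 ^ n * u ^ 3 := hu.trans e3
  rw [h4]
  nlinarith

end

end OptionPricing

namespace OptionPricing

noncomputable section

/-! ### The accuracy of the estimate -/

/-- The mean with respect to the discrete Gaussian weights. -/
def discreteMean (n K : ℕ) (F : Bool → ℕ → ℝ) : ℝ :=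
  (∑ s : Bool, ∑ m ∈ Finset.range K, gaussWeight n m * F s m) /
    (2 * ∑ m ∈ Finset.range K, gaussWeight n m)

lemma sum_gaussWeight_pos (n : ℕ) {K : ℕ} (hK : 0 < K) :
    0 < ∑ m ∈ Finset.range K, gaussWeight n m :=
  Finset.sum_pos (fun m _ => gaussWeight_pos n m) (by simp [hK.ne'])

lemma discreteMean_sub (n K : ℕ) (F F' : Bool → ℕ → ℝ) :
    discreteMean n K F - discreteMean n K F' = discreteMean n K fun s m => F s m - F' s m := by
  rw [discreteMean, discreteMean, discreteMean, ← sub_div]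
  simp only [mul_sub, Finset.sum_sub_distrib]

lemma discreteMean_const_mul (n K : ℕ) (c : ℝ) (F : Bool → ℕ → ℝ) :
    discreteMean n K (fun s m => c * F s m) = c * discreteMean n K F := by
  rw [discreteMean, discreteMean, ← mul_div_assoc, Finset.mul_sum]
  simp only [Finset.mul_sum, mul_left_comm]

lemma discreteMean_const (n : ℕ) {K : ℕ} (hK : 0 < K) (c : ℝ) :
    discreteMean n K (fun _ _ => c) = c := by
  have := sum_gaussWeight_pos n hK
  rw [discreteMean]
  simp only [← Finset.sum_mul, Fintype.sum_bool]
  field_simp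
  ring

lemma discreteMean_mono (n : ℕ) {K : ℕ} {F F' : Bool → ℕ → ℝ}
    (h : ∀ s, ∀ m < K, F s m ≤ F' s m) : discreteMean n K F ≤ discreteMean n K F' := by
  refine div_le_div_of_nonneg_right (Finset.sum_le_sum fun s _ => Finset.sum_le_sum fun m hm =>
    mul_le_mul_of_nonneg_left (h s m (Finset.mem_range.1 hm)) (gaussWeight_pos n m).le) ?_
  exact mul_nonneg zero_le_two (Finset.sum_nonneg fun m _ => (gaussWeight_pos n m).le)

lemma abs_discreteMean_sub_le (n : ℕ) {K : ℕ} (hK : 0 < K) {F F' : Bool → ℕ → ℝ} {c : ℝ}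
    (h : ∀ s, ∀ m < K, |F s m - F' s m| ≤ c) :
    |discreteMean n K F - discreteMean n K F'| ≤ c := by
  rw [discreteMean_sub]
  have h1 := discreteMean_mono n fun s m hm => (abs_le.1 (h s m hm)).1
  have h2 := discreteMean_mono n fun s m hm => (abs_le.1 (h s m hm)).2
  rw [discreteMean_const n hK] at h1 h2
  exact abs_le.2 ⟨h1, h2⟩

/-- The weights are normalized by this number when they are the probabilities of coins. -/
def discreteNorm (n b : ℕ) : ℝ := (1 / 2) ^ b * ∑ m ∈ Finset.range (2 ^ b), gaussWeight n m

lemma discreteNorm_pos (n b : ℕ) : 0 < discreteNorm n b :=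
  mul_pos (by positivity) (sum_gaussWeight_pos n (by positivity))

lemma discreteNorm_le_one (n b : ℕ) : discreteNorm n b ≤ 1 := by
  have h : ∑ m ∈ Finset.range (2 ^ b), gaussWeight n m ≤ 2 ^ b := by
    refine (Finset.sum_le_card_nsmul _ _ 1 fun m _ => ?_).trans_eq (by simp)
    rw [gaussWeight, Real.exp_le_one_iff, neg_nonpos]
    positivity
  calc discreteNorm n b ≤ (1 / 2) ^ b * 2 ^ b := mul_le_mul_of_nonneg_left h (by positivity)
    _ = 1 := by rw [← mul_pow]; norm_num

/-- The mean over coins with rejection is the acceptance probability times the conditional mean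
given acceptance. -/
lemma discreteNorm_mul_mean (n b : ℕ) (F : Bool → ℕ → ℝ) :
    1 / 2 * ∑ s : Bool, (1 / 2) ^ b * ∑ m ∈ Finset.range (2 ^ b), gaussWeight n m * F s m =
      discreteNorm n b * discreteMean n (2 ^ b) F := by
  have := sum_gaussWeight_pos n (K := 2 ^ b) (by positivity)
  rw [discreteNorm, discreteMean, ← Finset.mul_sum]
  field_simp

/-- The table of the payoff oracle for a lattice with `n` steps. -/
def latticeTable {q : ℕ} (n w fr : ℕ) (L : Lattice) (r σ T : ℝ) (f : ℝ → ℝ)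
    (price : (Fin q → Bool) → ℝ) : Table q n.size w := fun i k j =>
  if natOfBits k ≤ n then Int.testBit ⌊2 ^ fr * f (L.up r σ (T / n) ^ natOfBits k *
    L.down r σ (T / n) ^ (n - natOfBits k) * price i)⌋ j else false

/-- The distance between the centre of the weights and the centre of the lattice. -/
def latticeShift (n H : ℕ) : ℝ := (2 ^ (H + 1) - n) * (1 / √n)

lemma centred_point {n H m : ℕ} (hm : m < 2 ^ H) (s : Bool) :
    (2 * (centred H s m : ℝ) - n) * (1 / √n) = latticeShift n H + gaussPoint n s m := by
  cases s
  · rw [centred, latticeShift, gaussPoint, if_neg (by simp), if_neg (by simp),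
      Nat.cast_sub (by omega)]
    push_cast
    ring
  · rw [centred, latticeShift, gaussPoint, if_pos rfl, if_pos rfl]
    push_cast
    ring

/-- The payoff at the points that carry the discrete Gaussian distribution. -/
def latticePayoff (L : Lattice) (r σ T : ℝ) (n H : ℕ) (f : ℝ → ℝ) (price : ℝ) (s : Bool) (m : ℕ) :
    ℝ :=
  f (price * Real.exp (L.drift r σ T + σ * √T * (latticeShift n H + gaussPoint n s m)))

lemma latticeTable_centred {q n w fr H : ℕ} (L : Lattice) (r σ : ℝ) {T : ℝ} (hT : 0 < T)
    (f : ℝ → ℝ) (price : (Fin q → Bool) → ℝ) (i : Fin q → Bool) (hn : 0 < n) {s : Bool} {m : ℕ}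
    (hm : m < 2 ^ H) (hmn : centred H s m ≤ n) (j : Fin w) :
    latticeTable n w fr L r σ T f price i (fun l => (centred H s m).testBit l) j =
      Int.testBit ⌊2 ^ fr * latticePayoff L r σ T n H f (price i) s m⌋ j := by
  rw [latticeTable, natOfBits_testBit (hmn.trans_lt (Nat.lt_size_self n)), if_pos hmn,
    L.up_pow_mul_down_pow r σ hT hn hmn, latticePayoff, centred_point hm, mul_comm (price i)]

/-- The expectation of the rounded payoff. -/
def roundedMean {q : ℕ} (V : InitialOracle q) (L : Lattice) (r σ T : ℝ) (n H b fr : ℕ) (f : ℝ → ℝ)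
    (price : (Fin q → Bool) → ℝ) : ℝ :=
  ∑ i, initialProb V i * discreteMean n (2 ^ b) fun s m =>
    (⌊2 ^ fr * latticePayoff L r σ T n H f (price i) s m⌋ : ℝ)

section Accuracy

variable {q : ℕ} (V : InitialOracle q) (L : Lattice) (r : ℝ) {σ T : ℝ} {n H b w fr : ℕ}
  {f : ℝ → ℝ} (price : (Fin q → Bool) → ℝ)

lemma sum_initialProb_mul_le {F F' : (Fin q → Bool) → ℝ} (h : ∀ i, F i ≤ F' i) :
    ∑ i, initialProb V i * F i ≤ ∑ i, initialProb V i * F' i :=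
  Finset.sum_le_sum fun i _ => mul_le_mul_of_nonneg_left (h i) (initialProb_nonneg V i)

lemma sum_initialProb_mul_const (c : ℝ) : ∑ i, initialProb V i * c = c := by
  rw [← Finset.sum_mul, sum_initialProb, one_mul]

lemma abs_sum_initialProb_sub_le {F F' : (Fin q → Bool) → ℝ} {c : ℝ} (h : ∀ i, |F i - F' i| ≤ c) :
    |∑ i, initialProb V i * F i - ∑ i, initialProb V i * F' i| ≤ c := by
  rw [← Finset.sum_sub_distrib]
  simp only [← mul_sub]
  have h1 := sum_initialProb_mul_le V fun i => (abs_le.1 (h i)).1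
  have h2 := sum_initialProb_mul_le V fun i => (abs_le.1 (h i)).2
  rw [sum_initialProb_mul_const] at h1 h2
  exact abs_le.2 ⟨h1, h2⟩

/-- The prefactors are the acceptance probability and the selection coins; the summand 2^w comes
from offset binary. The relation is affine with known coefficients, so the estimate can be decoded.
-/
lemma predProb_flag_latticeTable (hT : 0 < T) (hn : 0 < n) (hb : b ≤ H)
    (hc : ∀ s, ∀ m < 2 ^ b, centred H s m ≤ n)
    (hw : ∀ x, -2 ^ w ≤ ⌊2 ^ fr * f x⌋ ∧ ⌊2 ^ fr * f x⌋ < 2 ^ w) :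
    predProb (prepare (coinBias (b := b) (w := w + 1) (2 / n)) V (zeroState _))
      (flag H (latticeTable n (w + 1) fr L r σ T f price)) =
      discreteNorm n b * (1 / 2) ^ (w + 1) * (roundedMean V L r σ T n H b fr f price + 2 ^ w) := by
  rw [predProb_flag (by positivity) hb]
  have h1 : ∀ i : Fin q → Bool, 1 / 2 * ∑ s : Bool, (1 / 2) ^ b * ∑ m ∈ Finset.range (2 ^ b),
      Real.exp (-(2 / (n : ℝ) * ((m : ℝ) ^ 2 + m))) * ((1 / 2) ^ (w + 1) *
        (natOfBits fun j : Fin (w + 1) => xor (latticeTable n (w + 1) fr L r σ T f price i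
          (fun l => (centred H s m).testBit l) j) (decide ((j : ℕ) + 1 = w + 1)) : ℝ)) =
      discreteNorm n b * (1 / 2) ^ (w + 1) * (discreteMean n (2 ^ b) (fun s m =>
        (⌊2 ^ fr * latticePayoff L r σ T n H f (price i) s m⌋ : ℝ)) + 2 ^ w) := by
    intro i
    have h2 : discreteMean n (2 ^ b) (fun s m => (1 / 2) ^ (w + 1) *
        ((⌊2 ^ fr * latticePayoff L r σ T n H f (price i) s m⌋ : ℝ) - -2 ^ w)) =
        (1 / 2) ^ (w + 1) * (discreteMean n (2 ^ b) (fun s m =>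
        (⌊2 ^ fr * latticePayoff L r σ T n H f (price i) s m⌋ : ℝ)) + 2 ^ w) := by
      rw [discreteMean_const_mul, ← discreteMean_sub, discreteMean_const n (by positivity)]
      ring
    rw [mul_assoc, ← h2, ← discreteNorm_mul_mean]
    congr 1
    refine Finset.sum_congr rfl fun s _ => ?_
    congr 1
    refine Finset.sum_congr rfl fun m hm => ?_
    have hm' := Finset.mem_range.1 hm
    rw [gaussWeight]
    congr 2
    simp only [latticeTable_centred L r σ hT f price i hn
      (hm'.trans_le (Nat.pow_le_pow_right (by norm_num) hb)) (hc s m hm')]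
    have h3 := natOfBits_offset (x := ⌊2 ^ fr * latticePayoff L r σ T n H f (price i) s m⌋)
      (hw _).1 (hw _).2
    rw [sub_neg_eq_add]
    exact_mod_cast h3
  simp only [h1]
  have h4 : ∀ i, initialProb V i * (discreteNorm n b * (1 / 2) ^ (w + 1) *
      (discreteMean n (2 ^ b) (fun s m =>
        (⌊2 ^ fr * latticePayoff L r σ T n H f (price i) s m⌋ : ℝ)) + 2 ^ w)) =
      discreteNorm n b * (1 / 2) ^ (w + 1) * (initialProb V i * discreteMean n (2 ^ b) (fun s m =>
        (⌊2 ^ fr * latticePayoff L r σ T n H f (price i) s m⌋ : ℝ)) + initialProb V i * 2 ^ w) :=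
    fun i => by ring
  simp only [h4]
  rw [← Finset.mul_sum, Finset.sum_add_distrib, sum_initialProb_mul_const, roundedMean]

/-- The rounded payoff lies strictly inside the range of the fixed-point format. -/
lemma roundedMean_mem {B : ℝ} (hB : ∀ x, |(⌊2 ^ fr * f x⌋ : ℝ)| ≤ B) :
    |roundedMean V L r σ T n H b fr f price| ≤ B := by
  have := abs_sum_initialProb_sub_le V (F' := fun _ => 0) (F := fun i =>
    discreteMean n (2 ^ b) fun s m => (⌊2 ^ fr * latticePayoff L r σ T n H f (price i) s m⌋ : ℝ))
    (c := B) fun i => by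
      have := abs_discreteMean_sub_le n (K := 2 ^ b) (by positivity) (F' := fun _ _ => 0)
        (F := fun s m => (⌊2 ^ fr * latticePayoff L r σ T n H f (price i) s m⌋ : ℝ)) (c := B)
        fun s m _ => by
          rw [sub_zero]
          exact hB _
      rwa [discreteMean_const n (by positivity)] at this
  simpa [roundedMean] using this

/-- The expectation of the rounded payoff is close to the option price. -/
lemma abs_roundedMean_sub_le (hσ : 0 < σ) (hT : 0 < T) {m : ℕ} (ψ : PiecewiseConstantPayoff m)
    {M D : ℝ} (hM : ∀ j, |ψ.value j| ≤ M) (hprice : ∀ i, 0 < price i)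
    (hD : ∀ τ, |discreteMean n (2 ^ b) (fun s m => if τ ≤ latticeShift n H + gaussPoint n s m
      then 1 else 0) - gaussianTail (L.tilt r σ T) τ| ≤ D) :
    |roundedMean V L r σ T n H b fr ψ.eval price / 2 ^ fr - ∑ i, initialProb V i *
      ∫ y, ψ.eval (price i * Real.exp (L.drift r σ T + σ * √T * y)) ∂gaussianReal (L.tilt r σ T) 1| ≤
      1 / 2 ^ fr + 2 * M * (m + 1) * D := by
  have e : roundedMean V L r σ T n H b fr ψ.eval price / 2 ^ fr = ∑ i, initialProb V i *
      discreteMean n (2 ^ b) fun s k =>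
        1 / 2 ^ fr * (⌊2 ^ fr * latticePayoff L r σ T n H ψ.eval (price i) s k⌋ : ℝ) := by
    rw [roundedMean, Finset.sum_div]
    refine Finset.sum_congr rfl fun i _ => ?_
    rw [discreteMean_const_mul]
    ring
  rw [e]
  refine abs_sum_initialProb_sub_le V fun i => ?_
  refine (abs_sub_le _ (discreteMean n (2 ^ b)
    (latticePayoff L r σ T n H ψ.eval (price i))) _).trans (add_le_add ?_ ?_)
  · refine abs_discreteMean_sub_le n (by positivity) fun s k _ => ?_
    set x := latticePayoff L r σ T n H ψ.eval (price i) s k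
    have h1 := Int.floor_le ((2 : ℝ) ^ fr * x)
    have h2 := Int.lt_floor_add_one ((2 : ℝ) ^ fr * x)
    have hp : (0 : ℝ) < 2 ^ fr := by positivity
    rw [show 1 / (2 : ℝ) ^ fr * (⌊(2 : ℝ) ^ fr * x⌋ : ℝ) - x =
      (⌊(2 : ℝ) ^ fr * x⌋ - 2 ^ fr * x : ℝ) / 2 ^ fr by field_simp, abs_div, abs_of_pos hp]
    refine div_le_div_of_nonneg_right ?_ hp.le
    exact abs_le.2 ⟨by linarith, by linarith⟩
  · have hG := sum_gaussWeight_pos n (K := 2 ^ b) (by positivity)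
    have hprod : ∀ F : Bool → ℕ → ℝ, ∑ p ∈ Finset.univ ×ˢ Finset.range (2 ^ b),
        gaussWeight n p.2 / (2 * ∑ m ∈ Finset.range (2 ^ b), gaussWeight n m) * F p.1 p.2 =
        discreteMean n (2 ^ b) F := fun F => by
      rw [Finset.sum_product, discreteMean, Finset.sum_div]
      refine Finset.sum_congr rfl fun s _ => ?_
      rw [Finset.sum_div]
      exact Finset.sum_congr rfl fun k _ => by ring
    have h1 := hprod fun _ _ => 1
    rw [discreteMean_const n (by positivity)] at h1
    simp only [mul_one] at h1
    have := ψ.abs_mean_sub_le hM (hprice i) (L.drift r σ T) (show 0 < σ * √T by positivity)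
      (Finset.univ ×ˢ Finset.range (2 ^ b))
      (fun p => gaussWeight n p.2 / (2 * ∑ m ∈ Finset.range (2 ^ b), gaussWeight n m))
      (fun p => latticeShift n H + gaussPoint n p.1 p.2) h1 (κ := L.tilt r σ T) (D := D)
      fun τ => by
        rw [hprod fun s k => if τ ≤ latticeShift n H + gaussPoint n s k then 1 else 0]
        exact hD τ
    rwa [hprod fun s k => ψ.eval (price i * Real.exp (L.drift r σ T + σ * √T *
      (latticeShift n H + gaussPoint n s k)))] at this

end Accuracy

/-- The discrete Gaussian distribution with a shifted centre. -/
lemma abs_discreteMean_sub_gaussianTail_le {n : ℕ} (hn : 0 < n) (b H : ℕ) (κ τ : ℝ) :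
    |discreteMean n (2 ^ b) (fun s m => if τ ≤ latticeShift n H + gaussPoint n s m then 1 else 0) -
      gaussianTail κ τ| ≤ 8 * 2 ^ b / n + 2 / √n + 8 * Real.exp (-(2 * 2 ^ b * (1 / √n))) +
        |latticeShift n H - κ| := by
  have h1 := abs_discrete_gaussian_sub_le hn (K := 2 ^ b) (by positivity) (τ - latticeShift n H)
  have h2 := abs_gaussianTail_sub_le 0 (τ - latticeShift n H) (τ - κ)
  have h3 : gaussianTail κ τ = gaussianTail 0 (τ - κ) := by
    have : gaussianReal κ 1 = (gaussianReal 0 1).map fun x => x + κ := by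
      rw [gaussianReal_map_add_const, zero_add]
    rw [gaussianTail, gaussianTail, this, map_measureReal_apply (measurable_add_const _)
      measurableSet_Ici]
    congr 1
    ext x
    simp
  simp only [sub_le_iff_le_add'] at h1
  push_cast at h1
  rw [h3, discreteMean]
  refine (abs_sub_le _ (gaussianTail 0 (τ - latticeShift n H)) _).trans (add_le_add h1 ?_)
  refine h2.trans_eq ?_
  rw [abs_sub_comm]
  congr 1
  ring

end

end OptionPricing

namespace OptionPricing

noncomputable section

/-! ### The choice of the parameters -/

lemma exists_two_pow_near {x : ℝ} (hx : 1 ≤ x) :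
    ∃ k : ℕ, x ≤ 2 ^ k ∧ 2 ^ k ≤ 2 * x ∧ (k : ℝ) ≤ 1 + 2 * Real.log x := by
  obtain ⟨n, h1, h2⟩ := exists_nat_pow_near hx (show (1 : ℝ) < 2 by norm_num)
  refine ⟨n + 1, h2.le, by rw [pow_succ]; linarith, ?_⟩
  have h3 := Real.log_le_log (by positivity) h1
  rw [Real.log_pow] at h3
  have h4 := Real.log_two_gt_d9
  have h5 : (n : ℝ) * (1 / 2) ≤ n * Real.log 2 := by
    gcongr
    linarith
  push_cast
  linarith

/-- The number of steps for which the discrete Gaussian weights have the right mean. -/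
lemma exists_steps (κ : ℝ) {μ : ℕ} (hμ : 1 ≤ μ) (hx : 2 * (|κ| + 1) ≤ 2 ^ μ) :
    ∃ n : ℕ, ((2 : ℝ) ^ μ) ^ 2 / 2 ≤ n ∧ (n : ℝ) ≤ 4 * (2 ^ μ) ^ 2 ∧
      ((2 : ℝ) ^ μ) ^ 2 - (|κ| * 2 ^ μ + 1) ≤ n ∧
      |latticeShift n (2 * μ - 1) - κ| ≤ 2 * (1 + |κ| * (|κ| + 1)) / 2 ^ μ := by
  have hpow : (2 : ℝ) ^ (2 * μ - 1 + 1) = (2 ^ μ) ^ 2 := by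
    rw [← pow_mul]
    congr 1
    omega
  set x : ℝ := 2 ^ μ with hx'
  have hx1 : 1 ≤ x := one_le_pow₀ (by norm_num)
  have hfl1 := Int.floor_le (κ * x)
  have hfl2 := Int.lt_floor_add_one (κ * x)
  set z : ℤ := ⌊κ * x⌋ with hz
  have hκx : |κ * x| = |κ| * x := by rw [abs_mul, abs_of_pos (show 0 < x by linarith)]
  have h1 := abs_le.1 hκx.le
  have hz1 : |(z : ℝ)| ≤ |κ| * x + 1 := abs_le.2 ⟨by linarith, by linarith⟩
  have hz2 : |(z : ℝ)| ≤ (|κ| + 1) * x := hz1.trans (by nlinarith)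
  have hz3 : |(z : ℝ)| ≤ x ^ 2 / 2 := hz2.trans (by nlinarith)
  have hz3' := abs_le.1 hz3
  have hz1' := abs_le.1 hz1
  have hnn : (0 : ℤ) ≤ (2 ^ μ) ^ 2 - z := by
    have : (0 : ℝ) ≤ (2 ^ μ) ^ 2 - z := by nlinarith
    exact_mod_cast this
  have hn : (((((2 : ℤ) ^ μ) ^ 2 - z).toNat : ℕ) : ℝ) = x ^ 2 - z := by
    have : ((((2 : ℤ) ^ μ) ^ 2 - z).toNat : ℤ) = (2 ^ μ) ^ 2 - z := Int.toNat_of_nonneg hnn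
    have h2 : (((((2 : ℤ) ^ μ) ^ 2 - z).toNat : ℤ) : ℝ) = (((2 ^ μ) ^ 2 - z : ℤ) : ℝ) := by
      rw [this]
    push_cast at h2
    rw [← h2]
  -- With 2^(H + 1) = x² and n = x² - ⌊κx⌋, the difference 2^(H + 1) - n is κ√n up to a bounded
  -- error, as √n is within a constant of x.
  refine ⟨(((2 : ℤ) ^ μ) ^ 2 - z).toNat, ?_, ?_, ?_, ?_⟩
  · rw [hn]
    linarith
  · rw [hn]
    nlinarith
  · rw [hn]
    linarith
  · rw [latticeShift, hpow, hn, sub_sub_cancel]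
    have hge : x / 2 ≤ √(x ^ 2 - z) := Real.le_sqrt_of_sq_le (by nlinarith)
    have hs0 : 0 < √(x ^ 2 - z) := by linarith
    have hss : √(x ^ 2 - z) ^ 2 = x ^ 2 - z := Real.sq_sqrt (by nlinarith)
    set y := √(x ^ 2 - z) with hy
    have hxy : |x - y| ≤ |κ| + 1 := by
      have e : (x - y) * (x + y) = z := by
        have : (x - y) * (x + y) = x ^ 2 - y ^ 2 := by ring
        rw [this, hss]
        ring
      have h3 : |x - y| * (x + y) = |(z : ℝ)| := by
        rw [← e, abs_mul, abs_of_pos (show 0 < x + y by linarith)]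
      have h4 : |x - y| * x ≤ (|κ| + 1) * x := by
        nlinarith [mul_nonneg (abs_nonneg (x - y)) hs0.le]
      exact le_of_mul_le_mul_right h4 (by linarith)
    have e : (z : ℝ) * (1 / y) - κ = ((z - κ * x) + κ * (x - y)) / y := by
      field_simp
      ring
    rw [e, abs_div, abs_of_pos hs0]
    have h5 : |(z - κ * x) + κ * (x - y)| ≤ 1 + |κ| * (|κ| + 1) := by
      refine (abs_add_le _ _).trans (add_le_add (abs_le.2 ⟨by linarith, by linarith⟩) ?_)
      rw [abs_mul]
      gcongr
    calc _ ≤ (1 + |κ| * (|κ| + 1)) / (x / 2) := by gcongr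
      _ = _ := by field_simp

set_option maxHeartbeats 400000 in
/-- The parameters of the lattice and of the discrete Gaussian distribution. -/
lemma exists_lattice_parameters (κ : ℝ) (n₀ : ℕ) {C G : ℝ} (hC : 0 ≤ C) (hG : 1 ≤ G) :
    ∃ D : ℝ, 1 ≤ D ∧ ∀ E : ℝ, 4 ≤ E → ∃ n H b ρ : ℕ, 0 < n ∧ n₀ ≤ n ∧ b ≤ H ∧
      (∀ s, ∀ m < 2 ^ b, centred H s m ≤ n) ∧
      C / ((1 / (G * E)) ^ 3 * √n) ≤ 1 / (G * E) ∧
      8 * 2 ^ b / n + 2 / √n + 8 * Real.exp (-(2 * 2 ^ b * (1 / √n))) + |latticeShift n H - κ| ≤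
        4 * (1 / (G * E)) ∧
      1 / (16 * 2 ^ ρ) ≤ discreteNorm n b ∧
      (n.size : ℝ) ≤ D * Real.log E ∧ (b : ℝ) ≤ D * Real.log E ∧ 2 ^ ρ ≤ D * Real.log E := by
  set C₀ := Real.log (8 * G) with hC₀
  have hC₀0 : 0 ≤ C₀ := Real.log_nonneg (by linarith)
  set k := 2 * (1 + |κ| * (|κ| + 1)) with hk
  have hk0 : 0 ≤ k := by positivity
  -- The sum of all lower bounds that are needed, so that x = 2^μ ≥ Q E⁴ satisfies each of them at
  -- once. The highest power E⁴ is forced by C(GE)⁴ ≤ √n.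
  set Q := 2 * (|κ| + 1) + 2 * (C * G ^ 4) + 32 * (1 + C₀) * G + 4 * G + k * G +
    4 * (1 + C₀) + n₀ + 2 with hQ
  have p1 : 0 ≤ 2 * (|κ| + 1) := by positivity
  have p2 : 0 ≤ 2 * (C * G ^ 4) := by positivity
  have p3 : 0 ≤ 32 * (1 + C₀) * G := by positivity
  have p4 : 0 ≤ 4 * G := by positivity
  have p5 : 0 ≤ k * G := by positivity
  have p6 : 0 ≤ 4 * (1 + C₀) := by positivity
  have p7 : (0 : ℝ) ≤ n₀ := Nat.cast_nonneg _
  have hQ1 : 1 ≤ Q := by linarith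
  have hlQ : 0 ≤ Real.log Q := Real.log_nonneg hQ1
  refine ⟨21 + 4 * Real.log Q + 2 * C₀, by linarith, fun E hE => ?_⟩
  have hE0 : 0 < E := by linarith
  set X := Real.log E with hX
  have hX1 : 1 ≤ X := by
    rw [hX, Real.le_log_iff_exp_le hE0]
    linarith [Real.exp_one_lt_d9]
  have hXE : X ≤ E := (Real.log_le_sub_one_of_pos hE0).trans (by linarith)
  -- With 2^ρ ≥ log(8GE), truncation at about 2^ρ standard deviations leaves mass at most 1/(GE).
  obtain ⟨ρ, hρ1, hρ2, hρ3⟩ := exists_two_pow_near (show 1 ≤ X + C₀ by linarith)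
  have hE4 : 1 ≤ E ^ 4 := one_le_pow₀ (by linarith)
  obtain ⟨μ, hμ1, -, hμ3⟩ := exists_two_pow_near (one_le_mul_of_one_le_of_one_le hQ1 hE4)
  set x : ℝ := 2 ^ μ with hx
  set R : ℝ := 2 ^ ρ with hR
  have hR1 : 1 ≤ R := one_le_pow₀ (by norm_num)
  have hC₀E : C₀ ≤ C₀ * E := le_mul_of_one_le_right hC₀0 (by linarith)
  have hRE : R ≤ 2 * (1 + C₀) * E := by linarith
  have hbound : ∀ a : ℝ, 0 ≤ a → a ≤ Q → ∀ j ≤ 4, a * E ^ j ≤ x := fun a ha haQ j hj =>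
    (mul_le_mul haQ (pow_le_pow_right₀ (by linarith) hj) (by positivity) (by linarith)).trans hμ1
  have r1 := hbound _ p1 (by linarith) 0 (by norm_num)
  have r2 := hbound _ p2 (by linarith) 4 le_rfl
  have r3 := hbound _ p3 (by linarith) 2 (by norm_num)
  have r4 := hbound _ p4 (by linarith) 1 (by norm_num)
  have r5 := hbound _ p5 (by linarith) 1 (by norm_num)
  have r6 := hbound (2 * (|κ| + 1) + 4 * (1 + C₀)) (by linarith) (by linarith) 1 (by norm_num)
  have r7 := hbound ((n₀ : ℝ) + 2) (by linarith) (by linarith) 0 (by norm_num)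
  rw [pow_one] at r4 r5 r6
  rw [pow_zero, mul_one] at r1 r7
  have hx2 : 2 ≤ x := by linarith
  have hκE : 2 * (|κ| + 1) ≤ 2 * (|κ| + 1) * E := le_mul_of_one_le_right p1 (by linarith)
  have r6' : 2 * (R + |κ| + 1) ≤ x := by linarith
  have hxx : 2 * x ≤ x ^ 2 := by
    rw [sq]
    exact mul_le_mul_of_nonneg_right hx2 (by linarith)
  have hρμ : ρ + 1 ≤ μ := by
    have : (2 : ℝ) ^ (ρ + 1) ≤ 2 ^ μ := by
      rw [pow_succ]
      linarith [abs_nonneg κ]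
    exact (pow_le_pow_iff_right₀ (by norm_num)).1 this
  obtain ⟨n, hn1, hn2, hn3, hn4⟩ := exists_steps κ (show 1 ≤ μ by omega) r1
  have hn0 : (0 : ℝ) < n := lt_of_lt_of_le (by positivity) hn1
  have hsq1 : x / 2 ≤ √n := Real.le_sqrt_of_sq_le (by linarith)
  have hsq2 : √n ≤ 2 * x := Real.sqrt_le_iff.2 ⟨by linarith, by linarith⟩
  have hsq0 : 0 < √(n : ℝ) := Real.sqrt_pos.2 hn0
  have hKx : (2 : ℝ) ^ (μ + ρ) = x * R := pow_add _ _ _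
  have hGE : 0 < G * E := by positivity
  have hacc : 8 * 2 ^ (μ + ρ) / n + 2 / √n + 8 * Real.exp (-(2 * 2 ^ (μ + ρ) * (1 / √n))) +
      |latticeShift n (2 * μ - 1) - κ| ≤ 4 * (1 / (G * E)) := by
    have e1 : 8 * 2 ^ (μ + ρ) / n ≤ 1 / (G * E) := by
      rw [hKx, div_le_div_iff₀ hn0 hGE]
      calc 8 * (x * R) * (G * E) ≤ 8 * (x * (2 * (1 + C₀) * E)) * (G * E) := by gcongr
        _ = x * (32 * (1 + C₀) * G * E ^ 2) / 2 := by ring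
        _ ≤ x * x / 2 := by gcongr
        _ ≤ 1 * n := by linarith
    have e2 : 2 / √n ≤ 1 / (G * E) := by
      rw [div_le_div_iff₀ hsq0 hGE]
      linarith
    have e3 : 8 * Real.exp (-(2 * 2 ^ (μ + ρ) * (1 / √n))) ≤ 1 / (G * E) := by
      have h1 : X + C₀ ≤ 2 * 2 ^ (μ + ρ) * (1 / √n) := by
        refine hρ1.trans ?_
        rw [hKx, mul_one_div, le_div_iff₀ hsq0]
        linarith [mul_le_mul_of_nonneg_left hsq2 (show 0 ≤ R by linarith)]
      calc 8 * Real.exp (-(2 * 2 ^ (μ + ρ) * (1 / √n))) ≤ 8 * Real.exp (-(X + C₀)) := by gcongr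
        _ = 1 / (G * E) := by
          rw [Real.exp_neg, Real.exp_add, hX, Real.exp_log hE0, hC₀, Real.exp_log (by linarith)]
          field_simp
    have e4 : |latticeShift n (2 * μ - 1) - κ| ≤ 1 / (G * E) := by
      refine hn4.trans ?_
      rw [div_le_div_iff₀ (by linarith) hGE]
      linarith
    linarith
  have hGE4 : 1 / (G * E) ≤ 1 / 4 := by
    exact one_div_le_one_div_of_le (by norm_num) (hE.trans (le_mul_of_one_le_left hE0.le hG))
  have hlogx : Real.log (Q * E ^ 4) = Real.log Q + 4 * X := by
    rw [Real.log_mul (by linarith) (by positivity), Real.log_pow]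
    push_cast
    ring
  rw [hlogx] at hμ3
  have hlogρ : Real.log (X + C₀) ≤ X + C₀ :=
    (Real.log_le_sub_one_of_pos (by linarith)).trans (by linarith)
  have q1 : Real.log Q ≤ Real.log Q * X := le_mul_of_one_le_right hlQ hX1
  have q2 : C₀ ≤ C₀ * X := le_mul_of_one_le_right hC₀0 hX1
  -- The distances range up to 2^ρ x, where x is of the order of √n. The weights fill a fraction of
  -- order 2^(-ρ) of that range, so acceptance is only logarithmically small.
  refine ⟨n, 2 * μ - 1, μ + ρ, ρ, by exact_mod_cast hn0, ?_, by omega, ?_, ?_, hacc, ?_, ?_, ?_, ?_⟩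
  · have : (n₀ : ℝ) ≤ n := by linarith
    exact_mod_cast this
  · have hH : (2 : ℝ) ^ (2 * μ - 1) = x ^ 2 / 2 := by
      rw [eq_div_iff two_ne_zero, ← pow_succ, hx, ← pow_mul]
      congr 1
      omega
    have hmain : (2 : ℝ) ^ (2 * μ - 1) + 2 ^ (μ + ρ) ≤ n := by
      rw [hH, hKx]
      linarith [mul_le_mul_of_nonneg_left r6' (show 0 ≤ x by linarith)]
    have hmain' : 2 ^ (2 * μ - 1) + 2 ^ (μ + ρ) ≤ n := by exact_mod_cast hmain
    intro s m hm
    rw [centred]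
    split_ifs <;> omega
  · rw [div_le_div_iff₀ (by positivity) hGE, one_mul]
    have h1 : C * (G * E) ^ 4 ≤ √n := by
      rw [mul_pow]
      linarith
    calc C * (G * E) = C * (G * E) ^ 4 * (1 / (G * E)) ^ 3 := by field_simp
      _ ≤ √n * (1 / (G * E)) ^ 3 := by gcongr
      _ = _ := mul_comm _ _
  · have h1 := sum_gaussWeight_ge (n := n) (K := 2 ^ (μ + ρ)) (by exact_mod_cast hn0) (by
      push_cast
      have e1 : 4 * 2 ^ (μ + ρ) / (n : ℝ) = 8 * 2 ^ (μ + ρ) / n / 2 := by ring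
      have e2 : 0 ≤ 2 / √(n : ℝ) := by positivity
      linarith [abs_nonneg (latticeShift n (2 * μ - 1) - κ)])
    rw [discreteNorm]
    calc 1 / (16 * R) = (1 / 2) ^ (μ + ρ) * (x / 2 / 8) := by
          rw [one_div_pow, hKx]
          field_simp
          norm_num
      _ ≤ (1 / 2) ^ (μ + ρ) * (√n / 8) := by gcongr
      _ ≤ _ := by gcongr
  · have hsize : n.size ≤ 2 * μ + 3 := by
      rw [Nat.size_le]
      have : (n : ℝ) < 2 ^ (2 * μ + 3) := by
        rw [pow_add, pow_mul']
        refine hn2.trans_lt ?_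
        linarith
      exact_mod_cast this
    have : (n.size : ℝ) ≤ 2 * μ + 3 := by exact_mod_cast hsize
    linarith
  · push_cast
    linarith
  · linarith

/-- The number of qubits that phase estimation needs. -/
lemma phase_estimation_error_le {s l : ℕ} {η : ℝ} (hη : 0 < η) (hs : 100 / η ≤ 2 ^ s)
    (hl : (s : ℝ) + 2 ≤ 2 ^ l) : (1 + ((s + l : ℕ) : ℝ) / 2) / 2 ^ (s + l) / η ≤ 1 / 100 := by
  have h1 : (l : ℝ) ≤ 2 ^ l := by exact_mod_cast Nat.lt_two_pow_self.le
  have h2 : (1 + ((s + l : ℕ) : ℝ) / 2) ≤ 2 ^ l := by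
    push_cast
    linarith
  rw [div_le_iff₀ hη] at hs
  rw [div_div, div_le_iff₀ (by positivity), pow_add]
  calc _ ≤ (2 : ℝ) ^ l * 1 := by linarith
    _ ≤ 2 ^ l * (1 / 100 * (2 ^ s * η)) := by gcongr; linarith
    _ = _ := by ring

/-- The decoded estimate is close to the option price. -/
lemma abs_decode_sub_le {fr w w₁ : ℕ} {R c Rm x η ε v B : ℝ} (hR : 0 ≤ R) (hc : 0 < c)
    (hx : |x - c * (Rm + 2 ^ w)| ≤ η) (hη : R * (η / c) / 2 ^ fr ≤ ε / 4)
    (hv : |R * Rm / 2 ^ fr - v| ≤ ε / 4) (hfr : 1 / 2 ^ fr ≤ ε / 4) (hε0 : 0 < ε) (hε : ε ≤ 1)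
    (hB : |Rm| ≤ 2 ^ fr * B) (hw₁ : R * B + 3 ≤ 2 ^ w₁) :
    |(intOfBits fun j : Fin (fr + w₁ + 1) => Int.testBit ⌊R * (x / c - 2 ^ w)⌋ j : ℝ) / 2 ^ fr -
      v| ≤ ε := by
  have hp : (0 : ℝ) < 2 ^ fr := by positivity
  have hp1 : (1 : ℝ) ≤ 2 ^ fr := one_le_pow₀ (by norm_num)
  have h1 : |R * (x / c - 2 ^ w) - R * Rm| ≤ ε / 4 * 2 ^ fr := by
    rw [div_le_iff₀ hp] at hη
    rw [← mul_sub, abs_mul, abs_of_nonneg hR]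
    refine le_trans ?_ hη
    gcongr
    rw [show x / c - 2 ^ w - Rm = (x - c * (Rm + 2 ^ w)) / c by field_simp; ring, abs_div,
      abs_of_pos hc]
    gcongr
  set y := R * (x / c - 2 ^ w) with hy
  have hf1 := Int.floor_le y
  have hf2 := Int.lt_floor_add_one y
  have hRm : |R * Rm| ≤ 2 ^ fr * (R * B) := by
    rw [abs_mul, abs_of_nonneg hR]
    calc R * |Rm| ≤ R * (2 ^ fr * B) := by gcongr
      _ = _ := by ring
  have hpow : (2 : ℝ) ^ (fr + w₁) = 2 ^ fr * 2 ^ w₁ := pow_add _ _ _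
  have hbig : 2 ^ fr * (R * B) + 3 * 2 ^ fr ≤ 2 ^ (fr + w₁) := by
    rw [hpow]
    nlinarith
  have h1' := abs_le.1 h1
  have hRm' := abs_le.1 hRm
  have hε2 : ε / 4 * 2 ^ fr ≤ 2 ^ fr := by nlinarith
  have hlow : -2 ^ (fr + w₁) ≤ ⌊y⌋ := by
    have : (-2 ^ (fr + w₁) : ℝ) ≤ ⌊y⌋ := by linarith
    exact_mod_cast this
  have hupp : ⌊y⌋ < 2 ^ (fr + w₁) := by
    have : (⌊y⌋ : ℝ) < 2 ^ (fr + w₁) := by linarith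
    exact_mod_cast this
  rw [intOfBits_testBit hlow hupp]
  -- One quarter of ε for phase estimation and one for rounding the output; the third quarter is the
  -- distance of the model from v.
  have e1 : |(⌊y⌋ : ℝ) / 2 ^ fr - R * Rm / 2 ^ fr| ≤ ε / 4 + ε / 4 := by
    rw [← sub_div, abs_div, abs_of_pos hp, div_le_iff₀ hp]
    rw [div_le_iff₀ hp] at hfr
    exact abs_le.2 ⟨by linarith, by linarith⟩
  refine (abs_sub_le _ (R * Rm / 2 ^ fr) _).trans ?_
  linarith

end

end OptionPricing

namespace OptionPricing

noncomputable section

/-! ### Quantum option pricing -/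

/-- The numbers of digits and the number of qubits of phase estimation, with their sizes. -/
lemma exists_precision_parameters {G G₁ D : ℝ} (hG : 4 ≤ G) (hG₁ : 1 ≤ G₁) (hD : 1 ≤ D) :
    ∃ D' : ℝ, 1 ≤ D' ∧ ∀ (ε X R : ℝ), 0 < ε → ε ≤ 1 → 1 ≤ X → Real.log (1 / ε) ≤ X → 1 ≤ R →
      R ≤ D * X → ∃ fr n : ℕ, 1 / 2 ^ fr ≤ ε / G ∧
      (1 + (n : ℝ) / 2) / 2 ^ n / (ε / (G₁ * R)) ≤ 1 / 100 ∧
      (fr : ℝ) ≤ D' * X ∧ (n : ℝ) ≤ D' * X ∧ 2 ^ n ≤ D' * ε⁻¹ * X ^ 2 := by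
  have hlG : 0 ≤ Real.log G := Real.log_nonneg (by linarith)
  set c := Real.log (100 * G₁ * D) with hc
  have hGD : 1 ≤ 100 * G₁ * D := by nlinarith
  have hc0 : 0 ≤ c := Real.log_nonneg hGD
  set S := 5 + 2 * c with hS
  set P := 4 * (100 * G₁ * D) * (S + 2) with hP
  have hP0 : 0 ≤ P := by positivity
  refine ⟨(1 + 2 * Real.log G + 2) + (3 * S + 5) + P, by linarith, ?_⟩
  intro ε X R hε0 hε1 hX hεX hR1 hRX
  have hε' : 1 ≤ 1 / ε := (one_le_div hε0).2 hε1
  obtain ⟨fr, hfr1, -, hfr3⟩ := exists_two_pow_near (show 1 ≤ G * (1 / ε) by nlinarith)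
  rw [Real.log_mul (by linarith) (by positivity)] at hfr3
  have hη0 : 0 < ε / (G₁ * R) := by positivity
  have hxs : 100 / (ε / (G₁ * R)) = 100 * G₁ * R * (1 / ε) := by
    field_simp
  have hxs1 : 1 ≤ 100 / (ε / (G₁ * R)) := by
    rw [hxs]
    refine one_le_mul_of_one_le_of_one_le (one_le_mul_of_one_le_of_one_le ?_ hR1) hε'
    linarith
  have hxs2 : 100 / (ε / (G₁ * R)) ≤ 100 * G₁ * D * X * (1 / ε) := by
    rw [hxs, mul_assoc (100 * G₁) D X]
    gcongr
  obtain ⟨s, hs1, hs2, hs3⟩ := exists_two_pow_near hxs1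
  obtain ⟨l, hl1, hl2, hl3⟩ := exists_two_pow_near (show (1 : ℝ) ≤ s + 2 by
    linarith [(Nat.cast_nonneg s : (0 : ℝ) ≤ s)])
  have hlogxs : Real.log (100 / (ε / (G₁ * R))) ≤ c + X + X := by
    refine (Real.log_le_log (by linarith) hxs2).trans ?_
    rw [Real.log_mul (by positivity) (by positivity), Real.log_mul (by positivity) (by positivity)]
    have : Real.log X ≤ X := (Real.log_le_sub_one_of_pos (by linarith)).trans (by linarith)
    linarith
  have hlogl : Real.log ((s : ℝ) + 2) ≤ s + 2 :=
    (Real.log_le_sub_one_of_pos (by positivity)).trans (by linarith)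
  have hcX : c ≤ c * X := le_mul_of_one_le_right hc0 hX
  have hGX : Real.log G ≤ Real.log G * X := le_mul_of_one_le_right hlG hX
  have hPX : 0 ≤ P * X := by positivity
  have hsX : (s : ℝ) ≤ S * X := by linarith
  refine ⟨fr, s + l, ?_, phase_estimation_error_le hη0 hs1 hl1, ?_, ?_, ?_⟩
  · rw [div_le_div_iff₀ (by positivity) (by linarith)]
    rw [mul_one_div, div_le_iff₀ hε0] at hfr1
    linarith
  · linarith
  · push_cast
    linarith
  · rw [pow_add]
    have h1 : (2 : ℝ) ^ s ≤ 2 * (100 * G₁ * D * X * (1 / ε)) := by linarith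
    have h2 : (2 : ℝ) ^ l ≤ 2 * ((S + 2) * X) := by linarith
    calc (2 : ℝ) ^ s * 2 ^ l ≤ 2 * (100 * G₁ * D * X * (1 / ε)) * (2 * ((S + 2) * X)) := by
          gcongr
      _ = P * ε⁻¹ * X ^ 2 := by rw [hP]; ring
      _ ≤ _ := by
          gcongr
          linarith

/-- A circuit whose output is close to every number that is close to the discounted expectation of
the rounded payoff. -/
lemma exists_pricing_circuit (L : Lattice) (r : ℝ) {σ T : ℝ} (hT : 0 < T)
    {M : ℝ} (q : ℕ) {n H b fr nq w₀ w₁ : ℕ} {ε η : ℝ} (hn : 0 < n) (hb : b ≤ H)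
    (hc : ∀ s, ∀ m < 2 ^ b, centred H s m ≤ n) (hw₀ : M + 2 ≤ 2 ^ w₀)
    (hw₁ : Real.exp (-(r * T)) * 2 ^ w₀ + 3 ≤ 2 ^ w₁) (hε0 : 0 < ε) (hε1 : ε ≤ 1)
    (hfr : 1 / 2 ^ fr ≤ ε / 4) (hη0 : 0 < η) (hnq : (1 + (nq : ℝ) / 2) / 2 ^ nq / η ≤ 1 / 100)
    (hη : Real.exp (-(r * T)) * (η / (discreteNorm n b * (1 / 2) ^ (fr + w₀ + 1))) / 2 ^ fr ≤
      ε / 4) :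
    ∃ A : PricingCircuit q, A.steps = n ∧
      A.cost ≤ circuitCost q n.size (fr + w₀ + 1) b nq (fr + w₁ + 1) ∧
      ∀ f : ℝ → ℝ, (∀ x, |f x| ≤ M) →
      ∀ (V : InitialOracle q) (price : (Fin q → Bool) → ℝ) (v : ℝ),
        |Real.exp (-(r * T)) * roundedMean V L r σ T n H b fr f price / 2 ^ fr - v| ≤ ε / 4 →
        99 / 100 ≤ A.successProb V (A.payoffTable L r σ T f price) v ε := by
  set c := discreteNorm n b * (1 / 2) ^ (fr + w₀ + 1) with hcdef
  have hc0 : 0 < c := mul_pos (discreteNorm_pos n b) (by positivity)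
  obtain ⟨N, gs, out, hlen, hgs⟩ := exists_flag_circuit q n.size (fr + w₀ + 1) b nq (fr + w₁ + 1) H
    (lam := 2 / n) (by positivity) (fun x j => Int.testBit
      ⌊Real.exp (-(r * T)) * (x / c - 2 ^ (fr + w₀))⌋ j)
  refine ⟨⟨n, fr + w₀ + 1, fr, N, gs, fr + w₁ + 1, fr, out⟩, rfl, hlen, ?_⟩
  intro f hf V price v hv
  have hp1 : (1 : ℝ) ≤ 2 ^ fr := one_le_pow₀ (by norm_num)
  have hpow : (2 : ℝ) ^ (fr + w₀) = 2 ^ fr * 2 ^ w₀ := pow_add _ _ _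
  have hbig : 2 ^ fr * M + 2 * 2 ^ fr ≤ 2 ^ (fr + w₀) := by
    rw [hpow]
    nlinarith
  -- The margin of one keeps the probability of the flag strictly between 0 and 1, as the
  -- eigenvector decomposition requires.
  have hfloor : ∀ x, |(⌊2 ^ fr * f x⌋ : ℝ)| ≤ 2 ^ (fr + w₀) - 1 := fun x => by
    have h1 := Int.floor_le (2 ^ fr * f x)
    have h2 := Int.lt_floor_add_one (2 ^ fr * f x)
    have h3 : |2 ^ fr * f x| ≤ 2 ^ fr * M := by
      rw [abs_mul, abs_of_pos (show (0 : ℝ) < 2 ^ fr by positivity)]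
      gcongr
      exact hf x
    have h4 := abs_le.1 h3
    exact abs_le.2 ⟨by linarith, by linarith⟩
  have hrange : ∀ x, -2 ^ (fr + w₀) ≤ ⌊2 ^ fr * f x⌋ ∧ ⌊2 ^ fr * f x⌋ < 2 ^ (fr + w₀) := fun x => by
    have h1 := abs_le.1 (hfloor x)
    constructor
    · have : (-2 ^ (fr + w₀) : ℝ) ≤ ⌊2 ^ fr * f x⌋ := by linarith
      exact_mod_cast this
    · have : (⌊2 ^ fr * f x⌋ : ℝ) < 2 ^ (fr + w₀) := by linarith
      exact_mod_cast this
  have hprob := predProb_flag_latticeTable V L r (σ := σ) price hT hn hb hc hrange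
  have hmem := roundedMean_mem V L r (σ := σ) (T := T) (n := n) (H := H) (b := b) price hfloor
  have hmem' := abs_le.1 hmem
  set Rm := roundedMean V L r σ T n H b fr f price with hRm
  refine hgs V _ _ hprob (mul_pos hc0 (by linarith)) ?_ η hη0 hnq
    (fun z => |(intOfBits z : ℝ) / 2 ^ fr - v| ≤ ε) fun x hx => ?_
  · have h1 : c ≤ (1 / 2) ^ (fr + w₀ + 1) :=
      mul_le_of_le_one_left (by positivity) (discreteNorm_le_one n b)
    have h2 : (1 / 2 : ℝ) ^ (fr + w₀ + 1) * (2 * 2 ^ (fr + w₀)) = 1 := by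
      rw [← pow_succ', ← mul_pow]
      norm_num
    calc c * (Rm + 2 ^ (fr + w₀)) < c * (2 * 2 ^ (fr + w₀)) := by gcongr; linarith
      _ ≤ (1 / 2) ^ (fr + w₀ + 1) * (2 * 2 ^ (fr + w₀)) := by gcongr
      _ = 1 := h2
  · refine abs_decode_sub_le (Real.exp_nonneg _) hc0 hx hη hv hfr hε0 hε1 (B := 2 ^ w₀) ?_ hw₁
    rw [← hpow]
    linarith

/-- The expectation of the rounded payoff is close to the option prices in both models. -/
lemma roundedMean_close (L : Lattice) (r : ℝ) {σ T : ℝ} (hσ : 0 < σ) (hT : 0 < T) {m : ℕ}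
    (ψ : PiecewiseConstantPayoff m) {M : ℝ} (hM0 : 0 ≤ M) (hM : ∀ j, |ψ.value j| ≤ M) {q : ℕ}
    (V : InitialOracle q) (price : (Fin q → Bool) → ℝ) (hprice : ∀ i, 0 < price i)
    {n H b fr : ℕ} {G C ε : ℝ} (hn : 0 < n) (hG : 4 ≤ G) (hε0 : 0 < ε) (hε1 : ε ≤ 1 / 2)
    (hbin : ∀ s, 0 < s → ∀ δ, 0 < δ → δ ≤ 1 →
      |binomialExpectation L r σ T n ψ.eval s -
        ∫ y, ψ.eval (s * Real.exp (L.drift r σ T + σ * √T * y)) ∂gaussianReal (L.tilt r σ T) 1| ≤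
        2 * M * (m + 1) * (δ + C / (δ ^ 3 * √n)))
    (hCn : C / ((1 / (G * ((m + 2) / ε))) ^ 3 * √n) ≤ 1 / (G * ((m + 2) / ε)))
    (hacc : 8 * 2 ^ b / n + 2 / √n + 8 * Real.exp (-(2 * 2 ^ b * (1 / √n))) +
      |latticeShift n H - L.tilt r σ T| ≤ 4 * (1 / (G * ((m + 2) / ε))))
    (hfr : 1 / 2 ^ fr ≤ ε / G) :
    |roundedMean V L r σ T n H b fr ψ.eval price / 2 ^ fr -
      ∑ i, initialProb V i * binomialExpectation L r σ T n ψ.eval (price i)| ≤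
        (12 * M + 1) * (ε / G) ∧
    |roundedMean V L r σ T n H b fr ψ.eval price / 2 ^ fr - ∑ i, initialProb V i *
      ∫ y, ψ.eval (price i * Real.exp (L.drift r σ T + σ * √T * y)) ∂gaussianReal (L.tilt r σ T) 1| ≤
        (12 * M + 1) * (ε / G) := by
  have hm0 : (0 : ℝ) ≤ m := Nat.cast_nonneg m
  set E : ℝ := (m + 2) / ε with hE
  have hE1 : 1 ≤ E := by
    rw [hE, le_div_iff₀ hε0]
    linarith
  have hGE : (0 : ℝ) < 1 / (G * E) := one_div_pos.2 (mul_pos (by linarith) (by linarith))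
  have hGE1 : 1 / (G * E) ≤ 1 := by
    rw [div_le_one (mul_pos (by linarith) (by linarith))]
    exact one_le_mul_of_one_le_of_one_le (by linarith) hE1
  have hmε : (m + 1) * (1 / (G * E)) ≤ ε / G := by
    have h1 : (m + 1) / E ≤ ε := by
      rw [hE, div_div_eq_mul_div, div_le_iff₀ (by linarith), mul_comm]
      gcongr
      norm_num
    calc (m + 1) * (1 / (G * E)) = (m + 1) / E / G := by
          rw [mul_one_div, mul_comm G, div_div]
      _ ≤ ε / G := by gcongr
  have hRm := abs_roundedMean_sub_le V L r (n := n) (H := H) (b := b) (fr := fr) price hσ hT ψ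
    hM hprice (D := 4 * (1 / (G * E)))
    fun τ => (abs_discreteMean_sub_gaussianTail_le hn b H _ τ).trans hacc
  have hRm' : 1 / 2 ^ fr + 2 * M * (m + 1) * (4 * (1 / (G * E))) ≤
      ε / G + 8 * M * (ε / G) := by
    refine add_le_add hfr ?_
    calc 2 * M * (m + 1) * (4 * (1 / (G * E))) = 8 * M * ((m + 1) * (1 / (G * E))) := by ring
      _ ≤ _ := by gcongr
  have hB : |∑ i, initialProb V i * (∫ y, ψ.eval (price i *
      Real.exp (L.drift r σ T + σ * √T * y)) ∂gaussianReal (L.tilt r σ T) 1) -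
      ∑ i, initialProb V i * binomialExpectation L r σ T n ψ.eval (price i)| ≤
      4 * M * (ε / G) := by
    refine abs_sum_initialProb_sub_le V fun i => ?_
    rw [abs_sub_comm]
    refine (hbin (price i) (hprice i) _ hGE hGE1).trans ?_
    -- The smoothing scale is δ = 1/(GE). The number m + 1 of jumps is absorbed by E = (m + 2)/ε.
    calc 2 * M * (m + 1) * (1 / (G * E) + C / ((1 / (G * E)) ^ 3 * √n))
        ≤ 2 * M * (m + 1) * (1 / (G * E) + 1 / (G * E)) := by gcongr
      _ = 4 * M * ((m + 1) * (1 / (G * E))) := by ring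
      _ ≤ _ := by gcongr
  have hεG : 0 ≤ M * (ε / G) := mul_nonneg hM0 (div_nonneg hε0.le (by linarith))
  refine ⟨(abs_sub_le _ _ _).trans ((add_le_add (hRm.trans hRm') hB).trans_eq (by ring)), ?_⟩
  linarith

/-- The cost is the inverse accuracy up to logarithmic factors. -/
lemma circuitCost_le_polylog {q t b nq fr w₀ w₁ : ℕ} {D D' X ε : ℝ} (hD : 1 ≤ D) (hD' : 1 ≤ D')
    (hX : 1 ≤ X) (hε : 0 < ε) (ht : t ≤ D * X) (hb : b ≤ D * X) (hfr : fr ≤ D' * X)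
    (hnq : nq ≤ D' * X) (hnq2 : 2 ^ nq ≤ D' * ε⁻¹ * X ^ 2) :
    (circuitCost q t (fr + w₀ + 1) b nq (fr + w₁ + 1) : ℝ) ≤
      6000 * D' * (D + D' + w₀ + w₁ + 1) ^ 3 * ε⁻¹ * (q + X) ^ 5 := by
  have hw₀0 : (0 : ℝ) ≤ w₀ := Nat.cast_nonneg _
  have hw₁0 : (0 : ℝ) ≤ w₁ := Nat.cast_nonneg _
  set Q := D + D' + w₀ + w₁ + 1 with hQ
  have hQ1 : 1 ≤ Q := by linarith
  set Y : ℝ := q + X with hY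
  have hq0 : (0 : ℝ) ≤ q := Nat.cast_nonneg q
  have hY1 : 1 ≤ Y := by linarith
  have hXY : X ≤ Y := by linarith
  have hbound : ∀ d : ℝ, d ≤ Q → d * X ≤ Q * Y := fun d hdQ =>
    mul_le_mul hdQ hXY (by linarith) (by linarith)
  have k1 : (w₀ : ℝ) ≤ w₀ * X := le_mul_of_one_le_right hw₀0 hX
  have k2 : (w₁ : ℝ) ≤ w₁ * X := le_mul_of_one_le_right hw₁0 hX
  have h1 := circuitCost_le (q := q) (t := t) (w := fr + w₀ + 1) (b := b) (n := nq)
    (ow := fr + w₁ + 1) (u := Q * Y) (one_le_mul_of_one_le_of_one_le hQ1 hY1)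
    ((show (q : ℝ) ≤ Y by linarith).trans (le_mul_of_one_le_left (by linarith) hQ1))
    (ht.trans (hbound D (by linarith)))
    (le_trans (by push_cast; linarith) (hbound (D' + w₀ + 1) (by linarith)))
    (hb.trans (hbound D (by linarith)))
    (hnq.trans (hbound D' (by linarith)))
    (le_trans (by push_cast; linarith) (hbound (D' + w₁ + 1) (by linarith)))
  have hX2 : X ^ 2 ≤ Y ^ 2 := by gcongr
  calc _ ≤ 6000 * 2 ^ nq * (Q * Y) ^ 3 := h1
    _ ≤ 6000 * (D' * ε⁻¹ * X ^ 2) * (Q * Y) ^ 3 := by gcongr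
    _ ≤ 6000 * (D' * ε⁻¹ * Y ^ 2) * (Q * Y) ^ 3 := by gcongr
    _ = 6000 * D' * Q ^ 3 * ε⁻¹ * Y ^ 5 := by ring

/-- The error of phase estimation in the units of the output. -/
lemma phase_error_le {R₀ ε z : ℝ} (hR₀ : 0 < R₀) (hε : 0 < ε) {w₀ ρ fr : ℕ}
    (hz : 1 / (16 * 2 ^ ρ) ≤ z) :
    R₀ * (ε / (4 * (1 + R₀) * 2 ^ (w₀ + 5) * 2 ^ ρ) / (z * (1 / 2) ^ (fr + w₀ + 1))) / 2 ^ fr ≤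
      ε / 4 := by
  have h1 : R₀ / (4 * (1 + R₀)) ≤ 1 / 4 := by
    rw [div_le_div_iff₀ (by positivity) (by norm_num)]
    linarith
  calc R₀ * (ε / (4 * (1 + R₀) * 2 ^ (w₀ + 5) * 2 ^ ρ) / (z * (1 / 2) ^ (fr + w₀ + 1))) / 2 ^ fr
      ≤ R₀ * (ε / (4 * (1 + R₀) * 2 ^ (w₀ + 5) * 2 ^ ρ) /
        (1 / (16 * 2 ^ ρ) * (1 / 2) ^ (fr + w₀ + 1))) / 2 ^ fr := by gcongr
    _ = R₀ / (4 * (1 + R₀)) * ε := by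
        rw [one_div_pow, pow_add _ (fr + w₀), pow_add _ fr, pow_add _ w₀]
        field_simp
        norm_num
    _ ≤ 1 / 4 * ε := by gcongr
    _ = ε / 4 := by ring

end

end OptionPricing

theorem mainTheorem7 (L : Lattice) (r σ : ℝ) (T : ℝ≥0) (hσ : 0 < σ) (hT : 0 < T) (M : ℝ) :
    ∃ (K : ℝ) (c : ℕ), ∀ (m q : ℕ) (ε : ℝ), 0 < ε → ε ≤ 1 / 2 → ∃ A : PricingCircuit q,
      (A.cost : ℝ) ≤ K * ε⁻¹ * (q + Real.log ((m + 2) / ε)) ^ c ∧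
      0 < A.steps ∧ L.upProb r σ (T / A.steps) ∈ Set.Icc (0 : ℝ) 1 ∧
      ∀ (ψ : PiecewiseConstantPayoff m), (∀ j, |ψ.value j| ≤ M) →
      ∀ (V : Matrix.unitaryGroup (Fin q → Bool) ℂ) (price : (Fin q → Bool) → ℝ),
        (∀ i, 0 < price i) →
        (99 / 100 ≤ A.successProb V (A.payoffTable L r σ T ψ.eval price)
          (∑ i, initialProb V i *
            (Real.exp (-(r * T)) * binomialExpectation L r σ T A.steps ψ.eval (price i))) ε) ∧
        ∀ (Ω : Type*) [MeasurableSpace Ω] (μ : Measure Ω) [IsProbabilityMeasure μ]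
          (W : ℝ≥0 → Ω → ℝ) (S₀ : Ω → ℝ),
          IsBrownianReal W μ → HasLaw S₀ (initialLaw V price) μ →
          IndepFun S₀ (fun ω t => W t ω) μ →
          99 / 100 ≤ A.successProb V (A.payoffTable L r σ T ψ.eval price)
            (∫ ω, Real.exp (-(r * T)) * ψ.eval (geometricBrownianMotion r σ S₀ W T ω) ∂μ) ε := by
  have hT' : (0 : ℝ) < T := by exact_mod_cast hT
  obtain ⟨C, n₀, hC, hbin⟩ := L.exists_binomialExpectation_bound r hσ hT'
  set R₀ := Real.exp (-(r * T)) with hR₀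
  have hR₀0 : 0 < R₀ := Real.exp_pos _
  -- A negative M admits no payoff, but the circuit must still be built; the maximum also makes the
  -- estimates monotone.
  set M' := max M 0 with hM'
  have hM'0 : 0 ≤ M' := le_max_right _ _
  obtain ⟨w₀, hw₀⟩ := pow_unbounded_of_one_lt (M' + 2) (one_lt_two (α := ℝ))
  obtain ⟨w₁, hw₁⟩ := pow_unbounded_of_one_lt (R₀ * 2 ^ w₀ + 3) (one_lt_two (α := ℝ))
  -- The total model error is (12M' + 1)ε/G: 8M' from the discrete Gaussian, 4M' from the binomial
  -- law, 1 from rounding. After discounting it is at most ε/4.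
  set G := 4 * (1 + R₀) * (12 * M' + 1) with hG
  have hG4 : 4 ≤ G := by nlinarith [mul_nonneg hR₀0.le hM'0]
  set G₁ := 4 * (1 + R₀) * 2 ^ (w₀ + 5) with hG₁
  have hG₁1 : 1 ≤ G₁ := one_le_mul_of_one_le_of_one_le (by linarith) (one_le_pow₀ (by norm_num))
  obtain ⟨D, hD1, hlat⟩ := exists_lattice_parameters (L.tilt r σ T) n₀ hC
    (show 1 ≤ G by linarith)
  obtain ⟨D', hD'1, hprec⟩ := exists_precision_parameters hG4 hG₁1 hD1
  -- The exponent 5 is the cubic cost of one Grover step with all overheads, plus the square of the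
  -- logarithm in the bound for 2^nq.
  refine ⟨6000 * D' * (D + D' + w₀ + w₁ + 1) ^ 3, 5, fun m q ε hε0 hε1 => ?_⟩
  set E : ℝ := (m + 2) / ε with hE
  have hm0 : (0 : ℝ) ≤ m := Nat.cast_nonneg m
  have hE4 : 4 ≤ E := by
    rw [hE, le_div_iff₀ hε0]
    linarith
  have hE0 : 0 < E := by linarith
  obtain ⟨n, H, b, ρ, hn, hn0, hbH, hcen, hCn, hacc, hnorm, hsize, hbX, hρ⟩ := hlat E hE4
  set X := Real.log E with hX
  have hX1 : 1 ≤ X := by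
    rw [hX, Real.le_log_iff_exp_le hE0]
    linarith [Real.exp_one_lt_d9]
  have hεX : Real.log (1 / ε) ≤ X := by
    refine Real.log_le_log (by positivity) ?_
    rw [hE]
    gcongr
    linarith
  obtain ⟨fr, nq, hfr, hnq, hfrX, hnqX, hnq2⟩ := hprec ε X (2 ^ ρ) hε0 (by linarith) hX1 hεX
    (one_le_pow₀ (by norm_num)) hρ
  have hη0 : 0 < ε / (G₁ * 2 ^ ρ) := by positivity
  have hfr4 : 1 / 2 ^ fr ≤ ε / 4 := hfr.trans (by gcongr)
  obtain ⟨A, hAn, hcost, hA⟩ := exists_pricing_circuit L r (σ := σ) hT' (M := M') q hn hbH hcen hw₀.le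
    hw₁.le hε0 (by linarith) hfr4 hη0 hnq
    (phase_error_le hR₀0 hε0 hnorm)
  obtain ⟨hp, hbin'⟩ := hbin n hn hn0
  refine ⟨A, ?_, hAn ▸ hn, hAn ▸ hp, ?_⟩
  · exact (Nat.cast_le.2 hcost).trans
      (circuitCost_le_polylog hD1 hD'1 hX1 hε0 hsize hbX hfrX hnqX hnq2)
  · intro ψ hψ V price hprice
    have hψ' : ∀ j, |ψ.value j| ≤ M' := fun j => (hψ j).trans (le_max_left _ _)
    obtain ⟨hclose₁, hclose₂⟩ := roundedMean_close L r hσ hT' ψ hM'0 hψ' V price hprice hn hG4 hε0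
      hε1 (hbin' m ψ M' hψ') hCn hacc hfr
    have htot : R₀ * ((12 * M' + 1) * (ε / G)) ≤ ε / 4 := by
      have h1 : R₀ * (12 * M' + 1) ≤ G / 4 := by
        rw [hG]
        nlinarith
      calc R₀ * ((12 * M' + 1) * (ε / G)) = R₀ * (12 * M' + 1) * (ε / G) := by ring
        _ ≤ G / 4 * (ε / G) := by gcongr
        _ = ε / 4 := by field_simp
    -- The circuit succeeds for every target this close to the one number it estimates, so both
    -- prices follow from the same statement.
    have hclose : ∀ v, |roundedMean V L r σ T n H b fr ψ.eval price / 2 ^ fr - v| ≤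
        (12 * M' + 1) * (ε / G) →
        99 / 100 ≤ A.successProb V (A.payoffTable L r σ T ψ.eval price) (R₀ * v) ε := by
      intro v hv
      refine hA ψ.eval (ψ.abs_eval_le hψ') V price _ ?_
      rw [mul_div_assoc, ← mul_sub, abs_mul, abs_of_pos hR₀0]
      exact (mul_le_mul_of_nonneg_left hv hR₀0.le).trans htot
    have hfac : ∀ F : (Fin q → Bool) → ℝ, ∑ i, initialProb V i * (R₀ * F i) =
        R₀ * ∑ i, initialProb V i * F i := fun F => by
      rw [Finset.mul_sum]
      exact Finset.sum_congr rfl fun i _ => by ring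
    refine ⟨?_, fun Ω _ μ _ W S₀ hW hS hind => ?_⟩
    · rw [hfac, hAn]
      exact hclose _ hclose₁
    · rw [integral_geometricBrownianMotion L r hσ hT ψ V price μ W S₀ hW hS hind, hfac]
      exact hclose _ hclose₂
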